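/- Let $K$ be a field with algebraic closure $\bar K$, let $n\ge 4$, and let $R=K[x_1,\dots,x_{n-1}]$. Let $X\subset\mathbb P^{n-2}$ be a set of $n$ points in general position defined over $K$; that is, $X(\bar K)$ consists of $n$ points, no $n-1$ of which lie in a hyperplane, and the homogeneous ideal of $X(\bar K)$ in $\bar K[x_1,\dots,x_{n-1}]$ is generated by polynomials over $K$. Let $I\subset R$ be the homogeneous ideal of $X$, and let $F_\bullet$ be a minimal graded free resolution of $R/I$ with differentials $\phi_k:F_k\to F_{k-1}$, represented by matrices with respect to homogeneous bases. Then $F_0$ and $F_{n-2}$ have rank $1$, $F_k=0$ for $k>n-2$, the entries of $\phi_1$ and $\phi_{n-2}$ are quadratic forms, and those of $\phi_k$ for $1<k<n-2$ are linear forms (zero being allowed as an entry). Hence we may define the following (where $1\times1$ matrices are identified with their entries). For $1\le a_1,\dots,a_{n-2}\le n-1$ put $$[a_1,\dots,a_{n-2}]=\frac{\partial\phi_1}{\partial x_{a_1}}\cdots\frac{\partial\phi_{n-2}}{\partial x_{a_{n-2}}},\qquad [[a_1,\dots,a_{n-2}]]=\sum_{k=1}^{n-2}[a_{\sigma^{2k}(1)},\dots,a_{\sigma^{2k}(n-2)}],$$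 where $\sigma=(1\,2\,\dots\,n-2)$, and $\Omega_j=(-1)^j[[1,\dots,\widehat{j},\dots,n-1]]$. Writing $\phi_1=\sum_{i\le j}P(i,j)x_ix_j$ and $\phi_{n-2}=\sum_{i\le j}Q(i,j)x_ix_j$, with $P(j,i)=P(i,j)$ and $Q(j,i)=Q(i,j)$, put $$\{a_1a_2\dots a_n\}=P(a_1,a_2)\frac{\partial\phi_2}{\partial x_{a_3}}\cdots\frac{\partial\phi_{n-3}}{\partial x_{a_{n-2}}}Q(a_{n-1},a_n)\in K.$$ For distinct indices $l_1,\dots,l_s$ let $\varepsilon_{l_1\dots l_s}$ be the sign of the permutation taking $1,\dots,n-1$ to $l_1,\dots,l_s$ followed by the remaining indices in increasing order; write $\widehat{ijk}$ for the omission of $i,j,k$ from an increasing sequence. (1) For all distinct $i,j,k\in\{1,\dots,n-1\}$: $$\frac{\partial^2\Omega_k}{\partial x_i\partial x_j}=(-1)^{n+1}\varepsilon_{ijk}(2n)\{i,i,1,\dots,\widehat{ijk},\dots,n-1,j,j\},$$ $$\frac{\partial^2\Omega_j}{\partial x_i^2}=\varepsilon_{ij}(2n)\{i,i,1,\dots,\widehat{ij},\dots,n-1,i\},$$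 $$\frac{\partial^2\Omega_j}{\partial x_i\partial x_j}-\frac{\partial^2\Omega_k}{\partial x_i\partial x_k}=(-1)^{n}\varepsilon_{ijk}(2n)\{i,i,1,\dots,\widehat{ijk},\dots,n-1,j,k\},$$ $$\frac{\partial^2\Omega_i}{\partial x_i^2}-\frac{\partial^2\Omega_j}{\partial x_i\partial x_j}-\frac{\partial^2\Omega_k}{\partial x_i\partial x_k}=(-1)^{n+1}\varepsilon_{ijk}(2n)\{i,j,1,\dots,\widehat{ijk},\dots,n-1,k,i\}.$$ Suppose from now on that $2n\ne0$ in $K$, and put $c^k_{ij}=\frac1{2n}\frac{\partial^2\Omega_k}{\partial x_i\partial x_j}\in K$. (2) For all distinct $i,j,k$ the constants $c^k_{ij}$, $c^j_{ii}$, $c^j_{ij}-c^k_{ik}$ and $c^i_{ii}-c^j_{ij}-c^k_{ik}$ are equal to, respectively, $(-1)^{n+1}\varepsilon_{ijk}\{i,i,1,\dots,\widehat{ijk},\dots,n-1,j,j\}$, $\ \varepsilon_{ij}\{i,i,1,\dots,\widehat{ij},\dots,n-1,i\}$, $\ (-1)^n\varepsilon_{ijk}\{i,i,1,\dots,\widehat{ijk},\dots,n-1,j,k\}$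 and $(-1)^{n+1}\varepsilon_{ijk}\{i,j,1,\dots,\widehat{ijk},\dots,n-1,k,i\}$. If $n=4$ they are also equal to $\varepsilon_{ijk}$ times $\{jjii\}$, $\{iiik\}$, $\{iijk\}$, $\{ikij\}$ respectively; if $n=5$ and $\ell$ is the fourth index, they are also equal to $\varepsilon_{ijk\ell}$ times $\{ii\ell jj\}$, $\{\ell iiik\}$, $\{jk\ell ii\}$, $\{ij\ell ki\}$ respectively. (3) Let $S\subset K$ be a subring containing all coefficients of all entries of the $\phi_k$ (for instance $S=\mathbb Z$, $K=\mathbb Q$). Let $A$ be a commutative $K$-algebra with $K$-basis $1,\alpha_1,\dots,\alpha_{n-1}$ such that $\alpha_i\alpha_j=c^0_{ij}+\sum_{k=1}^{n-1}c^k_{ij}\alpha_k$ for some $c^0_{ij}\in K$. For each $i$ choose an index $\nu(i)\ne i$, and put $\beta_i=\alpha_i-c^{\nu(i)}_{i\,\nu(i)}$. Then the $S$-span of $1,\beta_1,\dots,\beta_{n-1}$ is an $S$-subalgebra of $A$; in particular, it is an order in $A$ when $S=\mathbb Z$ and $K=\mathbb Q$. -/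

import Mathlib

open MvPolynomial
open scoped LinearAlgebra.Projectivization

noncomputable section

namespace PointsResolution

/-! ### Sets of points in general position -/

/-- The homogeneous ideal in `k[x_1, …, x_N]` of a finite set of points of `ℙ^(N-1)` over an
extension `L` of `k`: it is generated by the homogeneous polynomials that vanish at all the
points (for a homogeneous polynomial, the choice of homogeneous coordinates is irrelevant). -/
def homIdeal (k : Type*) {L : Type*} [Field k] [Field L] [Algebra k L] {N : ℕ}
    (X : Finset (ℙ L (Fin N → L))) : Ideal (MvPolynomial (Fin N) k) :=
  Ideal.span {f | (∃ d, f.IsHomogeneous d) ∧ ∀ P ∈ X, aeval P.rep f = 0}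

/-- `X`, given by its geometric points, is a set of `N + 1` points in general position in
`ℙ^(N-1)`, defined over `K`. -/
structure IsGeneralPosition (K : Type*) [Field K] {N : ℕ}
    (X : Finset (ℙ (AlgebraicClosure K) (Fin N → AlgebraicClosure K))) : Prop where
  /-- `X` is defined over `K`: its ideal over the algebraic closure is generated by
  polynomials with coefficients in `K`. -/
  defined_over : (homIdeal K X).map (MvPolynomial.map (algebraMap K (AlgebraicClosure K))) =
    homIdeal (AlgebraicClosure K) X
  card_eq : X.card = N + 1
  /-- No subset of size `N` is contained in a hyperplane. -/
  general : ∀ T ⊆ X, T.card = N →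
    ∀ l : Module.Dual (AlgebraicClosure K) (Fin N → AlgebraicClosure K),
      (∀ P ∈ T, l P.rep = 0) → l = 0

/-! ### Minimal graded free resolutions -/

/-- A minimal graded free resolution of `R / I`, where `R = K[x_i : i ∈ σ]`, with chosen
homogeneous bases of its modules: `F_k` is free with basis elements of degrees `deg k r`, that is
`F_k = ⨁ r, R(-deg k r)`, and the matrix `φ k` represents the differential
`φ_{k+1} : F_{k+1} → F_k`. -/
structure MinFreeRes {σ K : Type*} [Field K] (I : Ideal (MvPolynomial σ K)) where
  rank : ℕ → ℕ
  deg : ∀ k, Fin (rank k) → ℤ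
  φ : ∀ k, Matrix (Fin (rank k)) (Fin (rank (k + 1))) (MvPolynomial σ K)
  /-- The complex has finite length. -/
  finite_length : ∃ l, ∀ k, l < k → rank k = 0
  /-- The differentials respect the gradings: each entry of `φ k` is zero or homogeneous, of
  degree the difference of the degrees of the two basis elements. -/
  graded : ∀ k r s, ∀ e ∈ (φ k r s).support, deg k r + (e.degree : ℤ) = deg (k + 1) s
  /-- Exactness in positive degrees. -/
  exact : ∀ k, Function.Exact (φ (k + 1)).mulVecLin (φ k).mulVecLin
  /-- The cokernel of `φ_1` is `R / I`. -/
  coker : Nonempty (((Fin (rank 0) → MvPolynomial σ K) ⧸ LinearMap.range (φ 0).mulVecLin)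
    ≃ₗ[MvPolynomial σ K] (MvPolynomial σ K ⧸ I))
  /-- Minimality: the entries of the differentials lie in the ideal of the variables. -/
  minimal : ∀ k r s, constantCoeff (φ k r s) = 0

/-- The product `D 0 (a 0) * D 1 (a 1) * ⋯ * D (t - 1) (a (t - 1))` of matrices of compatible
sizes. -/
def pathProd {S σ : Type*} [CommRing S] {ρ : ℕ → ℕ}
    (D : ∀ k, σ → Matrix (Fin (ρ k)) (Fin (ρ (k + 1))) S) :
    ∀ t : ℕ, (Fin t → σ) → Matrix (Fin (ρ 0)) (Fin (ρ t)) S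
  | 0, _ => 1
  | t + 1, a => pathProd D t (fun r => a r.castSucc) * D t (a (Fin.last t))

/-- The entry of a `1 × 1` matrix. -/
def entry {S : Type*} [CommRing S] {p q : ℕ} (M : Matrix (Fin p) (Fin q) S) : S :=
  ∑ r, ∑ s, M r s

/-! ### Sequences of indices and signs

Indices `1, …, N` are represented by `Fin N`, so the index `j` of the usual numbering is the
element of value `j - 1`. -/

/-- `1, …, N` in increasing order, with the members of `L` deleted. -/
def omitted {N : ℕ} (L : List (Fin N)) : List (Fin N) :=
  (List.finRange N).filter (fun a => a ∉ L)

/-- A list of length `t`, read as a sequence indexed by `Fin t`. -/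
def toSeq {N : ℕ} [NeZero N] (t : ℕ) (L : List (Fin N)) : Fin t → Fin N :=
  fun r => L.getD r 0

open Classical in
/-- For distinct `l_1, …, l_s`, the sign of the permutation that takes `1, …, N` to
`l_1, …, l_s` followed by the remaining indices in increasing order. -/
def eps {N : ℕ} [NeZero N] (L : List (Fin N)) : ℤ :=
  if h : Function.Bijective (toSeq N (L ++ omitted L)) then
    (Equiv.Perm.sign (Equiv.ofBijective _ h) : ℤ)
  else 0

/-! ### The symbols attached to a resolution

Throughout `n = m + 4`: there are `n - 1 = m + 3` variables, and the differentials are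
`φ_1, …, φ_{n-2}`, represented by `F.φ 0, …, F.φ (m + 1)`. -/

namespace MinFreeRes

variable {K : Type*} [Field K] {m : ℕ} {I : Ideal (MvPolynomial (Fin (m + 3)) K)}

/-- `[a_1, …, a_{n-2}] = (∂φ_1/∂x_{a_1}) ⋯ (∂φ_{n-2}/∂x_{a_{n-2}})`. -/
def bracket (F : MinFreeRes I) (a : Fin (m + 2) → Fin (m + 3)) : MvPolynomial (Fin (m + 3)) K :=
  entry (pathProd (ρ := F.rank) (fun k i => (F.φ k).map (pderiv i)) (m + 2) a)

/-- `[[a_1, …, a_{n-2}]]`, the sum of `[a_{σ^{2k}(1)}, …, a_{σ^{2k}(n-2)}]` over `1 ≤ k ≤ n - 2`,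
where `σ` is the cycle `(1 2 … n-2)`. -/
def doubleBracket (F : MinFreeRes I) (a : Fin (m + 2) → Fin (m + 3)) :
    MvPolynomial (Fin (m + 3)) K :=
  ∑ k ∈ Finset.Icc 1 (m + 2), F.bracket (fun r => a (((finRotate (m + 2)) ^ (2 * k)) r))

/-- `Ω_j = (-1)^j [[1, …, ĵ, …, n-1]]`. -/
def Omega (F : MinFreeRes I) (j : Fin (m + 3)) : MvPolynomial (Fin (m + 3)) K :=
  (-1) ^ ((j : ℕ) + 1) * F.doubleBracket (toSeq (m + 2) (omitted [j]))

/-- The matrix of the coefficients of `x_i x_j` in the entries of `φ_{k+1}`. -/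
def quadCoeff (F : MinFreeRes I) (k : ℕ) (i j : Fin (m + 3)) :
    Matrix (Fin (F.rank k)) (Fin (F.rank (k + 1))) K :=
  (F.φ k).map (coeff (Finsupp.single i 1 + Finsupp.single j 1))

/-- `{a_1 a_2 … a_n} = P(a_1, a_2) (∂φ_2/∂x_{a_3}) ⋯ (∂φ_{n-3}/∂x_{a_{n-2}}) Q(a_{n-1}, a_n)`,
where `P(i, j)` and `Q(i, j)` are the coefficient vectors of `x_i x_j` in `φ_1` and `φ_{n-2}`.
(The matrices `φ_2, …, φ_{n-3}` are linear, so their derivatives are matrices over `K`.) -/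
def brace (F : MinFreeRes I) (L : List (Fin (m + 3))) : K :=
  let a : Fin (m + 4) → Fin (m + 3) := toSeq (m + 4) L
  entry (F.quadCoeff 0 (a 0) (a 1) *
    pathProd (ρ := fun k => F.rank (k + 1))
      (fun k i => (F.φ (k + 1)).map (fun f => constantCoeff (pderiv i f))) m
      (fun r => a ((r.castSucc.castSucc.succ).succ)) *
    F.quadCoeff (m + 1) (a ((Fin.last (m + 2)).castSucc)) (a (Fin.last (m + 3))))

/-- `c^k_{ij} = (1 / 2n) ∂²Ω_k / ∂x_i ∂x_j`. -/
def structConst (F : MinFreeRes I) (i j k : Fin (m + 3)) : K :=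
  (2 * ((m + 4 : ℕ) : K))⁻¹ * constantCoeff (pderiv i (pderiv j (F.Omega k)))

end MinFreeRes

end PointsResolution

end

/-!
Over the algebraic closure, homogeneous coordinates may be chosen such that the points are the
coordinate points `e_i` and the unit point `(1 : ⋯ : 1)`; a minimal free resolution stays one after
this base change (`CyclicRes.baseChange`).

*Shape of the resolution.* The double complex `F ⊗ Λ`, with the differential of the resolution and
the Koszul differential, compares `F_p` modulo the variables with the Koszul homology of `R / I`: a
basis element of `F_p` starts a zigzag that ends in a Koszul cycle over `R / I`
(`CyclicRes.exists_zig_gen`), and this cycle is not a boundary (`CyclicRes.Zig.not_isStdBoundary`).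
The Koszul homology is elementary. The value of a cycle at a point of the set is annihilated by the
contraction with that point, hence has a primitive; the cycle is a boundary as soon as the
primitives are the values of one cochain (`IsStdCycle.isStdBoundary_of_lift`). From quadratic
cochains on, every choice of values is attained; for linear cochains there is a single obstruction,
which takes values in the field and lives in top degree; in the remaining low degrees the cycles are
few enough to be described directly. This determines the degrees of all the
basis elements (`CyclicRes.deg_eq`, `CyclicRes.deg_top`) and bounds the last rank by one. Climbing
the double complex from a form that is nonzero at just one coordinate point shows that the last module
is nonzero, and that the last differential vanishes at the coordinate points
(`CyclicRes.exists_top_gen`), as the first one does because its entries lie in the ideal.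

*The determinantal formula.* Write the differentials as matrices `φ_1(x)`, `M_1(y)`, …, `M_m(y)`,
`φ_{n-2}(z)` depending on vectors, quadratically at the ends and linearly in between. Polarising the
relations between consecutive matrices shows that the `M_r` anticommute, and that a product with
both ends polarised against the same point `b_l` is alternating in the remaining arguments
(`IsQuadraticChain.corner_swap`), so it is a multiple `γ_l` of a determinant. If the ends share no
point, there are too few points left for the middle and the product is zero
(`IsQuadraticChain.disjoint_ends`). Together these say that
`φ_1(x) M_1(y_1) ⋯ M_m(y_m) φ_{n-2}(z) = -det(β(x, z), x, y_1, …, y_m, z)`,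
where `β` is the symmetric bilinear product for which `n - 1` of the points form an orthogonal
basis with `β(b_l, b_l) = -γ_l b_l` (`IsQuadraticChain.exists_det_formula`).

*Consequences.* A brace is a polarised value of the left-hand side at standard basis vectors, so the
determinant leaves one coordinate of `β`, or a combination of such coordinates in which the diagonal
ambiguity cancels (`MinFreeRes.IsProductOf.row_one` and the lemmas after it). The second derivative
of a bracket distributes one derivative to each quadratic end; in the sum over the even powers of
the cycle each position occurs at an end exactly twice, and the extra terms add up to traces. With
`τ_i` the trace of `β(e_i, ·)`, this gives
`∂²Ω_k / ∂x_i ∂x_j = 2n β(e_i, e_j)_k - 2 τ_i δ_{jk} - 2 τ_j δ_{ik}`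
(`MinFreeRes.IsProductOf.map_pderiv_pderiv_Omega`). The traces cancel in the four combinations of
structure constants considered, and the identities descend to the base field.

*Orders.* Braces have values in every ring that contains the coefficients of the resolution.
Subtracting `c^{ν(i)}_{i ν(i)}` from `α_i` turns all structure constants with a nonzero upper index
into sums of the four combinations, and associativity then forces the constant terms of the products
to lie in the same ring (`exists_subalgebra_of_mem`).
-/

noncomputable section

namespace PointsResolution

/-! ### Koszul complexes -/

section Koszul

variable {σ : Type*}

/-- The variables of a polynomial ring are regular in every order. -/
lemma mem_span_X_of_X_mul_mem {K : Type*} [CommSemiring K] (T : Finset σ) (i : σ) (hi : i ∉ T)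
    (f : MvPolynomial σ K)
    (h : X i * f ∈ Ideal.span ((X : σ → MvPolynomial σ K) '' T)) :
    f ∈ Ideal.span ((X : σ → MvPolynomial σ K) '' T) := by
  rw [mem_ideal_span_X_image] at h ⊢
  intro e he
  obtain ⟨j, hj, hj'⟩ := h (Finsupp.single i 1 + e) (by
    rw [mem_support_iff, coeff_X_mul]; exact mem_support_iff.1 he)
  refine ⟨j, hj, ?_⟩
  have hne : i ≠ j := by rintro rfl; exact hi hj
  simpa [Finsupp.single_apply, hne] using hj'

variable [LinearOrder σ]

/-- The sign of `e_i ∧ e_S` with respect to `e_{insert i S}`, for `i ∉ S`. -/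
def wedgeSign (i : σ) (S : Finset σ) : ℤ := (-1) ^ (S.filter (· < i)).card

lemma wedgeSign_mul_self (i : σ) (S : Finset σ) : wedgeSign i S * wedgeSign i S = 1 := by
  rw [wedgeSign, ← mul_pow]; simp

lemma wedgeSign_insert {i j : σ} {S : Finset σ} (hj : j ∉ S) :
    wedgeSign i (insert j S) = (if j < i then -1 else 1) * wedgeSign i S := by
  unfold wedgeSign
  rw [Finset.filter_insert]
  split_ifs with h
  · rw [Finset.card_insert_of_notMem (by simp [hj]), pow_succ']
  · simp

lemma wedgeSign_erase_self (i : σ) (S : Finset σ) : wedgeSign i (S.erase i) = wedgeSign i S := by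
  unfold wedgeSign
  congr 2
  ext a
  simp only [Finset.mem_filter, Finset.mem_erase]
  constructor
  · tauto
  · rintro ⟨h, h'⟩; exact ⟨⟨h'.ne, h⟩, h'⟩

lemma wedgeSign_swap {i j : σ} {S : Finset σ} (hij : i ≠ j) (hi : i ∉ S) (hj : j ∉ S) :
    wedgeSign i S * wedgeSign j (insert i S) = -(wedgeSign j S * wedgeSign i (insert j S)) := by
  rw [wedgeSign_insert hi, wedgeSign_insert hj]
  rcases lt_or_gt_of_ne hij with h | h
  · rw [if_pos h, if_neg h.not_gt]; ring
  · rw [if_neg h.not_gt, if_pos h]; ring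

variable {R M : Type*} [CommRing R] [AddCommGroup M] [Module R M]

variable (R M) in
/-- Contraction with the `i`-th basis vector on the exterior algebra with coefficients in `M`.
An element `∑ S, a S ⊗ e_S` of `M ⊗ Λ` is encoded by its coefficients `a : Finset σ → M`. -/
def contr (i : σ) : (Finset σ → M) →ₗ[R] (Finset σ → M) where
  toFun a S := if i ∈ S then 0 else wedgeSign i S • a (insert i S)
  map_add' a b := by ext S; dsimp only [Pi.add_apply]; split_ifs <;> simp
  map_smul' r a := by
    ext S; dsimp only [Pi.smul_apply, RingHom.id_apply]
    split_ifs
    · simp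
    · rw [smul_comm]

variable (R M) in
/-- Left multiplication by the `i`-th basis vector on `M ⊗ Λ`. -/
def wedge (i : σ) : (Finset σ → M) →ₗ[R] (Finset σ → M) where
  toFun a S := if i ∈ S then wedgeSign i S • a (S.erase i) else 0
  map_add' a b := by ext S; dsimp only [Pi.add_apply]; split_ifs <;> simp
  map_smul' r a := by
    ext S; dsimp only [Pi.smul_apply, RingHom.id_apply]
    split_ifs
    · rw [smul_comm]
    · simp

lemma contr_apply (i : σ) (a : Finset σ → M) (S : Finset σ) :
    contr R M i a S = if i ∈ S then 0 else wedgeSign i S • a (insert i S) := rfl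

lemma wedge_apply (i : σ) (a : Finset σ → M) (S : Finset σ) :
    wedge R M i a S = if i ∈ S then wedgeSign i S • a (S.erase i) else 0 := rfl

lemma contr_contr_self (i : σ) (a : Finset σ → M) : contr R M i (contr R M i a) = 0 := by
  ext S; simp [contr_apply]

lemma contr_contr (i j : σ) (a : Finset σ → M) :
    contr R M i (contr R M j a) = -contr R M j (contr R M i a) := by
  rcases eq_or_ne i j with rfl | hij
  · simp [contr_contr_self]
  ext S
  simp only [contr_apply, Pi.neg_apply, Finset.mem_insert]
  by_cases hi : i ∈ S
  · simp [hi]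
  by_cases hj : j ∈ S
  · simp [hi, hj]
  simp only [hi, hj, hij, hij.symm, or_self, if_false]
  rw [smul_smul, smul_smul, wedgeSign_swap hij hi hj, Finset.insert_comm, neg_smul]

lemma contr_wedge_self (i : σ) (a : Finset σ → M) :
    contr R M i (wedge R M i a) = a - wedge R M i (contr R M i a) := by
  ext S
  simp only [contr_apply, wedge_apply, Pi.sub_apply]
  by_cases hi : i ∈ S
  · simp [hi, smul_smul, wedgeSign_erase_self, wedgeSign_mul_self]
  · simp [hi, smul_smul, wedgeSign_insert hi, wedgeSign_mul_self]

lemma contr_wedge {i j : σ} (hij : i ≠ j) (a : Finset σ → M) :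
    contr R M i (wedge R M j a) = -wedge R M j (contr R M i a) := by
  ext S
  simp only [contr_apply, wedge_apply, Pi.neg_apply]
  by_cases hi : i ∈ S
  · simp [hi, hij]
  by_cases hj : j ∈ S
  · obtain ⟨T, hT, rfl⟩ : ∃ T, j ∉ T ∧ S = insert j T :=
      ⟨S.erase j, by simp, (Finset.insert_erase hj).symm⟩
    have hiT : i ∉ T := fun h => hi (Finset.mem_insert_of_mem h)
    have e : (insert i (insert j T)).erase j = insert i T := by
      rw [Finset.insert_comm, Finset.erase_insert]; simp [hij.symm, hT]
    have e2 : wedgeSign j (insert j T) = wedgeSign j T := by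
      rw [wedgeSign_insert hT]; simp
    have e3 : wedgeSign j (insert i (insert j T)) = wedgeSign j (insert i T) := by
      rw [Finset.insert_comm, wedgeSign_insert (by simp [hij.symm, hT])]; simp
    simp only [Finset.mem_insert, true_or, or_true, if_true, hiT, hij, or_self, if_false,
      smul_smul, e, Finset.erase_insert hT, e2, e3]
    rw [← neg_smul]
    congr 1
    have h := wedgeSign_swap hij hiT hT
    have h1 := wedgeSign_mul_self i (insert j T)
    have h2 := wedgeSign_mul_self i T
    linear_combination
      wedgeSign i (insert j T) * wedgeSign i T * h - wedgeSign i (insert j T) *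
        wedgeSign j (insert i T) * h2 - wedgeSign i T * wedgeSign j T * h1
  · simp [hi, hj, hij.symm]

lemma contr_map {M' : Type*} [AddCommGroup M'] [Module R M'] (f : M →+ M')
    (i : σ) (a : Finset σ → M) (S : Finset σ) :
    contr R M' i (fun S => f (a S)) S = f (contr R M i a S) := by
  simp only [contr_apply]; split_ifs <;> simp

variable (M) in
/-- The Koszul differential `∑ i ∈ T, x i • ι_i` on `M ⊗ Λ`. -/
def koszul (x : σ → R) (T : Finset σ) : (Finset σ → M) →ₗ[R] (Finset σ → M) :=
  ∑ i ∈ T, x i • contr R M i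

lemma koszul_apply (x : σ → R) (T : Finset σ) (a : Finset σ → M) :
    koszul M x T a = ∑ i ∈ T, x i • contr R M i a := by
  simp [koszul]

lemma koszul_apply' (x : σ → R) (T : Finset σ) (a : Finset σ → M) (S : Finset σ) :
    koszul M x T a S = ∑ i ∈ T, x i • contr R M i a S := by
  simp [koszul]

lemma koszul_insert (x : σ → R) {i : σ} {T : Finset σ} (hi : i ∉ T) (a : Finset σ → M) :
    koszul M x (insert i T) a = x i • contr R M i a + koszul M x T a := by
  simp [koszul_apply, Finset.sum_insert hi]

lemma contr_koszul (x : σ → R) (T : Finset σ) (i : σ) (a : Finset σ → M) :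
    contr R M i (koszul M x T a) = -koszul M x T (contr R M i a) := by
  simp only [koszul_apply, map_sum, map_smul, ← Finset.sum_neg_distrib]
  refine Finset.sum_congr rfl fun j _ => ?_
  rw [contr_contr, smul_neg]

lemma koszul_koszul (x : σ → R) (T : Finset σ) (a : Finset σ → M) :
    koszul M x T (koszul M x T a) = 0 := by
  induction T using Finset.induction_on with
  | empty => simp [koszul]
  | insert i T hi ih =>
    rw [koszul_insert x hi, koszul_insert x hi]
    simp only [map_add, map_smul, contr_contr_self, contr_koszul, ih]
    simp

lemma koszul_wedge_of_notMem (x : σ → R) {T : Finset σ} {i : σ} (hi : i ∉ T) (a : Finset σ → M) :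
    koszul M x T (wedge R M i a) = -wedge R M i (koszul M x T a) := by
  simp only [koszul_apply, map_sum, map_smul, ← Finset.sum_neg_distrib]
  refine Finset.sum_congr rfl fun j hj => ?_
  rw [contr_wedge (by rintro rfl; exact hi hj), smul_neg]

/-- `a` lies in `M ⊗ Λ^q`. -/
def InDegree (q : ℕ) (a : Finset σ → M) : Prop := ∀ S, S.card ≠ q → a S = 0

/-- `a` lies in `M ⊗ Λ(e_i : i ∈ T)`. -/
def InVars (T : Finset σ) (a : Finset σ → M) : Prop := ∀ S, ¬ S ⊆ T → a S = 0

lemma InDegree.contr {q : ℕ} {a : Finset σ → M} (h : InDegree (q + 1) a) (i : σ) :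
    InDegree q (contr R M i a) := by
  intro S hS
  rw [contr_apply]
  split_ifs with hi
  · rfl
  · rw [h _ (by rw [Finset.card_insert_of_notMem hi]; omega), smul_zero]

lemma InDegree.wedge {q : ℕ} {a : Finset σ → M} (h : InDegree q a) (i : σ) :
    InDegree (q + 1) (wedge R M i a) := by
  intro S hS
  rw [wedge_apply]
  split_ifs with hi
  · rw [h _ (by have := Finset.card_erase_add_one hi; omega), smul_zero]
  · rfl

lemma InDegree.koszul {q : ℕ} {a : Finset σ → M} (h : InDegree (q + 1) a) (x : σ → R)
    (T : Finset σ) : InDegree q (koszul M x T a) := by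
  intro S hS
  rw [koszul_apply']
  exact Finset.sum_eq_zero fun i _ => by rw [h.contr i S hS, smul_zero]

lemma InVars.contr {T : Finset σ} {a : Finset σ → M} (h : InVars T a) (i : σ) :
    InVars T (contr R M i a) := by
  intro S hS
  rw [contr_apply]
  split_ifs with hi
  · rfl
  · rw [h _ (fun h' => hS ((Finset.subset_insert _ _).trans h')), smul_zero]

lemma InVars.contr_eq_zero {T : Finset σ} {a : Finset σ → M} (h : InVars T a) {i : σ}
    (hi : i ∉ T) : PointsResolution.contr R M i a = 0 := by
  ext S
  rw [contr_apply]
  split_ifs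
  · rfl
  · rw [h _ (fun h' => hi (h' (Finset.mem_insert_self _ _)))]; simp

lemma InVars.koszul {T : Finset σ} {a : Finset σ → M} (h : InVars T a) (x : σ → R)
    (T' : Finset σ) : InVars T (koszul M x T' a) := by
  intro S hS
  rw [koszul_apply']
  exact Finset.sum_eq_zero fun i _ => by rw [h.contr i S hS, smul_zero]

omit [LinearOrder σ] in
lemma InDegree.add {q : ℕ} {a b : Finset σ → M} (ha : InDegree q a) (hb : InDegree q b) :
    InDegree q (a + b) := fun S hS => by simp [ha S hS, hb S hS]

omit [LinearOrder σ] in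
lemma InDegree.smul {q : ℕ} {a : Finset σ → M} (ha : InDegree q a) (r : R) :
    InDegree q (r • a) := fun S hS => by simp [ha S hS]

omit [LinearOrder σ] in
lemma InDegree.sub {q : ℕ} {a b : Finset σ → M} (ha : InDegree q a) (hb : InDegree q b) :
    InDegree q (a - b) := fun S hS => by simp [ha S hS, hb S hS]

/-- Exactness of the Koszul complex at its end, where its cokernel is `R / (x i : i ∈ T)`. -/
lemma koszul_exact_zero (x : σ → R) (T : Finset σ) (a : Finset σ → R) (hq : InDegree 0 a)
    (ha : a ∅ ∈ Ideal.span (x '' T)) :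
    ∃ b : Finset σ → R, InDegree 1 b ∧ InVars T b ∧ koszul R x T b = a := by
  obtain ⟨g, hg⟩ : ∃ g : σ → R, ∑ i ∈ T, g i • x i = a ∅ := by
    obtain ⟨g, hg⟩ := (Submodule.mem_span_image_finset_iff_exists_fun R).1 ha
    refine ⟨fun i => if h : i ∈ T then g ⟨i, h⟩ else 0, ?_⟩
    rw [← hg, ← Finset.sum_coe_sort]
    exact Finset.sum_congr rfl fun i _ => by simp
  refine ⟨fun S => ∑ j ∈ T, if S = {j} then g j else 0, ?_, ?_, ?_⟩
  · intro S hS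
    refine Finset.sum_eq_zero fun j _ => if_neg ?_
    rintro rfl; simp at hS
  · intro S hS
    refine Finset.sum_eq_zero fun j hj => if_neg ?_
    rintro rfl; simp [hj] at hS
  · ext S
    rw [koszul_apply']
    by_cases hS : S = ∅
    · subst hS
      rw [← hg]
      refine Finset.sum_congr rfl fun i hi => ?_
      rw [contr_apply, if_neg (by simp), Finset.sum_eq_single_of_mem i hi]
      · simp [wedgeSign, mul_comm]
      · intro j _ hj
        rw [if_neg]; simpa using hj.symm
    · rw [hq S (by simpa using hS)]
      refine Finset.sum_eq_zero fun i hi => ?_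
      rw [contr_apply]
      split_ifs with h
      · simp
      · rw [Finset.sum_eq_zero]
        · simp
        · intro j _
          rw [if_neg]
          intro h'
          have : (insert i S).card = 1 := by rw [h']; simp
          rw [Finset.card_insert_of_notMem h] at this
          exact hS (by simpa using this)

/-- Exactness of the Koszul complex of a sequence `x i`, `i ∈ T`, in positive degrees: `x` is
assumed to be regular in every order. The complex on `insert i T` is the mapping cone of
multiplication by `x i` on the complex on `T`. -/
lemma koszul_exact (x : σ → R)
    (hx : ∀ (T : Finset σ) (i : σ), i ∉ T → ∀ f, x i * f ∈ Ideal.span (x '' T) →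
      f ∈ Ideal.span (x '' T))
    (T : Finset σ) (q : ℕ) (a : Finset σ → R) (hq : InDegree (q + 1) a) (hT : InVars T a)
    (ha : koszul R x T a = 0) :
    ∃ b : Finset σ → R, InDegree (q + 2) b ∧ InVars T b ∧ koszul R x T b = a := by
  induction T using Finset.induction_on generalizing q a with
  | empty =>
    refine ⟨0, fun _ _ => rfl, fun _ _ => rfl, ?_⟩
    ext S
    rw [map_zero]
    by_cases hS : S ⊆ ∅
    · rw [Finset.subset_empty.1 hS, hq ∅ (by simp)]; rfl
    · rw [hT S hS]; rfl
  | insert i T hi ih =>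
    -- `a = a1 + e_i ∧ a2`, where `a1` and `a2` do not involve `e_i`; being a cycle means that
    -- `a2` is a cycle on `T` and that `∂ a1 = -x i • a2`
    set a2 := contr R R i a with ha2
    set a1 := a - wedge R R i a2 with ha1
    have h2q : InDegree q a2 := hq.contr i
    have h2T : InVars T a2 := by
      intro S hS
      rw [ha2, contr_apply]
      split_ifs with h
      · rfl
      · rw [hT, smul_zero]
        intro h'
        apply hS
        intro j hj
        have := h' (Finset.mem_insert_of_mem hj)
        rcases Finset.mem_insert.1 this with rfl | h3
        · exact absurd hj h
        · exact h3
    have h1q : InDegree (q + 1) a1 := hq.sub (h2q.wedge i)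
    have ha1c : a1 = contr R R i (wedge R R i a) := (contr_wedge_self i a).symm
    have h1T : InVars T a1 := by
      intro S hS
      rw [ha1c, contr_apply]
      split_ifs with h
      · rfl
      · rw [wedge_apply, if_pos (Finset.mem_insert_self _ _), Finset.erase_insert h, hT]
        · simp
        · intro h'
          apply hS
          intro j hj
          rcases Finset.mem_insert.1 (h' hj) with rfl | h3
          · exact absurd hj h
          · exact h3
    have hc1 : contr R R i a1 = 0 := by rw [ha1c, contr_contr_self]
    have hc2 : contr R R i a2 = 0 := by rw [ha2, contr_contr_self]
    have haeq : a = a1 + wedge R R i a2 := by rw [ha1]; abel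
    have key : koszul R x T a1 - wedge R R i (koszul R x T a2) + x i • a2 = 0 := by
      rw [koszul_insert x hi, ← ha2] at ha
      conv_lhs at ha => rw [haeq]
      rw [map_add, koszul_wedge_of_notMem x hi] at ha
      rw [← ha]; abel
    have key2 : koszul R x T a2 = 0 := by
      have := congrArg (contr R R i) key
      rw [map_add, map_sub, contr_koszul, hc1, contr_wedge_self, contr_koszul, hc2, map_smul,
        hc2] at this
      simpa using this
    have key1 : koszul R x T a1 + x i • a2 = 0 := by simpa [key2] using key
    -- in degree zero `a2` need not be a boundary as a cycle, but `x i • a2` is one, and `x i` is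
    -- regular modulo the other elements
    obtain ⟨c, hcq, hcT, hc⟩ : ∃ c : Finset σ → R, InDegree (q + 1) c ∧ InVars T c ∧
        koszul R x T c = a2 := by
      rcases q with _ | q
      · refine koszul_exact_zero x T a2 h2q (hx T i hi _ ?_)
        have := congrFun key1 ∅
        rw [Pi.add_apply, koszul_apply'] at this
        have h3 : x i * a2 ∅ = -∑ j ∈ T, x j • contr R R j a1 ∅ := by
          simp only [Pi.smul_apply, smul_eq_mul, Pi.zero_apply] at this ⊢
          linear_combination this
        rw [h3]
        refine neg_mem (Ideal.sum_mem _ fun j hj => ?_)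
        rw [smul_eq_mul, mul_comm]
        exact Ideal.mul_mem_left _ _ (Ideal.subset_span ⟨j, hj, rfl⟩)
      · exact ih q a2 h2q h2T key2
    obtain ⟨e, heq, heT, he⟩ := ih q (a1 + x i • c) (h1q.add (hcq.smul _))
      (fun S hS => by simp [h1T S hS, hcT S hS]) (by rw [map_add, map_smul, hc, key1])
    refine ⟨e - wedge R R i c, heq.sub (hcq.wedge i), ?_, ?_⟩
    · intro S hS
      rw [Pi.sub_apply, heT S (fun h => hS (h.trans (Finset.subset_insert _ _))), wedge_apply]
      split_ifs with h
      · rw [hcT, smul_zero, sub_zero]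
        intro h'
        apply hS
        rw [← Finset.insert_erase h]
        exact Finset.insert_subset_insert _ h'
      · simp
    · rw [koszul_insert x hi, map_sub, map_sub, heT.contr_eq_zero hi, contr_wedge_self,
        hcT.contr_eq_zero hi, koszul_wedge_of_notMem x hi, he, hc]
      simp only [map_zero, sub_zero, zero_sub, smul_neg]
      conv_rhs => rw [haeq]
      abel

end Koszul

/-! ### Polynomials graded by the integers -/

section IntegerGrading

variable {σ K : Type*} [CommSemiring K]

/-- `f` is homogeneous of the integer degree `d`; there are no nonzero such `f` if `d < 0`. -/
def IsHomZ (d : ℤ) (f : MvPolynomial σ K) : Prop := ∀ e ∈ f.support, (e.degree : ℤ) = d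

open Classical in
/-- The homogeneous component of integer degree `d`. -/
def homComp (d : ℤ) : MvPolynomial σ K →ₗ[K] MvPolynomial σ K :=
  if 0 ≤ d then homogeneousComponent d.toNat else 0

lemma coeff_homComp (d : ℤ) (f : MvPolynomial σ K) (e : σ →₀ ℕ) :
    coeff e (homComp d f) = if (e.degree : ℤ) = d then coeff e f else 0 := by
  unfold homComp
  by_cases h : 0 ≤ d
  · rw [if_pos h, coeff_homogeneousComponent]
    congr 1
    rw [eq_iff_iff]; omega
  · rw [if_neg h, if_neg (by omega)]; simp

lemma isHomZ_homComp (d : ℤ) (f : MvPolynomial σ K) : IsHomZ d (homComp d f) := by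
  intro e he
  rw [mem_support_iff, coeff_homComp] at he
  by_contra h
  exact he (if_neg h)

lemma IsHomZ.homComp_eq {d : ℤ} {f : MvPolynomial σ K} (h : IsHomZ d f) : homComp d f = f := by
  ext e
  rw [coeff_homComp]
  split_ifs with h'
  · rfl
  · by_contra h2
    exact h' (h e (mem_support_iff.2 (Ne.symm h2)))

lemma homComp_mul {a : ℤ} {f : MvPolynomial σ K} (hf : IsHomZ a f) (d : ℤ)
    (g : MvPolynomial σ K) : homComp d (f * g) = f * homComp (d - a) g := by
  classical
  ext e
  have key : ∀ x ∈ Finset.HasAntidiagonal.antidiagonal e, coeff x.1 f * coeff x.2 (homComp (d - a) g) =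
      if (e.degree : ℤ) = d then coeff x.1 f * coeff x.2 g else 0 := by
    intro x hx
    by_cases h0 : coeff x.1 f = 0
    · simp [h0]
    · have h1 := hf x.1 (mem_support_iff.2 h0)
      have h2 : (e.degree : ℤ) = x.1.degree + x.2.degree := by
        rw [← Finset.HasAntidiagonal.mem_antidiagonal.1 hx, map_add]; push_cast; rfl
      rw [coeff_homComp, mul_ite, mul_zero]
      congr 1
      rw [eq_iff_iff]; constructor <;> intro <;> omega
  rw [coeff_homComp, coeff_mul, coeff_mul, Finset.sum_congr rfl key]
  split_ifs <;> simp

lemma IsHomZ.mul {a b : ℤ} {f g : MvPolynomial σ K} (hf : IsHomZ a f) (hg : IsHomZ b g) :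
    IsHomZ (a + b) (f * g) := by
  have := homComp_mul hf (a + b) g
  rw [add_sub_cancel_left, hg.homComp_eq] at this
  rw [← this]
  exact isHomZ_homComp _ _

lemma isHomZ_zero (d : ℤ) : IsHomZ d (0 : MvPolynomial σ K) := by intro e he; simp at he

lemma IsHomZ.add {d : ℤ} {f g : MvPolynomial σ K} (hf : IsHomZ d f) (hg : IsHomZ d g) :
    IsHomZ d (f + g) := by
  rw [← hf.homComp_eq, ← hg.homComp_eq, ← map_add]; exact isHomZ_homComp _ _

lemma IsHomZ.sum {ι : Type*} {d : ℤ} (s : Finset ι) {f : ι → MvPolynomial σ K}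
    (hf : ∀ i ∈ s, IsHomZ d (f i)) : IsHomZ d (∑ i ∈ s, f i) := by
  have : ∑ i ∈ s, f i = homComp d (∑ i ∈ s, f i) := by
    rw [map_sum]; exact Finset.sum_congr rfl fun i hi => (hf i hi).homComp_eq.symm
  rw [this]; exact isHomZ_homComp _ _

lemma isHomZ_natCast {d : ℕ} {f : MvPolynomial σ K} : IsHomZ (d : ℤ) f ↔ f.IsHomogeneous d := by
  constructor
  · intro h e he
    have := h e (mem_support_iff.2 he)
    have h2 : e.degree = Finsupp.weight (fun _ : σ => 1) e := by
      rw [Finsupp.degree_eq_weight_one]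
    exact h2.symm.trans (by exact_mod_cast this)
  · intro h e he
    exact_mod_cast h.degree_eq_sum_deg_support he |>.symm

lemma isHomZ_X (i : σ) : IsHomZ 1 (X i : MvPolynomial σ K) :=
  isHomZ_natCast.2 (isHomogeneous_X K i)

lemma isHomZ_C (c : K) : IsHomZ 0 (C c : MvPolynomial σ K) :=
  isHomZ_natCast.2 (isHomogeneous_C σ c)

lemma IsHomZ.eq_zero_of_neg {d : ℤ} {f : MvPolynomial σ K} (hf : IsHomZ d f) (hd : d < 0) :
    f = 0 := by
  ext e
  by_contra h
  have := hf e (mem_support_iff.2 h)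
  omega

end IntegerGrading


/-! ### Minimal resolutions and the comparison with Koszul complexes -/

/-- A minimal graded complex of free modules that is a resolution of `R / I`, given by matrices,
with `F_0` of rank one. The last field says that the image of `φ_1` in `F_0 = R` is `I`. -/
structure CyclicRes {σ K : Type*} [Field K] (I : Ideal (MvPolynomial σ K)) where
  rank : ℕ → ℕ
  deg : ∀ k, Fin (rank k) → ℤ
  φ : ∀ k, Matrix (Fin (rank k)) (Fin (rank (k + 1))) (MvPolynomial σ K)
  graded : ∀ k r s, IsHomZ (deg (k + 1) s - deg k r) (φ k r s)
  exact : ∀ k, Function.Exact (φ (k + 1)).mulVecLin (φ k).mulVecLin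
  minimal : ∀ k r s, constantCoeff (φ k r s) = 0
  rank_zero : rank 0 = 1
  mem_iff : ∀ f, f ∈ I ↔ ∃ v, (φ 0).mulVecLin v = fun _ => f

lemma koszul_comp {σ R M M' : Type*} [LinearOrder σ] [CommRing R] [AddCommGroup M] [Module R M]
    [AddCommGroup M'] [Module R M'] (f : M →ₗ[R] M') (x : σ → R) (T : Finset σ)
    (a : Finset σ → M) (S : Finset σ) :
    koszul M' x T (fun S => f (a S)) S = f (koszul M x T a S) := by
  simp only [koszul_apply', map_sum, map_smul]
  exact Finset.sum_congr rfl fun i _ => congrArg (x i • ·) (contr_map (R := R) f.toAddMonoidHom i a S)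

/-- Exactness of the Koszul complex with coefficients in a free module of finite rank. -/
lemma koszul_exact_pi {σ R : Type*} [LinearOrder σ] [CommRing R] (x : σ → R)
    (hx : ∀ (T : Finset σ) (i : σ), i ∉ T → ∀ f, x i * f ∈ Ideal.span (x '' T) →
      f ∈ Ideal.span (x '' T))
    (T : Finset σ) (q : ℕ) {n : ℕ} (a : Finset σ → Fin n → R) (hq : InDegree q a)
    (hT : InVars T a) (ha : koszul _ x T a = 0)
    (h0 : q = 0 → ∀ r, a ∅ r ∈ Ideal.span (x '' T)) :
    ∃ b : Finset σ → Fin n → R, InDegree (q + 1) b ∧ InVars T b ∧ koszul _ x T b = a := by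
  have : ∀ r, ∃ b : Finset σ → R, InDegree (q + 1) b ∧ InVars T b ∧
      koszul R x T b = fun S => a S r := by
    intro r
    rcases q with _ | q
    · exact koszul_exact_zero x T _ (fun S hS => by rw [hq S hS]; rfl) (h0 rfl r)
    · refine koszul_exact x hx T q _ (fun S hS => by rw [hq S hS]; rfl)
        (fun S hS => by rw [hT S hS]; rfl) ?_
      ext S
      exact (koszul_comp (LinearMap.proj r : (Fin n → R) →ₗ[R] R) x T a S).trans (by rw [ha]; rfl)
  choose b hb1 hb2 hb3 using this
  refine ⟨fun S r => b r S, fun S hS => funext fun r => hb1 r S hS,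
    fun S hS => funext fun r => hb2 r S hS, ?_⟩
  ext S r
  have := koszul_comp (LinearMap.proj r : (Fin n → R) →ₗ[R] R) x T (fun S r => b r S) S
  rw [LinearMap.proj_apply] at this
  rw [← this]
  exact congrFun (hb3 r) S

namespace CyclicRes

variable {σ K : Type*} [Field K] {I : Ideal (MvPolynomial σ K)} (F : CyclicRes I)

/-- The elements of `F_p ⊗ Λ`. -/
abbrev Tens (p : ℕ) : Type _ := Finset σ → Fin (F.rank p) → MvPolynomial σ K

/-- The differential `F_{p+1} ⊗ Λ → F_p ⊗ Λ` induced by that of `F`. -/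
def act (p : ℕ) (y : F.Tens (p + 1)) : F.Tens p := fun S => (F.φ p).mulVecLin (y S)

variable {F}

lemma act_zero {p : ℕ} : F.act p 0 = 0 := by
  ext1 S; exact map_zero _

lemma act_sub {p : ℕ} (y z : F.Tens (p + 1)) : F.act p (y - z) = F.act p y - F.act p z := by
  ext1 S; exact map_sub _ _ _

lemma act_add {p : ℕ} (y z : F.Tens (p + 1)) : F.act p (y + z) = F.act p y + F.act p z := by
  ext1 S; exact map_add _ _ _

lemma act_smul {p : ℕ} (c : MvPolynomial σ K) (y : F.Tens (p + 1)) :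
    F.act p (c • y) = c • F.act p y := by
  ext1 S; exact (F.φ p).mulVecLin.map_smul _ _

lemma act_act {p : ℕ} (y : F.Tens (p + 2)) : F.act p (F.act (p + 1) y) = 0 := by
  ext1 S; exact (F.exact p _).2 ⟨_, rfl⟩

lemma exists_act_eq {p : ℕ} {y : F.Tens (p + 1)} (h : F.act p y = 0) :
    ∃ z, F.act (p + 1) z = y := by
  have : ∀ S, ∃ z, (F.φ (p + 1)).mulVecLin z = y S := fun S => (F.exact p _).1 (congrFun h S)
  choose z hz using this
  exact ⟨z, funext hz⟩

/-- `y ∈ F_p ⊗ Λ` is homogeneous of degree `d`. -/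
def IsHomTens (d : ℤ) {p : ℕ} (y : F.Tens p) : Prop :=
  ∀ S r, IsHomZ (d - S.card - F.deg p r) (y S r)

lemma IsHomTens.act {d : ℤ} {p : ℕ} {y : F.Tens (p + 1)} (h : IsHomTens d y) :
    IsHomTens d (F.act p y) := by
  intro S r
  rw [CyclicRes.act, Matrix.mulVecLin_apply, Matrix.mulVec, dotProduct]
  refine IsHomZ.sum _ fun s _ => ?_
  have := (F.graded p r s).mul (h S s)
  convert this using 1; ring

variable (F) in
/-- The basis element of `F_0`. -/
def idx : Fin (F.rank 0) := ⟨0, by rw [F.rank_zero]; exact one_pos⟩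

lemma eq_idx (r : Fin (F.rank 0)) : r = F.idx := by
  have : Subsingleton (Fin (F.rank 0)) := by rw [F.rank_zero]; infer_instance
  exact Subsingleton.elim _ _

/-- Preimages under the differential of `F` may be chosen in the same part of `Λ`. -/
lemma exists_act_eq_of_inDegree {p q : ℕ} {T : Finset σ} {y : F.Tens p} (hq : InDegree q y)
    (hT : InVars T y) {w : F.Tens (p + 1)} (h : y = F.act p w) :
    ∃ z, InDegree q z ∧ InVars T z ∧ F.act p z = y := by
  classical
  refine ⟨fun S => if S.card = q ∧ S ⊆ T then w S else 0, fun S hS => if_neg (by tauto),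
    fun S hS => if_neg (by tauto), ?_⟩
  ext1 S
  simp only [act]
  split_ifs with h'
  · rw [h]; rfl
  · rw [map_zero]
    by_cases hS : S.card = q
    · exact (hT S (by tauto)).symm
    · exact (hq S hS).symm

variable [LinearOrder σ]

variable (F) in
/-- The Koszul differential of `F_p ⊗ Λ` for the variables in `T`. -/
def kos (T : Finset σ) {p : ℕ} (y : F.Tens p) : F.Tens p :=
  koszul (Fin (F.rank p) → MvPolynomial σ K) (X : σ → MvPolynomial σ K) T y

lemma kos_kos (T : Finset σ) {p : ℕ} (y : F.Tens p) : F.kos T (F.kos T y) = 0 :=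
  koszul_koszul _ _ _

lemma kos_sub (T : Finset σ) {p : ℕ} (y z : F.Tens p) :
    F.kos T (y - z) = F.kos T y - F.kos T z := map_sub _ _ _

lemma kos_add (T : Finset σ) {p : ℕ} (y z : F.Tens p) :
    F.kos T (y + z) = F.kos T y + F.kos T z := map_add _ _ _

lemma kos_smul (T : Finset σ) {p : ℕ} (c : MvPolynomial σ K) (y : F.Tens p) :
    F.kos T (c • y) = c • F.kos T y := map_smul _ _ _

lemma kos_act (T : Finset σ) {p : ℕ} (y : F.Tens (p + 1)) :
    F.kos T (F.act p y) = F.act p (F.kos T y) := by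
  ext1 S; exact koszul_comp _ _ _ _ _

/-- Exactness of the rows of the double complex `F ⊗ Λ(T)` in positive degrees. -/
lemma exists_kos_eq_of_pos (T : Finset σ) {p q : ℕ} (y : F.Tens p) (hq : InDegree (q + 1) y)
    (hT : InVars T y) (h : F.kos T y = 0) :
    ∃ e : F.Tens p, InDegree (q + 2) e ∧ InVars T e ∧ F.kos T e = y :=
  koszul_exact_pi (R := MvPolynomial σ K) X mem_span_X_of_X_mul_mem T (q + 1) y hq hT h
    (fun h => absurd h (Nat.succ_ne_zero q))

/-- One step up the double complex `F ⊗ Λ(T)`, from `F_p ⊗ Λ^{q+1}` to `F_{p+1} ⊗ Λ^q`. -/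
lemma exists_climb_step (T : Finset σ) {p q : ℕ} {y : F.Tens p} (hq : InDegree (q + 1) y)
    (hT : InVars T y) (hw : ∃ w, F.kos T y = F.act p w) :
    ∃ g : F.Tens (p + 1), InDegree q g ∧ InVars T g ∧
      F.act p g = F.kos T y ∧ ∀ u : F.Tens (p + 1), InDegree (q + 1) u → InVars T u →
      (∃ v : F.Tens (p + 2), g = F.kos T u + F.act (p + 1) v) →
      ∃ (u : F.Tens p) (v : F.Tens (p + 1)), InDegree (q + 2) u ∧ InVars T u ∧ y = F.kos T u + F.act p v := by
  obtain ⟨w, hw⟩ := hw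
  have hT' : InVars T (F.kos T y) := hT.koszul _ _
  have hq' : InDegree q (F.kos T y) := hq.koszul _ _
  obtain ⟨g, hg1, hg2, hg3⟩ := exists_act_eq_of_inDegree hq' hT' hw
  refine ⟨g, hg1, hg2, hg3, fun u hu1 hu2 ⟨v, huv⟩ => ?_⟩
  have h0 : F.kos T (y - F.act p u) = 0 := by
    rw [kos_sub, ← hg3, kos_act, ← act_sub, huv, add_sub_cancel_left, act_act]
  have h1 : InDegree (q + 1) (y - F.act p u) :=
    hq.sub fun S hS => by rw [act, hu1 S hS, map_zero]
  have h2 : InVars T (y - F.act p u) := fun S hS => by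
    rw [Pi.sub_apply, hT S hS, act, hu2 S hS, map_zero, sub_zero]
  obtain ⟨e, he1, he2, he3⟩ := exists_kos_eq_of_pos T _ h1 h2 h0
  exact ⟨e, u, he1, he2, sub_eq_iff_eq_add.1 he3.symm⟩

/-- Climbing up the double complex `F ⊗ Λ(T)`: an element of `F_p ⊗ Λ^{q+1}` which becomes a
cycle over `R / I` yields an element `g` of `F_{p+q+1}`, whose image in `F_{p+q}` vanishes modulo
the variables in `T`, and which does not itself vanish modulo these variables unless the given
element is a boundary in the total complex. -/
lemma exists_climb (T : Finset σ) (q : ℕ) : ∀ (p k : ℕ), p + q = k → ∀ y : F.Tens p,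
    InDegree (q + 1) y → InVars T y → (∃ w, F.kos T y = F.act p w) →
    ∃ g : F.Tens (k + 1), InDegree 0 g ∧ (∃ y1, F.act k g = F.kos T y1) ∧
      ((∃ u, InDegree 1 u ∧ InVars T u ∧ g = F.kos T u) →
        ∃ u v, InDegree (q + 2) u ∧ InVars T u ∧ y = F.kos T u + F.act p v) := by
  induction q with
  | zero =>
    intro p k hk y hq hT hy
    obtain rfl : p = k := by omega
    obtain ⟨g, h1, h2, h3, h4⟩ := exists_climb_step T hq hT hy
    refine ⟨g, h1, ⟨y, h3⟩, fun ⟨u, hu1, hu2, hu3⟩ => h4 u hu1 hu2 ⟨0, ?_⟩⟩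
    rw [hu3, act_zero, add_zero]
  | succ q ih =>
    rintro p k hk y hq hT hy
    obtain ⟨g, h1, h2, h3, h4⟩ := exists_climb_step T hq hT hy
    obtain ⟨g', h1', h2', h3'⟩ := ih (p + 1) k (by omega) g h1 h2 (by
      obtain ⟨w, hw⟩ := exists_act_eq (F := F) (y := F.kos T g) (p := p) (by
        rw [← kos_act, h3, kos_kos])
      exact ⟨w, hw.symm⟩)
    refine ⟨g', h1', h2', fun hu => ?_⟩
    obtain ⟨u, v, hu1, hu2, huv⟩ := h3' hu
    exact h4 u hu1 hu2 ⟨v, huv⟩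

variable (F) in
/-- `y ∈ F_p ⊗ Λ` and `y' ∈ F_0 ⊗ Λ` are the ends of a zigzag
in the double complex `F ⊗ Λ`: consecutive elements `y_p, …, y_0` of it satisfy
`∂ y_{i-1} = φ y_i`. -/
def Zig [Fintype σ] : ∀ p, F.Tens p → F.Tens 0 → Prop
  | 0, y, y' => y' = y
  | p + 1, y, y' => ∃ y1, F.kos Finset.univ y1 = F.act p y ∧ Zig p y1 y'

variable [Fintype σ]

lemma Zig.add : ∀ {p : ℕ} {y z : F.Tens p} {y' z' : F.Tens 0}, F.Zig p y y' → F.Zig p z z' →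
    F.Zig p (y + z) (y' + z')
  | 0, _, _, _, _, rfl, rfl => rfl
  | _ + 1, _, _, _, _, ⟨y1, h1, h2⟩, ⟨z1, h1', h2'⟩ =>
    ⟨y1 + z1, by rw [kos_add, act_add, ← h1, ← h1'], h2.add h2'⟩

lemma Zig.smul (c : MvPolynomial σ K) : ∀ {p : ℕ} {y : F.Tens p} {y' : F.Tens 0},
    F.Zig p y y' → F.Zig p (c • y) (c • y')
  | 0, _, _, rfl => rfl
  | _ + 1, _, _, ⟨y1, h1, h2⟩ =>
    ⟨c • y1, by rw [kos_smul, act_smul, ← h1], h2.smul c⟩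

/-- Boundaries are carried back along zigzags. -/
lemma Zig.bdry : ∀ {p : ℕ} {y : F.Tens p} {y' : F.Tens 0}, F.Zig p y y' →
    (∃ u v, y' = F.kos Finset.univ u + F.act 0 v) → ∃ u v, y = F.kos Finset.univ u + F.act p v
  | 0, _, _, rfl, h => h
  | p + 1, y, y', ⟨y1, h1, h2⟩, h => by
    obtain ⟨u, v, huv⟩ := h2.bdry h
    obtain ⟨w, hw⟩ := exists_act_eq (F := F) (p := p) (y := y - F.kos Finset.univ v) (by
      rw [act_sub, ← h1, ← kos_act, huv, kos_add, kos_kos, zero_add, sub_self])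
    exact ⟨v, w, by rw [hw]; abel⟩

/-- Lifts along the Koszul differential may be chosen homogeneous. -/
lemma exists_kos_eq {p q : ℕ} {d : ℤ} {y : F.Tens p} (hy : IsHomTens d y) (hq : InDegree q y)
    (h : F.kos Finset.univ y = 0) (h0 : q = 0 → ∀ r, constantCoeff (y ∅ r) = 0) :
    ∃ z, InDegree (q + 1) z ∧ IsHomTens d z ∧ F.kos Finset.univ z = y := by
  obtain ⟨z, hz1, -, hz3⟩ := koszul_exact_pi (R := MvPolynomial σ K) X mem_span_X_of_X_mul_mem Finset.univ q y hq
    (fun S hS => absurd (Finset.subset_univ S) hS) h (fun hq r => by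
      rw [mem_ideal_span_X_image]
      intro e he
      by_contra h'
      have : e = 0 := by ext i; by_contra h2; exact h' ⟨i, by simp, h2⟩
      subst this
      exact (mem_support_iff.1 he) (h0 hq r))
  refine ⟨fun S r => homComp (d - S.card - F.deg p r) (z S r), fun S hS => ?_,
    fun S r => isHomZ_homComp _ _, ?_⟩
  · ext1 r; simp [hz1 S hS]
  · ext1 S; ext1 r
    rw [← (hy S r).homComp_eq, ← hz3]
    rw [kos, koszul_apply', koszul_apply', Finset.sum_apply, Finset.sum_apply, map_sum]
    refine Finset.sum_congr rfl fun i _ => ?_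
    rw [Pi.smul_apply, Pi.smul_apply, smul_eq_mul, smul_eq_mul, homComp_mul (isHomZ_X i),
      contr_apply, contr_apply]
    split_ifs with hi
    · simp
    · rw [Pi.smul_apply, Pi.smul_apply, map_zsmul, Finset.card_insert_of_notMem hi]
      congr 4
      push_cast; ring

/-- Descending the double complex `F ⊗ Λ`, from `F_p ⊗ Λ^q` to `F_0 ⊗ Λ^{p+q}`. -/
lemma exists_zig (p : ℕ) : ∀ (q : ℕ) (d : ℤ) (y : F.Tens p), IsHomTens d y → InDegree q y →
    (∃ w, F.kos Finset.univ y = F.act p w) →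
    ∃ y', F.Zig p y y' ∧ IsHomTens d y' ∧ InDegree (p + q) y' ∧
      ∃ w, F.kos Finset.univ y' = F.act 0 w := by
  induction p with
  | zero => intro q d y h1 h2 h3; exact ⟨y, rfl, h1, by rwa [zero_add], h3⟩
  | succ p ih =>
    rintro q d y h1 h2 ⟨w, h3⟩
    obtain ⟨z, hz1, hz2, hz3⟩ := exists_kos_eq (F := F) (q := q) h1.act
      (fun S hS => by rw [act, h2 S hS, map_zero])
      (by rw [kos_act, h3, act_act]) (fun _ r => by
        rw [act, Matrix.mulVecLin_apply, Matrix.mulVec, dotProduct, map_sum]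
        exact Finset.sum_eq_zero fun s _ => by rw [map_mul, F.minimal, zero_mul])
    obtain ⟨y', h1', h2', h3', h4'⟩ := ih (q + 1) d z hz2 hz1 ⟨y, hz3⟩
    exact ⟨y', ⟨z, hz3, h1'⟩, h2', by rwa [show p + 1 + q = p + (q + 1) by ring], h4'⟩

end CyclicRes

/-! ### Koszul homology of the coordinate points together with the unit point -/

section StandardPoints

variable (σ K : Type*) [Fintype σ] [LinearOrder σ] [Field K]

/-- The homogeneous ideal of the points `e_i` and `(1 : ⋯ : 1)`. -/
def stdIdeal : Ideal (MvPolynomial σ K) :=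
  Ideal.span {f | (∃ d, f.IsHomogeneous d) ∧ (∀ i, eval (Pi.single i 1) f = 0) ∧ eval 1 f = 0}

variable {σ K}

omit [Fintype σ] [LinearOrder σ] in
lemma IsHomZ.eval_eq_of_zero {f : MvPolynomial σ K} (h : IsHomZ 0 f) (p : σ → K) :
    f = C (eval p f) := by
  have : f = C (coeff 0 f) := by
    have h' : f.IsHomogeneous 0 := isHomZ_natCast.1 h
    rw [← homogeneousComponent_zero]
    exact (homogeneousComponent_eq_self h').symm
  rw [this]; simp

omit [Fintype σ] in
lemma mem_stdIdeal {d : ℤ} {f : MvPolynomial σ K} (hf : IsHomZ d f)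
    (h : ∀ i, eval (Pi.single i 1) f = 0) (h1 : eval 1 f = 0) : f ∈ stdIdeal σ K := by
  rcases lt_or_ge d 0 with hd | hd
  · rw [hf.eq_zero_of_neg hd]; exact zero_mem _
  · lift d to ℕ using hd
    exact Ideal.subset_span ⟨⟨d, isHomZ_natCast.1 hf⟩, h, h1⟩

omit [Fintype σ] in
lemma eval_single_of_mem_stdIdeal {f : MvPolynomial σ K} (h : f ∈ stdIdeal σ K) (i : σ) :
    eval (Pi.single i 1) f = 0 := by
  have : stdIdeal σ K ≤ RingHom.ker (eval (Pi.single i (1 : K)) : MvPolynomial σ K →+* K) :=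
    Ideal.span_le.2 fun f hf => hf.2.1 i
  exact this h

lemma eval_koszul (p : σ → K) (z : Finset σ → MvPolynomial σ K) (S : Finset σ) :
    eval p (koszul (MvPolynomial σ K) (X : σ → MvPolynomial σ K) Finset.univ z S) =
      koszul K p Finset.univ (fun S => eval p (z S)) S := by
  simp only [koszul_apply', map_sum, smul_eq_mul, map_mul, eval_X]
  refine Finset.sum_congr rfl fun i _ => congrArg (p i * ·) ?_
  simp only [contr_apply]
  split_ifs <;> simp

lemma koszul_single (i : σ) (a : Finset σ → K) :
    koszul K (Pi.single i 1 : σ → K) Finset.univ a = contr K K i a := by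
  rw [koszul_apply, Finset.sum_eq_single i]
  · simp
  · intro j _ hj; simp [hj]
  · simp

/-- At the unit point, left multiplication by any `e_i` is a contracting homotopy. -/
lemma koszul_one_wedge (i : σ) (a : Finset σ → K) :
    koszul K (1 : σ → K) Finset.univ (wedge K K i a) = a - wedge K K i (koszul K (1 : σ → K) Finset.univ a) := by
  have h : insert i (Finset.univ.erase i) = (Finset.univ : Finset σ) :=
    Finset.insert_erase (Finset.mem_univ i)
  rw [← h, koszul_insert _ (by simp), koszul_insert _ (by simp), contr_wedge_self,
    koszul_wedge_of_notMem _ (by simp)]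
  simp only [Pi.one_apply, one_smul, map_add]
  abel

/-- `z ∈ R ⊗ Λ`, homogeneous with coefficients of degree `j`, represents a cycle of degree `k` of
the Koszul complex of `R / I`, where `I` is the ideal of the standard points. -/
structure IsStdCycle (k : ℕ) (j : ℤ) (z : Finset σ → MvPolynomial σ K) : Prop where
  inDegree : InDegree k z
  hom : ∀ S, IsHomZ j (z S)
  cycle : ∀ S, koszul (MvPolynomial σ K) (X : σ → MvPolynomial σ K) Finset.univ z S ∈ stdIdeal σ K

/-- `z ∈ R ⊗ Λ` represents a boundary of the Koszul complex of `R / I`. -/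
def IsStdBoundary (z : Finset σ → MvPolynomial σ K) : Prop :=
  ∃ w, ∀ S, z S - koszul (MvPolynomial σ K) (X : σ → MvPolynomial σ K) Finset.univ w S ∈ stdIdeal σ K

/-- The values of a Koszul cochain at a point. -/
abbrev evalAt (p : σ → K) (z : Finset σ → MvPolynomial σ K) : Finset σ → K :=
  fun S => eval p (z S)

omit [Fintype σ] in
lemma eval_one_of_mem_stdIdeal {f : MvPolynomial σ K} (h : f ∈ stdIdeal σ K) :
    eval 1 f = 0 := by
  have : stdIdeal σ K ≤ RingHom.ker (eval (1 : σ → K) : MvPolynomial σ K →+* K) :=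
    Ideal.span_le.2 fun f hf => hf.2.2
  exact this h

namespace IsStdCycle

variable {k : ℕ} {j : ℤ} {z : Finset σ → MvPolynomial σ K}

lemma contr_evalAt (h : IsStdCycle k j z) (i : σ) :
    contr K K i (evalAt (Pi.single i 1) z) = 0 := by
  ext S
  rw [← koszul_single, ← eval_koszul]
  exact eval_single_of_mem_stdIdeal (h.cycle S) i

lemma koszul_evalAt (h : IsStdCycle k j z) : koszul K (1 : σ → K) Finset.univ (evalAt 1 z) = 0 := by
  ext S
  rw [← eval_koszul]
  exact eval_one_of_mem_stdIdeal (h.cycle S)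

lemma evalAt_inDegree (h : IsStdCycle k j z) (p : σ → K) : InDegree k (evalAt p z) :=
  fun S hS => by simp [evalAt, h.inDegree S hS]

lemma contr_wedge_evalAt (h : IsStdCycle k j z) (i : σ) :
    contr K K i (wedge K K i (evalAt (Pi.single i 1) z)) = evalAt (Pi.single i 1) z := by
  rw [contr_wedge_self, h.contr_evalAt, map_zero, sub_zero]

lemma koszul_wedge_evalAt (h : IsStdCycle k j z) (i : σ) :
    koszul K (1 : σ → K) Finset.univ (wedge K K i (evalAt 1 z)) = evalAt 1 z := by
  rw [koszul_one_wedge, h.koszul_evalAt, map_zero, sub_zero]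

/-- A cycle is a boundary if the primitives of its values at the points are the values of one
homogeneous cochain. -/
lemma isStdBoundary_of_lift (h : IsStdCycle k j z) (w : Finset σ → MvPolynomial σ K)
    (hw : ∀ S, IsHomZ (j - 1) (w S))
    (h1 : ∀ i, contr K K i (evalAt (Pi.single i 1) w) = evalAt (Pi.single i 1) z)
    (h2 : koszul K (1 : σ → K) Finset.univ (evalAt 1 w) = evalAt 1 z) : IsStdBoundary z := by
  refine ⟨w, fun S => ?_⟩
  have hhom : IsHomZ j (koszul (MvPolynomial σ K) (X : σ → MvPolynomial σ K) Finset.univ w S) := by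
    rw [koszul_apply']
    refine IsHomZ.sum _ fun i _ => ?_
    have : IsHomZ (j - 1) (contr (MvPolynomial σ K) (MvPolynomial σ K) i w S) := by
      rw [contr_apply]
      split_ifs
      · exact isHomZ_zero _
      · rw [zsmul_eq_mul, ← map_intCast (C : K →+* MvPolynomial σ K), ← zero_add (j - 1)]
        exact (isHomZ_C _).mul (hw _)
    have h3 := (isHomZ_X i).mul this
    rwa [add_sub_cancel] at h3
  refine mem_stdIdeal (d := j) ?_ (fun i => ?_) ?_
  · rw [← (h.hom S).homComp_eq, ← hhom.homComp_eq, ← map_sub]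
    exact isHomZ_homComp _ _
  · rw [map_sub, eval_koszul, koszul_single, sub_eq_zero]
    exact (congrFun (h1 i) S).symm
  · rw [map_sub, eval_koszul, sub_eq_zero]
    exact (congrFun h2 S).symm

end IsStdCycle

lemma isStdBoundary_zero : IsStdBoundary (0 : Finset σ → MvPolynomial σ K) :=
  ⟨0, fun S => by simp⟩

lemma IsStdCycle.isStdBoundary_of_neg {k : ℕ} {j : ℤ} {z : Finset σ → MvPolynomial σ K}
    (h : IsStdCycle k j z) (hj : j < 0) : IsStdBoundary z := by
  have : z = 0 := funext fun S => (h.hom S).eq_zero_of_neg hj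
  rw [this]; exact isStdBoundary_zero

/-- A cycle with constant coefficients is killed by the contractions with all the `e_i`. -/
lemma IsStdCycle.isStdBoundary_of_degree_zero {k : ℕ} {z : Finset σ → MvPolynomial σ K}
    (h : IsStdCycle k 0 z) (hk : k ≠ 0) : IsStdBoundary z := by
  have : z = 0 := by
    funext S
    by_cases hS : S.card = k
    · obtain ⟨i, hi⟩ : S.Nonempty := by
        rw [← Finset.card_pos]; omega
      have h1 := congrFun (h.contr_evalAt i) (S.erase i)
      rw [contr_apply, if_neg (by simp), Finset.insert_erase hi, Pi.zero_apply] at h1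
      have h2 : eval (Pi.single i 1) (z S) = 0 := by
        have h3 := congrArg (wedgeSign i (S.erase i) • ·) h1
        simp only [smul_smul, wedgeSign_mul_self, one_smul, smul_zero] at h3
        exact h3
      rw [(h.hom S).eval_eq_of_zero (Pi.single i 1), h2]; simp
    · exact h.inDegree S hS
  rw [this]; exact isStdBoundary_zero

/-- In top degree the Koszul differential at a point is injective, so that all values vanish. -/
lemma IsStdCycle.isStdBoundary_of_card_le {k : ℕ} {j : ℤ} {z : Finset σ → MvPolynomial σ K}
    [Nonempty σ] (h : IsStdCycle k j z) (hk : Fintype.card σ ≤ k) : IsStdBoundary z := by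
  have h0 : ∀ p : σ → K, ∀ S, S ≠ Finset.univ → evalAt p z S = 0 := fun p S hS =>
    h.evalAt_inDegree p S (((Finset.card_lt_iff_ne_univ S).2 hS).trans_le hk).ne
  have key : ∀ (p : σ → K) (i : σ), p i ≠ 0 → koszul K p Finset.univ (evalAt p z) = 0 →
      evalAt p z = 0 := by
    intro p i hpi hp
    ext S
    by_cases hS : S = Finset.univ
    · subst hS
      have h1 := congrFun hp (Finset.univ.erase i)
      rw [koszul_apply', Finset.sum_eq_single i] at h1
      · rw [contr_apply, if_neg (by simp), Finset.insert_erase (Finset.mem_univ i)] at h1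
        have h3 := congrArg (wedgeSign i (Finset.univ.erase i) • ·) h1
        simp only [Pi.zero_apply, smul_zero] at h3
        rw [smul_comm, smul_smul, wedgeSign_mul_self, one_smul, smul_eq_mul] at h3
        exact (mul_eq_zero.1 h3).resolve_left hpi
      · intro l _ hl
        rw [contr_apply, if_pos (by simp [hl]), smul_zero]
      · simp
    · exact h0 p S hS
  have e1 : ∀ i, evalAt (Pi.single i 1) z = 0 := fun i =>
    key _ i (by simp) (by rw [koszul_single, h.contr_evalAt])
  have e2 : evalAt 1 z = 0 := key 1 (Classical.arbitrary σ) (by simp) h.koszul_evalAt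
  refine h.isStdBoundary_of_lift 0 (fun S => isHomZ_zero _) (fun i => ?_) ?_
  · rw [e1]; ext S; simp [contr_apply, evalAt]
  · rw [e2, ← map_zero (koszul K (1 : σ → K) Finset.univ)]
    congr 1

/-- In each degree at least two, there are forms taking any given values at the standard
points. -/
lemma exists_isHomZ_eval_eq [Nontrivial σ] {j : ℤ} (hj : 2 ≤ j) (c : σ → K)
    (c1 : K) : ∃ f : MvPolynomial σ K, IsHomZ j f ∧ (∀ i, eval (Pi.single i 1) f = c i) ∧
      eval 1 f = c1 := by
  lift j to ℕ using by omega
  obtain ⟨d, rfl⟩ : ∃ d, j = d + 2 := ⟨j - 2, by omega⟩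
  choose o ho using fun i : σ => exists_ne i
  obtain ⟨a⟩ : Nonempty σ := inferInstance
  refine ⟨∑ i, C (c i) * (X i ^ (d + 1) * (X i - X (o i))) + C c1 * (X a ^ (d + 1) * X (o a)),
    ?_, fun i => ?_, ?_⟩
  · rw [isHomZ_natCast]
    refine IsHomogeneous.add (IsHomogeneous.sum _ _ _ fun i _ => ?_) ?_
    · convert (((isHomogeneous_X K i).pow (d + 1)).mul
        ((isHomogeneous_X K i).sub (isHomogeneous_X K (o i)))).C_mul (c i) using 1; ring
    · convert (((isHomogeneous_X K a).pow (d + 1)).mul (isHomogeneous_X K (o a))).C_mul c1 using 1; ring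
  · rw [map_add, map_sum, Finset.sum_eq_single i]
    · have h1 : (Pi.single i 1 : σ → K) (o i) = 0 := by simp [ho]
      have h2 : (Pi.single i 1 : σ → K) a = 0 ∨ (Pi.single i 1 : σ → K) (o a) = 0 := by
        by_cases hai : a = i
        · subst hai; exact Or.inr h1
        · left; simp [hai]
      rcases h2 with h2 | h2 <;> simp [h1, h2]
    · intro l _ hl
      simp [hl]
    · simp
  · simp

/-- From degree two on, forms interpolate any values at the points, so that the primitives
of the values lift. -/
lemma IsStdCycle.isStdBoundary_of_three_le [Nontrivial σ] {k : ℕ} {j : ℤ}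
    {z : Finset σ → MvPolynomial σ K} (h : IsStdCycle k j z) (hj : 3 ≤ j) : IsStdBoundary z := by
  choose w hw1 hw2 hw3 using fun S : Finset σ => exists_isHomZ_eval_eq (j := j - 1) (by omega)
    (fun i => wedge K K i (evalAt (Pi.single i 1) z) S)
    (wedge K K (Classical.arbitrary σ) (evalAt 1 z) S)
  refine h.isStdBoundary_of_lift w hw1 (fun i => ?_) ?_
  · rw [← h.contr_wedge_evalAt i]
    congr 1
    exact funext fun S => hw2 S i
  · rw [← h.koszul_wedge_evalAt (Classical.arbitrary σ)]
    congr 1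
    exact funext fun S => hw3 S

/-- The obstruction to lifting the primitives of the values at the points of a cycle with
quadratic coefficients to a linear cochain. -/
def stdClass [Nonempty σ] (z : Finset σ → MvPolynomial σ K) : K :=
  wedge K K (Classical.arbitrary σ) (evalAt 1 z) Finset.univ -
    ∑ i, wedge K K i (evalAt (Pi.single i 1) z) Finset.univ

/-- The primitives at the coordinate points may be changed by elements of the kernels of the
contractions, and these kernels together span the exterior algebra except in top degree. -/
lemma IsStdCycle.isStdBoundary_of_stdClass_eq_zero [Nontrivial σ] {k : ℕ}
    {z : Finset σ → MvPolynomial σ K} (h : IsStdCycle k 2 z) (hz : stdClass z = 0) :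
    IsStdBoundary z := by
  set y : Finset σ → K := wedge K K (Classical.arbitrary σ) (evalAt 1 z) -
    ∑ i, wedge K K i (evalAt (Pi.single i 1) z) with hy
  have hyu : y Finset.univ = 0 := by
    rw [← hz, stdClass, hy, Pi.sub_apply, Finset.sum_apply]
  have hch : ∀ S : Finset σ, ∃ i, y S ≠ 0 → i ∉ S := by
    intro S
    by_cases hS : S = Finset.univ
    · exact ⟨Classical.arbitrary σ, fun h' => absurd (hS ▸ hyu) h'⟩
    · obtain ⟨i, hi⟩ := not_forall.1 (mt Finset.eq_univ_iff_forall.2 hS)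
      exact ⟨i, fun _ => hi⟩
  choose ch hch using hch
  -- `y` is the sum of elements `v i` killed by the contraction with `e_i`
  let v : σ → Finset σ → K := fun i S => if i = ch S then y S else 0
  have hv : ∀ i, contr K K i (v i) = 0 := by
    intro i; ext S
    rw [contr_apply]
    split_ifs with hi
    · rfl
    · simp only [v]
      split_ifs with hc
      · by_contra hne
        have hne' : y (insert i S) ≠ 0 := fun h0 => hne (by simp [h0])
        exact hch _ hne' (hc ▸ Finset.mem_insert_self _ _)
      · simp
  have hvs : ∑ i, v i = y := by
    ext S; simp [v, Finset.sum_apply]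
  let c : σ → Finset σ → K := fun i => wedge K K i (evalAt (Pi.single i 1) z) + v i
  have hcs : ∑ i, c i = wedge K K (Classical.arbitrary σ) (evalAt 1 z) := by
    simp only [c, Finset.sum_add_distrib, hvs, hy]; abel
  have e1 : ∀ i, evalAt (Pi.single i 1) (fun S => ∑ i, X i * C (c i S)) = c i := by
    intro i; ext S
    simp only [evalAt, map_sum, map_mul, eval_X, eval_C]
    rw [Finset.sum_eq_single i]
    · simp
    · intro l _ hl; simp [hl]
    · simp
  have e2 : evalAt 1 (fun S => ∑ i, X i * C (c i S)) = ∑ i, c i := by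
    ext S; simp [evalAt, Finset.sum_apply]
  refine h.isStdBoundary_of_lift (fun S => ∑ i, X i * C (c i S)) (fun S => ?_) (fun i => ?_) ?_
  · refine IsHomZ.sum _ fun i _ => ?_
    have := (isHomZ_X (K := K) i).mul (isHomZ_C (σ := σ) (c i S))
    norm_num at this ⊢
    exact this
  · rw [e1]
    simp only [c, map_add, hv, add_zero, h.contr_wedge_evalAt]
  · rw [e2, hcs, h.koszul_wedge_evalAt]

/-- The obstruction lives in the top degree of the exterior algebra. -/
lemma IsStdCycle.stdClass_eq_zero [Nonempty σ] {k : ℕ} {j : ℤ}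
    {z : Finset σ → MvPolynomial σ K} (h : IsStdCycle k j z) (hk : k + 1 ≠ Fintype.card σ) :
    stdClass z = 0 := by
  have : ∀ p i, wedge K K i (evalAt p z) Finset.univ = 0 := fun p i =>
    ((h.evalAt_inDegree p).wedge i) _ (by rw [Finset.card_univ]; exact hk.symm)
  simp [stdClass, this]

lemma IsHomZ.eval_one_eq_sum {f : MvPolynomial σ K} (h : IsHomZ 1 f) :
    eval 1 f = ∑ i, eval (Pi.single i 1) f := by
  have h' : f ∈ homogeneousSubmodule σ K 1 := isHomZ_natCast.1 h
  rw [homogeneousSubmodule_one_eq_span_X] at h'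
  clear h
  induction h' using Submodule.span_induction with
  | mem f hf =>
    obtain ⟨i, rfl⟩ := hf
    simp [Pi.single_apply]
  | zero => simp
  | add f g _ _ hf hg => simp [hf, hg, Finset.sum_add_distrib]
  | smul c f _ hf => simp [hf, smul_eval, Finset.mul_sum]

/-- A linear cycle in the last degree but one amounts to a matrix which has all standard points as
eigenvectors, so it is a multiple of the boundary given by the identity matrix. -/
lemma IsStdCycle.isStdBoundary_of_degree_one [Nontrivial σ] {k : ℕ}
    {z : Finset σ → MvPolynomial σ K} (h : IsStdCycle k 1 z) (hk : k + 1 = Fintype.card σ) :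
    IsStdBoundary z := by
  set a := Classical.arbitrary σ
  have hne : ∀ b : Finset σ → K, InDegree (k + 1) b → ∀ S, S ≠ Finset.univ → b S = 0 :=
    fun b hb S hS => hb S (by rw [hk]; exact ((Finset.card_lt_iff_ne_univ S).2 hS).ne)
  have hw : ∀ p i, InDegree (k + 1) (wedge K K i (evalAt p z)) := fun p i =>
    (h.evalAt_inDegree p).wedge i
  set c := wedge K K a (evalAt 1 z) Finset.univ with hc
  have hval : ∀ (i l : σ) (b : Finset σ → K), InDegree (k + 1) b →
      contr K K l b (Finset.univ.erase i) =
        if l = i then wedgeSign i Finset.univ • b Finset.univ else 0 := by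
    intro i l b hb
    rw [contr_apply]
    by_cases hl : l = i
    · subst hl
      rw [if_neg (by simp), if_pos rfl, Finset.insert_erase (Finset.mem_univ l),
        wedgeSign_erase_self]
    · rw [if_pos (by simp [hl]), if_neg hl]
  have key : ∀ i, wedge K K i (evalAt (Pi.single i 1) z) Finset.univ = c := by
    intro i
    have h1 : evalAt 1 z (Finset.univ.erase i) =
        ∑ l, evalAt (Pi.single l 1) z (Finset.univ.erase i) := (h.hom _).eval_one_eq_sum
    rw [← h.koszul_wedge_evalAt a, koszul_apply'] at h1
    simp only [Pi.one_apply, one_smul] at h1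
    have h2 : ∀ l, evalAt (Pi.single l 1) z (Finset.univ.erase i) =
        if l = i then wedgeSign i Finset.univ • wedge K K i (evalAt (Pi.single i 1) z) Finset.univ
          else 0 := by
      intro l
      rw [← h.contr_wedge_evalAt l, hval i l _ (hw _ _)]
      split_ifs with hl
      · subst hl; rfl
      · rfl
    simp only [h2, hval i _ _ (hw 1 a), Finset.sum_ite_eq', Finset.mem_univ, if_true] at h1
    have h3 := congrArg (wedgeSign i Finset.univ • ·) h1
    simp only [smul_smul, wedgeSign_mul_self, one_smul] at h3
    exact h3.symm
  have heq : ∀ b : Finset σ → K, InDegree (k + 1) b → b Finset.univ = c →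
      b = fun S => if S = Finset.univ then c else 0 := by
    intro b hb hbc
    ext S
    split_ifs with hS
    · rw [hS, hbc]
    · exact hne b hb S hS
  have e1 : ∀ p : σ → K, evalAt p (fun S => C (if S = Finset.univ then c else 0)) =
      fun S => if S = Finset.univ then c else 0 := by
    intro p; ext S; simp [evalAt]
  refine h.isStdBoundary_of_lift (fun S => C (if S = Finset.univ then c else 0))
    (fun S => isHomZ_C _) (fun i => ?_) ?_
  · rw [e1, ← heq _ (hw _ i) (key i), h.contr_wedge_evalAt]
  · rw [e1, ← heq _ (hw _ a) hc.symm, h.koszul_wedge_evalAt]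

end StandardPoints

namespace CyclicRes

variable {σ K : Type*} [Fintype σ] [LinearOrder σ] [Field K] {F : CyclicRes (stdIdeal σ K)}

/-- A zigzag that starts with an element of `F_p` that is nonzero modulo the variables does not
end with a boundary. -/
lemma Zig.not_isStdBoundary {p : ℕ} {y : F.Tens p} {y' : F.Tens 0} (h : F.Zig p y y')
    {r : Fin (F.rank p)} (hr : constantCoeff (y ∅ r) ≠ 0) :
    ¬ IsStdBoundary (fun S => y' S F.idx) := by
  rintro ⟨w, hw⟩
  choose v hv using fun S => (F.mem_iff _).1 (hw S)
  obtain ⟨u, v', huv⟩ := h.bdry ⟨fun S _ => w S, v, by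
    ext1 S; ext1 r
    rw [eq_idx r, Pi.add_apply, Pi.add_apply, act, hv S]
    have := koszul_comp (LinearMap.proj F.idx :
      (Fin (F.rank 0) → MvPolynomial σ K) →ₗ[MvPolynomial σ K] MvPolynomial σ K)
      (X : σ → MvPolynomial σ K) Finset.univ (fun S _ => w S) S
    simp only [LinearMap.proj_apply] at this
    rw [kos, this]; ring⟩
  apply hr
  rw [huv, Pi.add_apply, Pi.add_apply, map_add, kos, koszul_apply', Finset.sum_apply, map_sum, act,
    Matrix.mulVecLin_apply, Matrix.mulVec, dotProduct, map_sum,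
    Finset.sum_eq_zero (fun i _ => by simp),
    Finset.sum_eq_zero (fun i _ => by rw [map_mul, F.minimal, zero_mul]), zero_add]

omit [Fintype σ] in
lemma eval_of_mem {S : Finset σ} {y : F.Tens 0} {w : F.Tens 1} (h : y = F.act 0 w) :
    y S F.idx ∈ stdIdeal σ K := by
  rw [F.mem_iff]
  refine ⟨w S, ?_⟩
  ext1 r
  rw [eq_idx r, h]; rfl

variable (F) in
/-- The basis element of index `r` of `F_p`. -/
def gen (p : ℕ) (r : Fin (F.rank p)) : F.Tens p := fun S => if S = ∅ then Pi.single r 1 else 0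

/-- Every basis element of `F_p` starts a zigzag whose end is a homogeneous cycle. -/
lemma exists_zig_gen (p : ℕ) (r : Fin (F.rank p)) : ∃ y', F.Zig p (F.gen p r) y' ∧
    IsStdCycle p (F.deg p r - p - F.deg 0 F.idx) (fun S => y' S F.idx) := by
  obtain ⟨y', h1, h2, h3, w, h4⟩ := exists_zig (F := F) p 0 (F.deg p r) (F.gen p r) (by
    intro S s
    by_cases hS : S = ∅
    · by_cases hs : s = r
      · subst hs
        simp only [gen, hS, if_true, Pi.single_eq_same, Finset.card_empty]
        have := isHomZ_C (σ := σ) (1 : K)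
        simpa using this
      · simp only [gen, hS, if_true, Pi.single_eq_of_ne hs]; exact isHomZ_zero _
    · simp only [gen, hS, if_false]; exact isHomZ_zero _) (by
    intro S hS
    exact if_neg (by simpa using hS)) ⟨0, by
      rw [act_zero]
      ext1 S
      rw [kos, koszul_apply']
      refine Finset.sum_eq_zero fun i _ => ?_
      rw [contr_apply]
      split_ifs
      · simp
      · simp [gen, Finset.insert_ne_empty]⟩
  refine ⟨y', h1, fun S hS => ?_, fun S => ?_, fun S => ?_⟩
  · rw [h3 S (by simpa using hS)]; rfl
  · by_cases hS : S.card = p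
    · have := h2 S F.idx
      rwa [hS] at this
    · rw [h3 S (by simpa using hS)]; exact isHomZ_zero _
  · have := koszul_comp (LinearMap.proj F.idx :
      (Fin (F.rank 0) → MvPolynomial σ K) →ₗ[MvPolynomial σ K] MvPolynomial σ K)
      (X : σ → MvPolynomial σ K) Finset.univ y' S
    simp only [LinearMap.proj_apply] at this
    rw [this]
    exact eval_of_mem h4

end CyclicRes

/-! ### Shape of the resolution of the standard points -/

namespace CyclicRes

variable {σ K : Type*} [Fintype σ] [LinearOrder σ] [Nontrivial σ] [Field K]
  {F : CyclicRes (stdIdeal σ K)}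

omit [Fintype σ] [Nontrivial σ] in
lemma constantCoeff_gen (p : ℕ) (r : Fin (F.rank p)) : constantCoeff (F.gen p r ∅ r) ≠ 0 := by
  simp [gen]

lemma rank_eq_zero {p : ℕ} (hp : Fintype.card σ ≤ p) : F.rank p = 0 := by
  by_contra h
  obtain ⟨y', h1, h2⟩ := exists_zig_gen (F := F) p ⟨0, Nat.pos_of_ne_zero h⟩
  exact h1.not_isStdBoundary (constantCoeff_gen _ _) (h2.isStdBoundary_of_card_le hp)

/-- Koszul homology of `R / I` in positive homological degree has coefficients of degree one
or two only. -/
lemma deg_bounds {p : ℕ} (hp : p ≠ 0) (r : Fin (F.rank p)) :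
    F.deg p r - p - F.deg 0 F.idx = 1 ∨ F.deg p r - p - F.deg 0 F.idx = 2 := by
  obtain ⟨y', h1, h2⟩ := exists_zig_gen (F := F) p r
  have h3 := h1.not_isStdBoundary (constantCoeff_gen _ _)
  set j := F.deg p r - p - F.deg 0 F.idx
  have e1 : ¬ j < 0 := fun h => h3 (h2.isStdBoundary_of_neg h)
  have e2 : j ≠ 0 := fun h => h3 (IsStdCycle.isStdBoundary_of_degree_zero (h ▸ h2) hp)
  have e3 : ¬ 3 ≤ j := fun h => h3 (h2.isStdBoundary_of_three_le h)
  omega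

lemma deg_eq {p : ℕ} (hp : p ≠ 0) (hp' : p + 1 ≠ Fintype.card σ) (r : Fin (F.rank p)) :
    F.deg p r = F.deg 0 F.idx + p + 1 := by
  rcases deg_bounds hp r with h | h
  · omega
  · obtain ⟨y', h1, h2⟩ := exists_zig_gen (F := F) p r
    rw [h] at h2
    exact absurd (h2.isStdBoundary_of_stdClass_eq_zero (h2.stdClass_eq_zero hp'))
      (h1.not_isStdBoundary (constantCoeff_gen _ _))

lemma deg_top {p : ℕ} (hp : p ≠ 0) (hp' : p + 1 = Fintype.card σ) (r : Fin (F.rank p)) :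
    F.deg p r = F.deg 0 F.idx + p + 2 := by
  rcases deg_bounds hp r with h | h
  · obtain ⟨y', h1, h2⟩ := exists_zig_gen (F := F) p r
    rw [h] at h2
    exact absurd (h2.isStdBoundary_of_degree_one hp')
      (h1.not_isStdBoundary (constantCoeff_gen _ _))
  · omega

omit [Nontrivial σ] in
lemma stdClass_linear [Nonempty σ] (a b : K) (y z : Finset σ → MvPolynomial σ K) :
    stdClass (fun S => C a * y S + C b * z S) = a * stdClass y + b * stdClass z := by
  have : ∀ p i, wedge K K i (evalAt p fun S => C a * y S + C b * z S) Finset.univ =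
      a * wedge K K i (evalAt p y) Finset.univ + b * wedge K K i (evalAt p z) Finset.univ := by
    intro p i
    simp only [wedge_apply, Finset.mem_univ, if_true, evalAt, map_add, map_mul, eval_C, smul_add,
      mul_smul_comm]
  simp only [stdClass, this, Finset.sum_add_distrib, ← Finset.mul_sum]
  ring

omit [Nontrivial σ] in
lemma _root_.PointsResolution.IsStdCycle.linear {k : ℕ} {j : ℤ}
    {y z : Finset σ → MvPolynomial σ K} (hy : IsStdCycle k j y) (hz : IsStdCycle k j z) (a b : K) :
    IsStdCycle k j (fun S => C a * y S + C b * z S) where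
  inDegree S hS := by simp [hy.inDegree S hS, hz.inDegree S hS]
  hom S := by
    have h1 := (isHomZ_C (σ := σ) a).mul (hy.hom S)
    have h2 := (isHomZ_C (σ := σ) b).mul (hz.hom S)
    rw [zero_add] at h1 h2
    exact h1.add h2
  cycle S := by
    have : (fun S => C a * y S + C b * z S) =
      (C a : MvPolynomial σ K) • y + (C b : MvPolynomial σ K) • z := rfl
    rw [this, map_add, map_smul, map_smul]
    exact add_mem (Ideal.mul_mem_left _ _ (hy.cycle S)) (Ideal.mul_mem_left _ _ (hz.cycle S))

/-- Two basis elements of the last module would have proportional classes, so that a nontrivial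
combination of them would be carried to a boundary. -/
lemma rank_top_le {p : ℕ} (hp : p ≠ 0) (hp' : p + 1 = Fintype.card σ) : F.rank p ≤ 1 := by
  by_contra! hlt
  let r : Fin (F.rank p) := ⟨0, by omega⟩
  let s : Fin (F.rank p) := ⟨1, hlt⟩
  have hrs : r ≠ s := by simp [r, s]
  obtain ⟨y, hy1, hy2⟩ := exists_zig_gen (F := F) p r
  obtain ⟨z, hz1, hz2⟩ := exists_zig_gen (F := F) p s
  have e : ∀ r : Fin (F.rank p), F.deg p r - p - F.deg 0 F.idx = 2 := fun r => by
    rw [deg_top hp hp' r]; ring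
  rw [e] at hy2 hz2
  have hbne : stdClass (fun S => z S F.idx) ≠ 0 := fun h =>
    hz1.not_isStdBoundary (constantCoeff_gen _ _) (hz2.isStdBoundary_of_stdClass_eq_zero h)
  set a := stdClass (fun S => y S F.idx)
  set b := stdClass (fun S => z S F.idx)
  have hzig := (hy1.smul (C b)).add (hz1.smul (C (-a)))
  refine hzig.not_isStdBoundary (r := r) ?_ ?_
  · simp [gen, Pi.single_eq_of_ne hrs, hbne]
  · refine IsStdCycle.isStdBoundary_of_stdClass_eq_zero (hy2.linear hz2 b (-a)) ?_
    refine (stdClass_linear b (-a) (fun S => y S F.idx) (fun S => z S F.idx)).trans ?_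
    ring

omit [Fintype σ] [Nontrivial σ] in
/-- The ideal of the variables in `T` is prime. -/
lemma mem_span_X_or_of_mul_mem (T : Finset σ) (f g : MvPolynomial σ K)
    (h : f * g ∈ Ideal.span ((X : σ → MvPolynomial σ K) '' T)) :
    f ∈ Ideal.span ((X : σ → MvPolynomial σ K) '' T) ∨
      g ∈ Ideal.span ((X : σ → MvPolynomial σ K) '' T) := by
  set P := Ideal.span ((X : σ → MvPolynomial σ K) '' T)
  let ρ : MvPolynomial σ K →ₐ[K] MvPolynomial σ K := aeval fun j => if j ∈ T then 0 else X j
  have h1 : ∀ f, f - ρ f ∈ P := by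
    intro f
    rw [← Ideal.Quotient.eq]
    have : (Ideal.Quotient.mkₐ K P) = (Ideal.Quotient.mkₐ K P).comp ρ := by
      ext j
      simp only [ρ, AlgHom.comp_apply, aeval_X]
      split_ifs with hj
      · rw [map_zero]
        exact Ideal.Quotient.eq_zero_iff_mem.2 (Ideal.subset_span ⟨j, hj, rfl⟩)
      · rfl
    exact DFunLike.congr_fun this f
  have h2 : ∀ f ∈ P, ρ f = 0 := by
    have : P ≤ RingHom.ker ρ := by
      refine Ideal.span_le.2 ?_
      rintro _ ⟨j, hj, rfl⟩
      have hj' : j ∈ T := hj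
      simp [ρ, RingHom.mem_ker, hj']
    exact fun f hf => this hf
  have h3 := h2 _ h
  rw [map_mul, mul_eq_zero] at h3
  rcases h3 with h3 | h3
  · left; simpa [h3] using h1 f
  · right; simpa [h3] using h1 g

/-- The last module of the resolution is nonzero, and the matrix of the last differential vanishes
at the coordinate points. This is seen on the Koszul complex of the linear forms that
vanish at such a point: locally at the point, it is the resolution of the ideal of the point. -/
lemma exists_top_gen {p : ℕ} (hp : p + 2 = Fintype.card σ) (i : σ) :
    F.rank (p + 1) ≠ 0 ∧ (F.rank (p + 1) = 1 → ∀ r s, eval (Pi.single i 1) (F.φ p r s) = 0) := by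
  set T := Finset.univ.erase i with hT
  have hTc : T.card = p + 1 := by
    rw [hT, Finset.card_erase_of_mem (Finset.mem_univ i), Finset.card_univ]; omega
  obtain ⟨f, hf1, hf2, hf3⟩ := exists_isHomZ_eval_eq (σ := σ) (K := K) (j := 2) le_rfl
    (Pi.single i 1) 0
  -- `f` is nonzero at the `i`-th point only, so that `X j * f` vanishes at all points for `j ∈ T`
  let y : F.Tens 0 := fun S _ => if S = T then f else 0
  have hmul : ∀ j ∈ T, X j * f ∈ stdIdeal σ K := by
    intro j hj
    refine mem_stdIdeal ((isHomZ_X j).mul hf1) (fun l => ?_) (by simp [hf3])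
    rw [map_mul, hf2]
    by_cases hl : l = i
    · subst hl
      have : j ≠ l := (Finset.mem_erase.1 hj).1
      simp [this]
    · simp [hl]
  have hw : ∃ w, F.kos T y = F.act 0 w := by
    have hmem : ∀ S, F.kos T y S F.idx ∈ stdIdeal σ K := by
      intro S
      rw [kos, koszul_apply', Finset.sum_apply]
      refine Ideal.sum_mem _ fun j hj => ?_
      rw [Pi.smul_apply, contr_apply, smul_eq_mul]
      split_ifs with hjS
      · simp
      · rw [Pi.smul_apply, mul_smul_comm]
        refine Submodule.smul_of_tower_mem _ _ ?_
        simp only [y]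
        split_ifs
        · exact hmul j hj
        · simp
    choose w hw using fun S => (F.mem_iff _).1 (hmem S)
    refine ⟨w, ?_⟩
    ext1 S; ext1 r
    rw [act, hw, eq_idx r]
  obtain ⟨g, hg1, ⟨y1, hg2⟩, hg3⟩ := exists_climb (F := F) T p 0 p (zero_add p) y
    (fun S hS => by
      ext1 r; simp only [y]; rw [if_neg (by rintro rfl; exact hS hTc)]; rfl)
    (fun S hS => by
      ext1 r; simp only [y]; rw [if_neg (by rintro rfl; exact hS subset_rfl)]; rfl) hw
  have hng : ¬ ∃ u, InDegree 1 u ∧ InVars T u ∧ g = F.kos T u := by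
    intro h
    obtain ⟨u, v, -, -, huv⟩ := hg3 h
    have h1 : f ∈ stdIdeal σ K := by
      have h2 : y - F.kos T u = F.act 0 v := by rw [huv]; abel
      have h3 := eval_of_mem h2 (S := T)
      have h4 : F.kos T u T = 0 := by
        rw [kos, koszul_apply']
        refine Finset.sum_eq_zero fun j hj => ?_
        rw [contr_apply, if_pos hj, smul_zero]
      rw [Pi.sub_apply, h4, sub_zero] at h3
      simpa [y] using h3
    have := eval_single_of_mem_stdIdeal h1 i
    rw [hf2] at this
    simp at this
  refine ⟨fun h0 => hng ⟨0, fun _ _ => rfl, fun _ _ => rfl, ?_⟩, fun h1 r s => ?_⟩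
  · have : IsEmpty (Fin (F.rank (p + 1))) := by rw [h0]; infer_instance
    ext1 S; ext1 r; exact this.elim r
  · have hsub : Subsingleton (Fin (F.rank (p + 1))) := by rw [h1]; infer_instance
    have hgs : g ∅ s ∉ Ideal.span ((X : σ → MvPolynomial σ K) '' T) := by
      intro hmem
      apply hng
      have hgT : InVars T g := by
        intro S hS
        refine hg1 S fun h0 => hS ?_
        rw [Finset.card_eq_zero.1 h0]; exact Finset.empty_subset _
      obtain ⟨b, hb1, hb2, hb3⟩ := koszul_exact_pi (R := MvPolynomial σ K) X
        mem_span_X_of_X_mul_mem T 0 g hg1 hgT (by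
          ext1 S
          rw [koszul_apply']
          refine Finset.sum_eq_zero fun j _ => ?_
          rw [contr_apply]
          split_ifs with hj
          · simp
          · rw [hg1 _ (by simp)]; simp) (fun _ r => by rwa [Subsingleton.elim r s])
      exact ⟨b, hb1, hb2, hb3.symm⟩
    have hmul2 : F.φ p r s * g ∅ s ∈ Ideal.span ((X : σ → MvPolynomial σ K) '' T) := by
      have h2 := congrFun (congrFun hg2 ∅) r
      rw [act, Matrix.mulVecLin_apply, Matrix.mulVec, dotProduct,
        Fintype.sum_subsingleton _ s] at h2
      rw [h2, kos, koszul_apply', Finset.sum_apply]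
      refine Ideal.sum_mem _ fun j hj => ?_
      rw [Pi.smul_apply, smul_eq_mul, mul_comm]
      exact Ideal.mul_mem_left _ _ (Ideal.subset_span ⟨j, hj, rfl⟩)
    have h3 := (mem_span_X_or_of_mul_mem T _ _ hmul2).resolve_right hgs
    have h4 : Ideal.span ((X : σ → MvPolynomial σ K) '' T) ≤
        RingHom.ker (eval (Pi.single i (1 : K)) : MvPolynomial σ K →+* K) := by
      refine Ideal.span_le.2 ?_
      rintro _ ⟨j, hj, rfl⟩
      have : j ≠ i := (Finset.mem_erase.1 hj).1
      simp [RingHom.mem_ker, this]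
    exact h4 h3

end CyclicRes

/-! ### Coordinates adapted to the points -/

lemma eval_smul_of_isHomogeneous {σ L : Type*} [Field L] {d : ℕ} {f : MvPolynomial σ L}
    (hf : f.IsHomogeneous d) (c : L) (p : σ → L) : eval (c • p) f = c ^ d * eval p f := by
  rw [eval_eq, eval_eq, Finset.mul_sum]
  refine Finset.sum_congr rfl fun e he => ?_
  have : ∑ i ∈ e.support, e i = d := (hf.degree_eq_sum_deg_support he).symm
  simp only [Pi.smul_apply, smul_eq_mul, mul_pow, Finset.prod_mul_distrib]
  rw [Finset.prod_pow_eq_pow_sum, this]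
  ring

/-- Homogeneous coordinates of points in general position may be scaled in such a way that all of
them but the last form a basis, whose sum is the last one. -/
lemma exists_basis_of_general {L : Type*} [Field L] {N : ℕ} (X : Finset (ℙ L (Fin N → L)))
    (hc : X.card = N + 1)
    (hg : ∀ T ⊆ X, T.card = N → ∀ l : Module.Dual L (Fin N → L), (∀ P ∈ T, l P.rep = 0) → l = 0) :
    ∃ b : Module.Basis (Fin N) L (Fin N → L), ∀ (d : ℕ) (f : MvPolynomial (Fin N) L),
      f.IsHomogeneous d → ((∀ P ∈ X, eval P.rep f = 0) ↔
        (∀ i, eval (b i) f = 0) ∧ eval (∑ i, b i) f = 0) := by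
  classical
  obtain ⟨P0, hP0⟩ : X.Nonempty := by rw [← Finset.card_pos]; omega
  have hc' : (X.erase P0).card = N := by rw [Finset.card_erase_of_mem hP0]; omega
  let e : Fin N ≃ X.erase P0 := (Finset.equivFinOfCardEq hc').symm
  let q : Fin N → Fin N → L := fun i => (e i : ℙ L (Fin N → L)).rep
  have hspan : ⊤ ≤ Submodule.span L (Set.range q) := by
    by_contra hlt
    obtain ⟨l, hl, hl'⟩ := Submodule.exists_le_ker_of_lt_top _ (lt_top_iff_ne_top.2
      fun h => hlt h.ge)
    refine hl (hg _ (Finset.erase_subset _ _) hc' l fun P hP => ?_)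
    have : q (e.symm ⟨P, hP⟩) = P.rep := by simp [q]
    rw [← this]
    exact hl' (Submodule.subset_span ⟨_, rfl⟩)
  let bq : Module.Basis (Fin N) L (Fin N → L) :=
    basisOfTopLeSpanOfCardEqFinrank q hspan (by simp)
  have hbq : ∀ i, bq i = q i := fun i => by simp [bq]
  have hne : ∀ i, bq.repr P0.rep i ≠ 0 := by
    intro i h0
    have h1 : bq.coord i = 0 := by
      refine hg (X.erase (e i : ℙ L (Fin N → L))) (Finset.erase_subset _ _) ?_ _ fun P hP => ?_
      · rw [Finset.card_erase_of_mem (Finset.mem_of_mem_erase (e i).2)]; omega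
      · by_cases hPP : P = P0
        · subst hPP; exact h0
        · have hPm : P ∈ X.erase P0 := Finset.mem_erase.2 ⟨hPP, Finset.mem_of_mem_erase hP⟩
          have h2 : bq (e.symm ⟨P, hPm⟩) = P.rep := by rw [hbq]; simp [q]
          have h3 : e.symm ⟨P, hPm⟩ ≠ i := by
            intro h
            rw [Equiv.symm_apply_eq] at h
            exact (Finset.mem_erase.1 hP).1 (congrArg Subtype.val h)
          rw [← h2, Module.Basis.coord_apply, Module.Basis.repr_self, Finsupp.single_apply,
            if_neg h3]
    have h4 : bq.coord i (bq i) = 1 := by simp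
    rw [h1] at h4
    simp at h4
  let b : Module.Basis (Fin N) L (Fin N → L) := bq.isUnitSMul fun i => (hne i).isUnit
  have hb : ∀ i, b i = bq.repr P0.rep i • q i := fun i => by
    simp only [b, Module.Basis.isUnitSMul_apply, hbq]
  have hsum : ∑ i, b i = P0.rep := by
    rw [← bq.sum_repr P0.rep]
    exact Finset.sum_congr rfl fun i _ => by rw [hb, hbq]
  refine ⟨b, fun d f hf => ?_⟩
  have hiff : ∀ i, eval (b i) f = 0 ↔ eval (q i) f = 0 := fun i => by
    rw [hb, eval_smul_of_isHomogeneous hf, mul_eq_zero, or_iff_right (pow_ne_zero _ (hne i))]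
  simp only [hiff, hsum]
  constructor
  · exact fun h => ⟨fun i => h _ (Finset.mem_of_mem_erase (e i).2), h _ hP0⟩
  · rintro ⟨h1, h2⟩ P hP
    by_cases hPP : P = P0
    · rw [hPP]; exact h2
    · have := h1 (e.symm ⟨P, Finset.mem_erase.2 ⟨hPP, hP⟩⟩)
      simpa [q] using this

/-! ### Base change of the resolution -/

section BaseChange

/-- Exactness of a sequence of matrices is preserved by a ring homomorphism `h : R → S` that makes
`S` a free `R`-module. -/
lemma exact_map_of_basis {R S ι : Type*} [CommRing R] [CommRing S] (h : R →+* S) (B : ι → S)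
    (hsurj : ∀ f : S, ∃ c : ι →₀ R, f = c.sum fun i a => B i * h a)
    (hinj : ∀ c : ι →₀ R, (c.sum fun i a => B i * h a) = 0 → c = 0)
    {p q r : ℕ} (M : Matrix (Fin p) (Fin q) R) (M' : Matrix (Fin q) (Fin r) R)
    (hM : Function.Exact M'.mulVecLin M.mulVecLin) :
    Function.Exact (M'.map h).mulVecLin (M.map h).mulVecLin := by
  classical
  intro v
  constructor
  · intro hv
    choose c hc using fun s => hsurj (v s)
    have hker : ∀ i, M.mulVecLin (fun s => c s i) = 0 := by
      intro i
      ext t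
      have h1 : ∑ s, M t s • c s = 0 := by
        apply hinj
        have h2 := congrFun hv t
        rw [Matrix.mulVecLin_apply, Matrix.mulVec, dotProduct, Pi.zero_apply] at h2
        rw [← h2, ← Finsupp.sum_finsetSum_index]
        · refine Finset.sum_congr rfl fun s _ => ?_
          rw [Finsupp.sum_smul_index (by simp), Matrix.map_apply, hc s, Finsupp.sum, Finsupp.sum,
            Finset.mul_sum]
          exact Finset.sum_congr rfl fun i _ => by rw [map_mul]; ring
        · simp
        · intro i a b; rw [map_add, mul_add]
      have := DFunLike.congr_fun h1 i
      simpa [Matrix.mulVec, dotProduct, Finsupp.finsetSum_apply] using this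
    choose w hw using fun i => (hM _).1 (hker i)
    refine ⟨fun u => ∑ i ∈ Finset.univ.biUnion fun s => (c s).support, B i * h (w i u), ?_⟩
    ext s
    rw [Matrix.mulVecLin_apply, Matrix.mulVec, dotProduct, hc s, Finsupp.sum_of_support_subset _
      (Finset.subset_biUnion_of_mem (fun s => (c s).support) (Finset.mem_univ s)) _ (by simp)]
    simp only [Finset.mul_sum]
    rw [Finset.sum_comm]
    refine Finset.sum_congr rfl fun i _ => ?_
    have h3 := congrFun (hw i) s
    rw [Matrix.mulVecLin_apply, Matrix.mulVec, dotProduct] at h3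
    rw [← h3, map_sum, Finset.mul_sum]
    exact Finset.sum_congr rfl fun u _ => by rw [Matrix.map_apply, map_mul]; ring
  · rintro ⟨w, rfl⟩
    have h0 : M * M' = 0 := by
      ext t u
      have h2 : M.mulVecLin (M'.mulVecLin (Pi.single u 1)) = 0 := (hM _).2 ⟨_, rfl⟩
      have h3 := congrFun h2 t
      rw [Matrix.mulVecLin_apply, Matrix.mulVecLin_apply, Matrix.mulVec_mulVec] at h3
      simpa using h3
    rw [Matrix.mulVecLin_apply, Matrix.mulVecLin_apply, Matrix.mulVec_mulVec, ← Matrix.map_mul, h0]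
    simp

variable {σ K L : Type*} [Field K] [Field L] [Algebra K L]

lemma exists_eq_sum_basis {ι : Type*} (B : Module.Basis ι K L) (f : MvPolynomial σ L) :
    ∃ c : ι →₀ MvPolynomial σ K,
      f = c.sum fun i a => C (B i) * MvPolynomial.map (algebraMap K L) a := by
  classical
  induction f using MvPolynomial.induction_on' with
  | monomial e a =>
    refine ⟨(B.repr a).mapRange (monomial e) (map_zero _), ?_⟩
    rw [Finsupp.sum_mapRange_index (by simp)]
    conv_lhs => rw [← B.linearCombination_repr a, Finsupp.linearCombination_apply]
    rw [Finsupp.sum, map_sum, Finsupp.sum]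
    refine Finset.sum_congr rfl fun i _ => ?_
    rw [map_monomial, C_mul_monomial, Algebra.smul_def, mul_comm]
  | add f g hf hg =>
    obtain ⟨c, rfl⟩ := hf
    obtain ⟨d, rfl⟩ := hg
    exact ⟨c + d, (Finsupp.sum_add_index' (by simp) (by simp [mul_add])).symm⟩

lemma sum_basis_injective {ι : Type*} (B : Module.Basis ι K L) (c : ι →₀ MvPolynomial σ K)
    (h : (c.sum fun i a => C (B i) * MvPolynomial.map (algebraMap K L) a) = 0) : c = 0 := by
  ext i e
  have h1 : (∑ j ∈ c.support, coeff e (c j) • B j) = 0 := by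
    have := congrArg (coeff e) h
    rw [Finsupp.sum, coeff_sum, coeff_zero] at this
    rw [← this]
    refine Finset.sum_congr rfl fun j _ => ?_
    rw [coeff_C_mul, coeff_map, Algebra.smul_def, mul_comm]
  by_cases hi : i ∈ c.support
  · exact linearIndependent_iff'.1 B.linearIndependent _ _ h1 i hi
  · rw [Finsupp.notMem_support_iff.1 hi]; rfl

/-- The substitution of coordinates for which the basis `b` becomes the standard basis. -/
def coordSubst {N : ℕ} (b : Module.Basis (Fin N) L (Fin N → L)) :
    MvPolynomial (Fin N) L →ₐ[L] MvPolynomial (Fin N) L :=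
  aeval fun j => ∑ i, C (b i j) * X i

lemma eval_coordSubst {N : ℕ} (b : Module.Basis (Fin N) L (Fin N → L)) (p : Fin N → L)
    (f : MvPolynomial (Fin N) L) : eval p (coordSubst b f) = eval (∑ i, p i • b i) f := by
  have : (aeval p).comp (coordSubst b) = (aeval (∑ i, p i • b i) : _ →ₐ[L] L) := by
    ext j
    simp [coordSubst, Finset.sum_apply, mul_comm]
  simpa [coe_aeval_eq_eval] using DFunLike.congr_fun this f

/-- The inverse of the substitution `coordSubst b`. -/
def coordSubstInv {N : ℕ} (b : Module.Basis (Fin N) L (Fin N → L)) :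
    MvPolynomial (Fin N) L →ₐ[L] MvPolynomial (Fin N) L :=
  aeval fun i => ∑ j, C (b.repr (Pi.single j 1) i) * X j

lemma coordSubstInv_coordSubst {N : ℕ} (b : Module.Basis (Fin N) L (Fin N → L))
    (f : MvPolynomial (Fin N) L) : coordSubstInv b (coordSubst b f) = f := by
  have h1 : (coordSubstInv b).comp (coordSubst b) = AlgHom.id L _ := by
    ext1 l
    simp only [coordSubst, coordSubstInv, AlgHom.comp_apply, aeval_X, map_sum, map_mul, AlgHom.id_apply,
      algHom_C, algebraMap_eq, Finset.mul_sum]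
    rw [Finset.sum_comm, Finset.sum_eq_single l]
    · have h := congrFun (b.sum_repr (Pi.single l 1)) l
      rw [Finset.sum_apply, Pi.single_eq_same] at h
      simp only [← mul_assoc, ← Finset.sum_mul, ← C_mul, ← map_sum]
      rw [Finset.sum_congr rfl fun i _ => mul_comm (b i l) _]
      simp only [Pi.smul_apply, smul_eq_mul] at h
      rw [h]; simp
    · intro j _ hj
      have h := congrFun (b.sum_repr (Pi.single j 1)) l
      rw [Finset.sum_apply, Pi.single_eq_of_ne hj.symm] at h
      simp only [← mul_assoc, ← Finset.sum_mul, ← C_mul, ← map_sum]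
      rw [Finset.sum_congr rfl fun i _ => mul_comm (b i l) _]
      simp only [Pi.smul_apply, smul_eq_mul] at h
      rw [h]; simp
    · simp
  exact DFunLike.congr_fun h1 f

lemma coordSubst_coordSubstInv {N : ℕ} (b : Module.Basis (Fin N) L (Fin N → L))
    (f : MvPolynomial (Fin N) L) : coordSubst b (coordSubstInv b f) = f := by
  have h2 : (coordSubst b).comp (coordSubstInv b) = AlgHom.id L _ := by
    ext1 l
    simp only [coordSubst, coordSubstInv, AlgHom.comp_apply, aeval_X, map_sum, map_mul, AlgHom.id_apply,
      algHom_C, algebraMap_eq, Finset.mul_sum]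
    have h3 : ∀ i, ∑ j, b i j * b.repr (Pi.single j 1) l = if i = l then 1 else 0 := by
      intro i
      have h4 : b i = ∑ j, b i j • (Pi.single j 1 : Fin N → L) := by
        ext l; simp [Finset.sum_apply, Pi.single_apply]
      have h5 := congrArg (fun v => b.repr v l) h4
      simp only [Module.Basis.repr_self, map_sum, map_smul, Finsupp.finsetSum_apply,
        Finsupp.smul_apply, smul_eq_mul, Finsupp.single_apply] at h5
      exact h5.symm
    rw [Finset.sum_comm]
    simp only [← mul_assoc, ← Finset.sum_mul, ← C_mul, ← map_sum]
    rw [Finset.sum_congr rfl fun i _ => by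
      rw [Finset.sum_congr rfl fun j _ => mul_comm (b.repr (Pi.single j 1) l) _, h3]]
    simp
  exact DFunLike.congr_fun h2 f

lemma isHomogeneous_coordSubst {N d : ℕ} (b : Module.Basis (Fin N) L (Fin N → L))
    {f : MvPolynomial (Fin N) L} (hf : f.IsHomogeneous d) : (coordSubst b f).IsHomogeneous d := by
  have := hf.aeval (fun j => ∑ i, C (b i j) * X i : Fin N → MvPolynomial (Fin N) L) (n := 1)
    fun j => IsHomogeneous.sum _ _ _ fun i _ => isHomogeneous_C_mul_X _ _
  simpa [coordSubst] using this

lemma isHomogeneous_coordSubstInv {N d : ℕ} (b : Module.Basis (Fin N) L (Fin N → L))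
    {f : MvPolynomial (Fin N) L} (hf : f.IsHomogeneous d) :
    (coordSubstInv b f).IsHomogeneous d := by
  have := hf.aeval (fun i => ∑ j, C (b.repr (Pi.single j 1) i) * X j :
    Fin N → MvPolynomial (Fin N) L) (n := 1)
    fun j => IsHomogeneous.sum _ _ _ fun i _ => isHomogeneous_C_mul_X _ _
  simpa [coordSubstInv] using this

/-- Extension of scalars from `K` to `L`, followed by a change of coordinates. -/
def baseChangeHom {N : ℕ} (K : Type*) [Field K] [Algebra K L]
    (b : Module.Basis (Fin N) L (Fin N → L)) :
    MvPolynomial (Fin N) K →+* MvPolynomial (Fin N) L :=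
  (coordSubst b).toRingHom.comp (MvPolynomial.map (algebraMap K L))

lemma IsHomZ.baseChangeHom {N : ℕ} {d : ℤ} (b : Module.Basis (Fin N) L (Fin N → L))
    {f : MvPolynomial (Fin N) K} (hf : IsHomZ d f) :
    IsHomZ d (PointsResolution.baseChangeHom K b f) := by
  rcases lt_or_ge d 0 with hd | hd
  · rw [hf.eq_zero_of_neg hd, map_zero]; exact isHomZ_zero _
  · lift d to ℕ using hd
    rw [isHomZ_natCast] at hf ⊢
    exact isHomogeneous_coordSubst b (hf.map _)

lemma constantCoeff_baseChangeHom {N : ℕ} (b : Module.Basis (Fin N) L (Fin N → L))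
    {f : MvPolynomial (Fin N) K} (hf : constantCoeff f = 0) :
    constantCoeff (baseChangeHom K b f) = 0 := by
  have h1 : ∀ f : MvPolynomial (Fin N) L, constantCoeff f = eval 0 f := fun f => by
    rw [eval_zero]
  rw [h1]
  have := eval_coordSubst b 0 (MvPolynomial.map (algebraMap K L) f)
  simp only [Pi.zero_apply, zero_smul, Finset.sum_const_zero] at this
  refine this.trans ?_
  rw [← h1, constantCoeff_map, hf, map_zero]

/-- The resolution of `R / I` over `K` yields a resolution over `L`. -/
def CyclicRes.baseChange {N : ℕ} {I : Ideal (MvPolynomial (Fin N) K)} (F : CyclicRes I)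
    (b : Module.Basis (Fin N) L (Fin N → L)) {J : Ideal (MvPolynomial (Fin N) L)}
    (hJ : I.map (baseChangeHom K b) = J) : CyclicRes J where
  rank := F.rank
  deg := F.deg
  φ k := (F.φ k).map (baseChangeHom K b)
  graded k r s := (F.graded k r s).baseChangeHom b
  exact k := by
    let B := Module.Basis.ofVectorSpace K L
    refine exact_map_of_basis (baseChangeHom K b) (fun i => C (B i)) (fun f => ?_)
      (fun c hc => ?_) _ _ (F.exact k)
    · obtain ⟨g, rfl⟩ : ∃ g, coordSubst b g = f := ⟨_, coordSubst_coordSubstInv b f⟩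
      obtain ⟨c, rfl⟩ := exists_eq_sum_basis B g
      refine ⟨c, ?_⟩
      rw [Finsupp.sum, map_sum, Finsupp.sum]
      exact Finset.sum_congr rfl fun i _ => by
        rw [map_mul, algHom_C]; rfl
    · apply sum_basis_injective B
      apply (Function.LeftInverse.injective (coordSubstInv_coordSubst b))
      rw [map_zero, ← hc, Finsupp.sum, map_sum, Finsupp.sum]
      exact Finset.sum_congr rfl fun i _ => by
        rw [map_mul, algHom_C]; rfl
  minimal k r s := constantCoeff_baseChangeHom b (F.minimal k r s)
  rank_zero := F.rank_zero
  mem_iff f := by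
    have hs : Subsingleton (Fin (F.rank 0)) := by rw [F.rank_zero]; infer_instance
    have hI : I = Ideal.span (Set.range (F.φ 0 F.idx)) := by
      ext g
      rw [F.mem_iff, Ideal.mem_span_range_iff_exists_fun]
      refine exists_congr fun v => ?_
      rw [_root_.funext_iff]
      constructor
      · intro h
        rw [← h F.idx, Matrix.mulVecLin_apply, Matrix.mulVec, dotProduct]
        exact Finset.sum_congr rfl fun s _ => mul_comm _ _
      · intro h r
        rw [CyclicRes.eq_idx r, ← h, Matrix.mulVecLin_apply, Matrix.mulVec, dotProduct]
        exact Finset.sum_congr rfl fun s _ => mul_comm _ _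
    rw [← hJ]
    conv_lhs => rw [hI]
    rw [Ideal.map_span, ← Set.range_comp, Ideal.mem_span_range_iff_exists_fun]
    refine exists_congr fun v => ?_
    rw [_root_.funext_iff]
    constructor
    · intro h r
      rw [CyclicRes.eq_idx r, ← h, Matrix.mulVecLin_apply, Matrix.mulVec, dotProduct]
      exact Finset.sum_congr rfl fun s _ => mul_comm _ _
    · intro h
      rw [← h F.idx, Matrix.mulVecLin_apply, Matrix.mulVec, dotProduct]
      exact Finset.sum_congr rfl fun s _ => mul_comm _ _

end BaseChange

/-- A minimal free resolution of a cyclic module starts with a module of rank one, in which the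
image of the next module is the annihilator `I`. -/
lemma MinFreeRes.rank_zero_and_mem_iff {σ K : Type*} [Field K] {I : Ideal (MvPolynomial σ K)}
    (F : MinFreeRes I) (hI : I ≠ ⊤) :
    F.rank 0 = 1 ∧ ∀ f, f ∈ I ↔ ∃ v, (F.φ 0).mulVecLin v = fun _ => f := by
  obtain ⟨e⟩ := F.coker
  have hsm : ∀ a : MvPolynomial σ K, a • (1 : MvPolynomial σ K ⧸ I) = Ideal.Quotient.mk I a :=
    fun a => (Submodule.Quotient.mk_smul I a (1 : MvPolynomial σ K)).symm.trans
      (by rw [smul_eq_mul, mul_one]; rfl)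
  set P := LinearMap.range (F.φ 0).mulVecLin
  obtain ⟨v, hv⟩ := Submodule.mkQ_surjective P (e.symm 1)
  have hgen : ∀ w, ∃ a : MvPolynomial σ K, w - a • v ∈ P := by
    intro w
    obtain ⟨a, ha⟩ := Ideal.Quotient.mk_surjective (e (P.mkQ w))
    refine ⟨a, ?_⟩
    rw [← Submodule.Quotient.mk_eq_zero, ← Submodule.mkQ_apply, map_sub, map_smul, hv, sub_eq_zero]
    apply e.injective
    rw [map_smul, e.apply_symm_apply, ← ha, hsm]
  have hP : ∀ w ∈ P, ∀ r, constantCoeff (w r) = 0 := by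
    rintro _ ⟨u, rfl⟩ r
    rw [Matrix.mulVecLin_apply, Matrix.mulVec, dotProduct, map_sum]
    exact Finset.sum_eq_zero fun s _ => by rw [map_mul, F.minimal, zero_mul]
  have h0 : F.rank 0 ≠ 0 := by
    intro h0
    have : IsEmpty (Fin (F.rank 0)) := by rw [h0]; infer_instance
    have h1 : (1 : MvPolynomial σ K ⧸ I) = 0 := by
      rw [← e.apply_symm_apply 1, ← hv, Subsingleton.elim v 0, map_zero, map_zero]
    have h2 : (1 : MvPolynomial σ K) ∈ I := Ideal.Quotient.eq_zero_iff_mem.1 (by simpa using h1)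
    exact hI ((Ideal.eq_top_iff_one I).2 h2)
  have h1 : F.rank 0 ≤ 1 := by
    by_contra! hlt
    let r : Fin (F.rank 0) := ⟨0, by omega⟩
    let s : Fin (F.rank 0) := ⟨1, hlt⟩
    have hrs : r ≠ s := by simp [r, s]
    obtain ⟨a, ha⟩ := hgen (Pi.single r 1)
    obtain ⟨c, hc⟩ := hgen (Pi.single s 1)
    have e1 := hP _ ha r
    have e2 := hP _ ha s
    have e3 := hP _ hc s
    simp [Pi.single_eq_of_ne hrs.symm] at e1 e2 e3
    rcases e2 with e2 | e2
    · simp [e2] at e1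
    · simp [e2] at e3
  have h2 : F.rank 0 = 1 := by omega
  refine ⟨h2, fun f => ?_⟩
  have hs : Subsingleton (Fin (F.rank 0)) := by rw [h2]; infer_instance
  constructor
  · intro hf
    have : (fun _ => f : Fin (F.rank 0) → MvPolynomial σ K) ∈ P := by
      rw [← Submodule.Quotient.mk_eq_zero, ← Submodule.mkQ_apply]
      have h3 : (fun _ => f : Fin (F.rank 0) → MvPolynomial σ K) = f • 1 := by ext1; simp
      apply e.injective
      rw [h3, map_smul, map_smul, map_zero]
      obtain ⟨a, ha⟩ := Ideal.Quotient.mk_surjective (e (P.mkQ 1))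
      rw [← ha]
      exact Ideal.Quotient.eq_zero_iff_mem.2 (Ideal.mul_mem_right _ _ hf)
    exact this
  · intro hf
    have hf' : (fun _ => f : Fin (F.rank 0) → MvPolynomial σ K) ∈ P := hf
    have h3 : f • v = v ⟨0, by omega⟩ • (fun _ => f : Fin (F.rank 0) → MvPolynomial σ K) := by
      ext1 r
      rw [Subsingleton.elim r ⟨0, by omega⟩]
      simp [mul_comm]
    have h4 : f • v ∈ P := h3 ▸ P.smul_mem _ hf'
    rw [← Submodule.Quotient.mk_eq_zero, ← Submodule.mkQ_apply, map_smul, hv] at h4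
    have h5 := congrArg e h4
    rw [map_smul, e.apply_symm_apply, map_zero] at h5
    refine Ideal.Quotient.eq_zero_iff_mem.1 ?_
    rw [← h5, hsm]

/-- A minimal resolution over `K`, with the integer grading of its differentials. -/
def MinFreeRes.toCyclicRes {σ K : Type*} [Field K] {I : Ideal (MvPolynomial σ K)}
    (F : MinFreeRes I) (hI : I ≠ ⊤) : CyclicRes I where
  rank := F.rank
  deg := F.deg
  φ := F.φ
  graded k r s e he := by have := F.graded k r s e he; omega
  exact := F.exact
  minimal := F.minimal
  rank_zero := (F.rank_zero_and_mem_iff hI).1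
  mem_iff := (F.rank_zero_and_mem_iff hI).2

lemma homIdeal_map_coordSubst {L : Type*} [Field L] {N : ℕ} (X : Finset (ℙ L (Fin N → L)))
    (b : Module.Basis (Fin N) L (Fin N → L))
    (hb : ∀ (d : ℕ) (f : MvPolynomial (Fin N) L), f.IsHomogeneous d →
      ((∀ P ∈ X, eval P.rep f = 0) ↔ (∀ i, eval (b i) f = 0) ∧ eval (∑ i, b i) f = 0)) :
    (homIdeal L X).map (coordSubst b) = stdIdeal (Fin N) L := by
  have e1 : ∀ i f, eval (Pi.single i 1) (coordSubst b f) = eval (b i) f := fun i f => by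
    rw [eval_coordSubst]; congr 2; simp [Pi.single_apply]
  have e2 : ∀ f, eval 1 (coordSubst b f) = eval (∑ i, b i) f := fun f => by
    rw [eval_coordSubst]; simp
  unfold homIdeal stdIdeal
  rw [Ideal.map_span]
  congr 1
  ext f
  simp only [Set.mem_image, Set.mem_ofPred_eq]
  constructor
  · rintro ⟨g, ⟨⟨d, hd⟩, hg⟩, rfl⟩
    obtain ⟨h1, h2⟩ := (hb d g hd).1 hg
    exact ⟨⟨d, isHomogeneous_coordSubst b hd⟩, fun i => by rw [e1, h1], by rw [e2, h2]⟩
  · rintro ⟨⟨d, hd⟩, h1, h2⟩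
    have hg := isHomogeneous_coordSubstInv b hd
    have hgf := coordSubst_coordSubstInv b f
    exact ⟨_, ⟨⟨d, hg⟩, (hb d _ hg).2
      ⟨fun i => by rw [← e1, hgf, h1], by rw [← e2, hgf, h2]⟩⟩, hgf⟩

/-- The shape of a minimal free resolution of the coordinate ring of points in general position,
and the vanishing of its first and last differentials at the points. -/
theorem MinFreeRes.shape {K : Type*} [Field K] {m : ℕ}
    {X : Finset (ℙ (AlgebraicClosure K) (Fin (m + 3) → AlgebraicClosure K))}
    (hX : IsGeneralPosition K X) (F : MinFreeRes (homIdeal K X)) :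
    (F.rank 0 = 1 ∧ F.rank (m + 2) = 1 ∧ (∀ k, m + 2 < k → F.rank k = 0) ∧
      (∀ r s, (F.φ 0 r s).IsHomogeneous 2) ∧ (∀ r s, (F.φ (m + 1) r s).IsHomogeneous 2) ∧
      (∀ k, 1 ≤ k → k ≤ m → ∀ r s, (F.φ k r s).IsHomogeneous 1)) ∧
    ∃ b : Module.Basis (Fin (m + 3)) (AlgebraicClosure K) (Fin (m + 3) → AlgebraicClosure K),
      (∀ i r s, aeval (b i) (F.φ 0 r s) = 0) ∧ (∀ i r s, aeval (b i) (F.φ (m + 1) r s) = 0) := by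
  set L := AlgebraicClosure K
  obtain ⟨b, hb⟩ := exists_basis_of_general X hX.card_eq hX.general
  have hmap : (homIdeal K X).map (baseChangeHom K b) = stdIdeal (Fin (m + 3)) L := by
    rw [← homIdeal_map_coordSubst X b hb, ← hX.defined_over, baseChangeHom, ← Ideal.map_map]
    rfl
  have hI : homIdeal K X ≠ ⊤ := by
    intro h
    rw [h, Ideal.map_top] at hmap
    have : (1 : MvPolynomial (Fin (m + 3)) L) ∈ stdIdeal (Fin (m + 3)) L := by rw [← hmap]; trivial
    have := eval_single_of_mem_stdIdeal this 0
    simp at this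
  let F' : CyclicRes (stdIdeal (Fin (m + 3)) L) := (F.toCyclicRes hI).baseChange b hmap
  have hcard : Fintype.card (Fin (m + 3)) = m + 3 := Fintype.card_fin _
  have h0 : F.rank 0 = 1 := F'.rank_zero
  have htop : F.rank (m + 2) = 1 := by
    have h1 : F.rank (m + 2) ≤ 1 :=
      CyclicRes.rank_top_le (F := F') (p := m + 2) (by omega) (by rw [hcard])
    have h2 : F.rank (m + 2) ≠ 0 :=
      (CyclicRes.exists_top_gen (F := F') (p := m + 1) (by rw [hcard]) 0).1
    omega
  have hidx : ∀ r, F.deg 0 r = F'.deg 0 F'.idx := fun r => by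
    rw [← CyclicRes.eq_idx (F := F') r]; rfl
  have hmid : ∀ p, p ≠ 0 → p ≠ m + 2 → ∀ r, F.deg p r = F'.deg 0 F'.idx + p + 1 :=
    fun p hp hp' r => CyclicRes.deg_eq (F := F') hp (by rw [hcard]; omega) r
  have hlast : ∀ r, F.deg (m + 2) r = F'.deg 0 F'.idx + (m + 2 : ℕ) + 2 :=
    fun r => CyclicRes.deg_top (F := F') (by omega) (by rw [hcard]) r
  have hgr : ∀ k r s (d : ℕ), F.deg (k + 1) s - F.deg k r = d → (F.φ k r s).IsHomogeneous d :=
    fun k r s d hd => isHomZ_natCast.1 (hd ▸ (F.toCyclicRes hI).graded k r s)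
  have heval : ∀ i (f : MvPolynomial (Fin (m + 3)) K),
      eval (Pi.single i 1) (baseChangeHom K b f) = aeval (b i) f := by
    intro i f
    rw [baseChangeHom]
    refine (eval_coordSubst b _ _).trans ?_
    rw [eval_map, aeval_def]
    congr 1
    simp [Pi.single_apply]
  refine ⟨⟨h0, htop, fun k hk => ?_, fun r s => ?_, fun r s => ?_, fun k hk hk' r s => ?_⟩, b,
    fun i r s => ?_, fun i r s => ?_⟩
  · exact CyclicRes.rank_eq_zero (F := F') (by rw [hcard]; omega)
  · refine hgr _ _ _ _ ?_
    have h1 := hmid (0 + 1) one_ne_zero (by omega) s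
    rw [h1, hidx]; push_cast; ring
  · refine hgr _ _ _ _ ?_
    rw [hlast, hmid (m + 1) (by omega) (by omega)]; push_cast; ring
  · refine hgr _ _ _ _ ?_
    rw [hmid (k + 1) (by omega) (by omega), hmid k (by omega) (by omega)]; push_cast; ring
  · have h1 : baseChangeHom K b (F.φ 0 r s) ∈ stdIdeal (Fin (m + 3)) L := by
      refine (F'.mem_iff _).2 ⟨Pi.single s 1, ?_⟩
      have : Subsingleton (Fin (F.rank 0)) := by rw [h0]; infer_instance
      ext1 r'
      have h2 := congrFun
        (Matrix.mulVec_single_one ((F.φ 0).map (baseChangeHom K b)) s) r'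
      exact h2.trans (congrArg (fun r => baseChangeHom K b (F.φ 0 r s)) (Subsingleton.elim _ _))
    rw [← heval]
    exact eval_single_of_mem_stdIdeal h1 i
  · rw [← heval]
    exact (CyclicRes.exists_top_gen (F := F') (p := m + 1) (by rw [hcard]) i).2 htop r s

/-! ### Products along chains of anticommuting matrices -/

section Products

variable {S V : Type*} [CommRing S]

lemma pathProd_succ_left {ρ : ℕ → ℕ} (D : ∀ k, V → Matrix (Fin (ρ k)) (Fin (ρ (k + 1))) S)
    (t : ℕ) (a : Fin (t + 1) → V) :
    pathProd D (t + 1) a = D 0 (a 0) *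
      pathProd (ρ := fun k => ρ (k + 1)) (fun k => D (k + 1)) t (fun r => a r.succ) := by
  induction t with
  | zero =>
    simp only [pathProd, Matrix.one_mul]
    exact (Matrix.mul_one _).symm
  | succ t ih =>
    rw [pathProd, ih]
    exact Matrix.mul_assoc _ _ _

lemma pathProd_adjacent_swap {ρ : ℕ → ℕ} (D : ∀ k, V → Matrix (Fin (ρ k)) (Fin (ρ (k + 1))) S)
    (t : ℕ) (hD : ∀ k, k + 1 < t → ∀ x y, D k x * D (k + 1) y = -(D k y * D (k + 1) x))
    (a : Fin t → V) (r : ℕ) (hr : r + 1 < t) :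
    pathProd D t (a ∘ Equiv.swap ⟨r, by omega⟩ ⟨r + 1, hr⟩) = -pathProd D t a := by
  induction t with
  | zero => omega
  | succ t ih =>
    rcases Nat.lt_or_ge (r + 1) t with h | h
    · have h1 : (fun s : Fin t => (a ∘ Equiv.swap ⟨r, by omega⟩ ⟨r + 1, hr⟩) s.castSucc) =
          (fun s : Fin t => a s.castSucc) ∘ Equiv.swap ⟨r, by omega⟩ ⟨r + 1, h⟩ := by
        ext1 s
        simp only [Function.comp_apply]
        congr 1
        simp only [Equiv.swap_apply_def]
        split_ifs <;> simp_all [Fin.ext_iff]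
      have h2 : (a ∘ Equiv.swap ⟨r, by omega⟩ ⟨r + 1, hr⟩) (Fin.last t) = a (Fin.last t) := by
        simp only [Function.comp_apply]
        rw [Equiv.swap_apply_of_ne_of_ne] <;> simp [Fin.ext_iff] <;> omega
      rw [pathProd, pathProd, h1, h2, ih (fun k hk => hD k (by omega)), Matrix.neg_mul]
    · obtain rfl : t = r + 1 := by omega
      have e1 : (⟨r, by omega⟩ : Fin (r + 1 + 1)) = (Fin.last r).castSucc := rfl
      have e2 : (⟨r + 1, hr⟩ : Fin (r + 1 + 1)) = Fin.last (r + 1) := rfl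
      rw [pathProd, pathProd, pathProd, pathProd, e1, e2, Matrix.mul_assoc, Matrix.mul_assoc,
        ← Matrix.mul_neg]
      simp only [Function.comp_apply, Equiv.swap_apply_left, Equiv.swap_apply_right]
      rw [hD r (by omega)]
      congr 2
      ext1 s
      rw [Equiv.swap_apply_of_ne_of_ne] <;> simp [Fin.ext_iff] <;> omega

/-- A function of tuples that changes sign under transpositions of neighbours changes by the sign
under every permutation. -/
lemma comp_perm_of_adjacent {A : Type*} [AddCommGroup A] {t : ℕ} (h : (Fin t → V) → A)
    (H : ∀ a (r : ℕ) (hr : r + 1 < t),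
      h (a ∘ Equiv.swap ⟨r, by omega⟩ ⟨r + 1, hr⟩) = -h a)
    (π : Equiv.Perm (Fin t)) (a : Fin t → V) :
    h (a ∘ π) = (Equiv.Perm.sign π : ℤ) • h a := by
  rcases t with _ | t
  · rw [Subsingleton.elim π 1]; simp
  have hπ : π ∈ Submonoid.closure (Set.range fun i : Fin t ↦ Equiv.swap i.castSucc i.succ) := by
    rw [Equiv.Perm.mclosure_swap_castSucc_succ]; trivial
  induction hπ using Submonoid.closure_induction generalizing a with
  | mem x hx =>
    obtain ⟨i, rfl⟩ := hx
    rw [Equiv.Perm.sign_swap (by simp [Fin.ext_iff])]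
    rw [Units.val_neg, Units.val_one, neg_one_smul]
    exact H a i (by omega)
  | one => simp
  | mul x y hx hy ihx ihy =>
    have : a ∘ ⇑(x * y) = (a ∘ x) ∘ y := rfl
    rw [this, ihy, ihx, smul_smul, Equiv.Perm.sign_mul, mul_comm]
    simp

lemma eq_zero_of_comp_perm {A : Type*} [AddCommGroup A] {t : ℕ} {h : (Fin t → V) → A}
    {π : Equiv.Perm (Fin t)} {a : Fin t → V}
    (h1 : h (a ∘ π) = (Equiv.Perm.sign π : ℤ) • h a) (h2 : h (a ∘ π) = 0) : h a = 0 := by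
  rw [h2] at h1
  rcases Int.units_eq_one_or (Equiv.Perm.sign π) with h3 | h3 <;> simpa [h3] using h1.symm

/-- A function that changes by the sign under permutations and vanishes when the first two entries
agree is alternating; in characteristic two the second condition does not follow from the first. -/
lemma eq_zero_of_not_injective {A : Type*} [AddCommGroup A] {t : ℕ} (h : (Fin (t + 2) → V) → A)
    (H : ∀ (π : Equiv.Perm (Fin (t + 2))) a, h (a ∘ π) = (Equiv.Perm.sign π : ℤ) • h a)
    (H0 : ∀ a, a 0 = a 1 → h a = 0) {a : Fin (t + 2) → V} (ha : ¬ Function.Injective a) :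
    h a = 0 := by
  simp only [Function.Injective, not_forall] at ha
  obtain ⟨i, j, hij, hne⟩ := ha
  have h1 : Equiv.swap 0 i j ≠ 0 := by
    intro h1
    have h2 := congrArg (Equiv.swap 0 i) h1
    rw [Equiv.swap_apply_self, Equiv.swap_apply_left] at h2
    exact hne h2.symm
  refine eq_zero_of_comp_perm (H (Equiv.swap 0 i * Equiv.swap 1 (Equiv.swap 0 i j)) a) (H0 _ ?_)
  simp only [Function.comp_apply, Equiv.Perm.mul_apply]
  rw [Equiv.swap_apply_of_ne_of_ne (by simp) h1.symm, Equiv.swap_apply_left,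
    Equiv.swap_apply_left, Equiv.swap_apply_self, hij]

end Products

/-! ### Products of quadratic and linear families of matrices -/

section Polar

open QuadraticMap

variable {L V : Type*} [Field L] [AddCommGroup V] [Module L V] {n p q : ℕ}

lemma anticomm_of_mul_self {M : V →ₗ[L] Matrix (Fin n) (Fin p) L}
    {N : V →ₗ[L] Matrix (Fin p) (Fin q) L} (h : ∀ x, M x * N x = 0) (x y : V) :
    M x * N y = -(M y * N x) := by
  have := h (x + y)
  rw [map_add, map_add, Matrix.add_mul, Matrix.mul_add, Matrix.mul_add, h, h, zero_add,
    add_zero] at this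
  exact eq_neg_of_add_eq_zero_left this

variable [Infinite L]

variable (L) in
lemma exists_ne_zero_ne_one : ∃ t : L, t ≠ 0 ∧ t ≠ 1 := by
  classical
  obtain ⟨t, ht⟩ := Infinite.exists_notMem_finset ({0, 1} : Finset L)
  simp only [Finset.mem_insert, Finset.mem_singleton, not_or] at ht
  exact ⟨t, ht⟩

/-- If `Q` vanishes at `u` and `v`, then `Q (u + t • v) * M (u + t • v)` is a multiple of
`polar Q u v * M u + t • (polar Q u v * M v)` by `t`, so that both terms vanish once there is a
scalar other than `0` and `1`. -/
lemma polar_mul_left {Q : QuadraticMap L V (Matrix (Fin n) (Fin p) L)}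
    {M : V →ₗ[L] Matrix (Fin p) (Fin q) L} (h : ∀ x, Q x * M x = 0) {u v : V} (hu : Q u = 0)
    (hv : Q v = 0) : polar Q u v * M u = 0 := by
  have key : ∀ t : L, t ≠ 0 → polar Q u v * M u + t • (polar Q u v * M v) = 0 := by
    intro t ht
    have := h (u + t • v)
    rw [QuadraticMap.map_add Q, QuadraticMap.map_smul, hu, hv, smul_zero, zero_add, zero_add,
      polar_smul_right, map_add, map_smul, Matrix.smul_mul, Matrix.mul_add, Matrix.mul_smul] at this
    exact (smul_eq_zero.1 this).resolve_left ht
  obtain ⟨t, h0, h1⟩ := exists_ne_zero_ne_one L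
  have h2 := key 1 one_ne_zero
  have h3 := key t h0
  have h4 : (1 - t) • (polar Q u v * M v) = 0 := by
    rw [sub_smul, ← sub_eq_zero.2 (h2.trans h3.symm)]; abel
  rw [(smul_eq_zero.1 h4).resolve_left (sub_ne_zero.2 h1.symm), smul_zero, add_zero] at h2
  exact h2

/-- The part of `Q x * M x = 0` that is multilinear in three zeros of `Q`. -/
lemma polar_mul_cyclic {Q : QuadraticMap L V (Matrix (Fin n) (Fin p) L)}
    {M : V →ₗ[L] Matrix (Fin p) (Fin q) L} (h : ∀ x, Q x * M x = 0) {u v w : V} (hu : Q u = 0)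
    (hv : Q v = 0) (hw : Q w = 0) :
    polar Q u v * M w + polar Q u w * M v = -(polar Q v w * M u) := by
  have := h (u + v + w)
  have e1 := polar_mul_left h hu hv
  have e2 := polar_mul_left h hu hw
  have e3 := polar_mul_left h hv hw
  have e1' := polar_mul_left h hv hu
  have e2' := polar_mul_left h hw hu
  have e3' := polar_mul_left h hw hv
  rw [polar_comm] at e1' e2' e3'
  rw [QuadraticMap.map_add Q, QuadraticMap.map_add Q, hu, hv, hw, polar_add_left, map_add, map_add]
    at this
  simp only [zero_add, Matrix.add_mul, Matrix.mul_add, e1, e2, e3, e1', e2', e3', add_zero] at this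
  rw [← sub_eq_zero, sub_neg_eq_add, ← this]
  abel

/-- The mirror image of `polar_mul_left`. -/
lemma mul_polar_right {M : V →ₗ[L] Matrix (Fin n) (Fin p) L}
    {Q : QuadraticMap L V (Matrix (Fin p) (Fin q) L)} (h : ∀ x, M x * Q x = 0) {u v : V}
    (hu : Q u = 0) (hv : Q v = 0) : M u * polar Q u v = 0 := by
  have key : ∀ t : L, t ≠ 0 → M u * polar Q u v + t • (M v * polar Q u v) = 0 := by
    intro t ht
    have := h (u + t • v)
    rw [QuadraticMap.map_add Q, QuadraticMap.map_smul, hu, hv, smul_zero, zero_add, zero_add,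
      polar_smul_right, map_add, map_smul, Matrix.mul_smul, Matrix.add_mul, Matrix.smul_mul] at this
    exact (smul_eq_zero.1 this).resolve_left ht
  obtain ⟨t, h0, h1⟩ := exists_ne_zero_ne_one L
  have h2 := key 1 one_ne_zero
  have h3 := key t h0
  have h4 : (1 - t) • (M v * polar Q u v) = 0 := by
    rw [sub_smul, ← sub_eq_zero.2 (h2.trans h3.symm)]; abel
  rw [(smul_eq_zero.1 h4).resolve_left (sub_ne_zero.2 h1.symm), smul_zero, add_zero] at h2
  exact h2

/-- The mirror image of `polar_mul_cyclic`. -/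
lemma mul_polar_cyclic {M : V →ₗ[L] Matrix (Fin n) (Fin p) L}
    {Q : QuadraticMap L V (Matrix (Fin p) (Fin q) L)} (h : ∀ x, M x * Q x = 0) {u v w : V}
    (hu : Q u = 0) (hv : Q v = 0) (hw : Q w = 0) :
    M u * polar Q v w + M v * polar Q u w = -(M w * polar Q u v) := by
  have := h (u + v + w)
  have e1 := mul_polar_right h hu hv
  have e2 := mul_polar_right h hu hw
  have e3 := mul_polar_right h hv hw
  have e1' := mul_polar_right h hv hu
  have e2' := mul_polar_right h hw hu
  have e3' := mul_polar_right h hw hv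
  rw [polar_comm] at e1' e2' e3'
  rw [QuadraticMap.map_add Q, QuadraticMap.map_add Q, hu, hv, hw, polar_add_left, map_add, map_add]
    at this
  simp only [zero_add, Matrix.add_mul, Matrix.mul_add, e1, e2, e3, e1', e2', e3', add_zero] at this
  rw [← sub_eq_zero, sub_neg_eq_add, ← this]
  abel

omit [Infinite L] in
lemma polar_mul_polar_self {Q : QuadraticMap L V (Matrix (Fin n) (Fin p) L)}
    {Q' : QuadraticMap L V (Matrix (Fin p) (Fin q) L)} (h : ∀ x, Q x * Q' x = 0) {u v : V}
    (hu : Q u = 0) (hv : Q v = 0) (hu' : Q' u = 0) (hv' : Q' v = 0) :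
    polar Q u v * polar Q' u v = 0 := by
  have := h (u + v)
  rwa [QuadraticMap.map_add Q, QuadraticMap.map_add Q', hu, hv, hu', hv', zero_add, zero_add,
    zero_add, zero_add] at this

/-- The coefficient of `s * t` in the vanishing product at `u + s • v + t • w`, extracted by
choosing several values of `s` and `t`. -/
lemma polar_mul_polar_anticomm {Q : QuadraticMap L V (Matrix (Fin n) (Fin p) L)}
    {Q' : QuadraticMap L V (Matrix (Fin p) (Fin q) L)} (h : ∀ x, Q x * Q' x = 0) {u v w : V}
    (hu : Q u = 0) (hv : Q v = 0) (hw : Q w = 0) (hu' : Q' u = 0) (hv' : Q' v = 0)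
    (hw' : Q' w = 0) :
    polar Q u v * polar Q' u w = -(polar Q u w * polar Q' u v) := by
  set A := polar Q u v * polar Q' u w + polar Q u w * polar Q' u v with hA
  set B := polar Q u v * polar Q' v w + polar Q v w * polar Q' u v with hB
  set C := polar Q u w * polar Q' v w + polar Q v w * polar Q' u w with hC
  have key : ∀ s t : L, s ≠ 0 → t ≠ 0 → A + s • B + t • C = 0 := by
    intro s t hs ht
    have := h (u + s • v + t • w)
    have e1 := polar_mul_polar_self h hu hv hu' hv'
    have e2 := polar_mul_polar_self h hu hw hu' hw'
    have e3 := polar_mul_polar_self h hv hw hv' hw'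
    rw [QuadraticMap.map_add Q, QuadraticMap.map_add Q, QuadraticMap.map_add Q',
      QuadraticMap.map_add Q'] at this
    simp only [QuadraticMap.map_smul, hu, hv, hw, hu', hv', hw', polar_add_left, polar_smul_left,
      polar_smul_right, smul_zero, zero_add, add_zero, Matrix.add_mul, Matrix.mul_add,
      Matrix.smul_mul, Matrix.mul_smul, e1, e2, e3] at this
    have h2 : (s * t) • (A + s • B + t • C) = 0 := by
      rw [← this, hA, hB, hC]
      module
    exact (smul_eq_zero.1 h2).resolve_left (mul_ne_zero hs ht)
  obtain ⟨t, h0, h1⟩ := exists_ne_zero_ne_one L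
  have k1 := key 1 1 one_ne_zero one_ne_zero
  have k2 := key t 1 h0 one_ne_zero
  have k3 := key 1 t one_ne_zero h0
  have hB0 : (1 - t) • B = 0 := by
    rw [← sub_eq_zero.2 (k1.trans k2.symm)]; module
  have hC0 : (1 - t) • C = 0 := by
    rw [← sub_eq_zero.2 (k1.trans k3.symm)]; module
  rw [(smul_eq_zero.1 hB0).resolve_left (sub_ne_zero.2 h1.symm),
    (smul_eq_zero.1 hC0).resolve_left (sub_ne_zero.2 h1.symm), smul_zero, add_zero,
    add_zero] at k1
  exact eq_neg_of_add_eq_zero_left k1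

omit [Infinite L] in
/-- A quadratic map is determined by its values at the vectors of a basis and at the sums of two
of them. -/
lemma quadraticMap_eq_zero {ι : Type*} [Fintype ι] (b : Module.Basis ι L V)
    (Q : QuadraticMap L V L) (h1 : ∀ i, Q (b i) = 0) (h2 : ∀ i j, i ≠ j → Q (b i + b j) = 0)
    (x : V) : Q x = 0 := by
  classical
  rw [← b.sum_repr x, QuadraticMap.map_sum]
  rw [Finset.sum_eq_zero fun i _ => by rw [QuadraticMap.map_smul, h1, smul_zero], zero_add]
  refine Finset.sum_eq_zero fun ij hij => ?_
  induction ij using Sym2.ind with | _ i j => ?_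
  have hne : i ≠ j := by simpa using (Finset.mem_filter.1 hij).2
  have h3 := h2 i j hne
  rw [QuadraticMap.map_add Q, h1, h1, zero_add, zero_add] at h3
  simp [polarSym2, polar_smul_left, polar_smul_right, h3]

end Polar

/-! ### The determinantal formula -/

section Chain

open QuadraticMap

variable {L V ι : Type*} [Field L] [AddCommGroup V] [Module L V]

/-- A chain of matrices depending on a vector, with consecutive products zero: the first and the
last one depend on it quadratically and vanish at the vectors `b i`, and the `m` matrices in
between depend on it linearly. -/
structure IsQuadraticChain {ρ : ℕ → ℕ} (m : ℕ) (b : ι → V)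
    (D : ∀ k, V → Matrix (Fin (ρ k)) (Fin (ρ (k + 1))) L) : Prop where
  mul_eq_zero : ∀ k x, D k x * D (k + 1) x = 0
  first : ∃ Q : QuadraticMap L V (Matrix (Fin (ρ 0)) (Fin (ρ 1)) L), ⇑Q = D 0
  mid : ∀ k < m, ∃ M : V →ₗ[L] Matrix (Fin (ρ (k + 1))) (Fin (ρ (k + 2))) L, ⇑M = D (k + 1)
  last : ∃ Q : QuadraticMap L V (Matrix (Fin (ρ (m + 1))) (Fin (ρ (m + 2))) L), ⇑Q = D (m + 1)
  first_zero : ∀ i, D 0 (b i) = 0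
  last_zero : ∀ i, D (m + 1) (b i) = 0

/-- The product of the linear matrices of a chain, at the vectors `y 0, …, y (m - 1)`. -/
def midProd {ρ : ℕ → ℕ} (D : ∀ k, V → Matrix (Fin (ρ k)) (Fin (ρ (k + 1))) L) (m : ℕ)
    (y : Fin m → V) : Matrix (Fin (ρ 1)) (Fin (ρ (m + 1))) L :=
  pathProd (ρ := fun k => ρ (k + 1)) (fun k => D (k + 1)) m y

namespace IsQuadraticChain

variable {ρ : ℕ → ℕ} {m : ℕ} {b : ι → V} {D : ∀ k, V → Matrix (Fin (ρ k)) (Fin (ρ (k + 1))) L}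

lemma mid_anticomm (h : IsQuadraticChain m b D) {k : ℕ} (hk : k + 1 < m) (x y : V) :
    D (k + 1) x * D (k + 2) y = -(D (k + 1) y * D (k + 2) x) := by
  obtain ⟨M, hM⟩ := h.mid k (by omega)
  obtain ⟨N, hN⟩ := h.mid (k + 1) hk
  have := anticomm_of_mul_self (M := M) (N := N)
    (fun x => by rw [hM, hN]; exact h.mul_eq_zero (k + 1) x) x y
  rwa [hM, hN] at this

lemma midProd_swap (h : IsQuadraticChain m b D) (y : Fin m → V) (r : ℕ) (hr : r + 1 < m) :
    midProd D m (y ∘ Equiv.swap ⟨r, by omega⟩ ⟨r + 1, hr⟩) = -midProd D m y :=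
  pathProd_adjacent_swap (ρ := fun k => ρ (k + 1)) (fun k => D (k + 1)) m
    (fun _ hk => h.mid_anticomm hk) y r hr

lemma midProd_perm (h : IsQuadraticChain m b D) (π : Equiv.Perm (Fin m)) (y : Fin m → V) :
    midProd D m (y ∘ π) = (Equiv.Perm.sign π : ℤ) • midProd D m y :=
  comp_perm_of_adjacent (midProd D m) (fun y r hr => h.midProd_swap y r hr) π y

/-- The product of the linear matrices is alternating. -/
lemma midProd_eq_zero (h : IsQuadraticChain m b D) {y : Fin m → V} (hy : ¬ Function.Injective y) :
    midProd D m y = 0 := by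
  rcases m with _ | _ | m
  · exact absurd (Function.injective_of_subsingleton y) hy
  · have : Subsingleton (Fin (0 + 1)) := inferInstanceAs (Subsingleton (Fin 1))
    exact absurd (Function.injective_of_subsingleton y) hy
  refine eq_zero_of_not_injective (midProd D (m + 2)) h.midProd_perm (fun y hy => ?_) hy
  rw [midProd, pathProd_succ_left, pathProd_succ_left, ← Matrix.mul_assoc]
  have := h.mul_eq_zero 1 (y 0)
  have h2 : y (Fin.succ 0) = y 0 := hy.symm
  rw [h2]
  exact (congrArg (· * _) this).trans (Matrix.zero_mul _)

variable [Infinite L]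

/-- The matrix at `b l` may be moved next to the quadratic end, where it gives zero by
`polar_mul_left`. -/
lemma first_mul_midProd (h : IsQuadraticChain m b D) (i l : ι) {y : Fin m → V} {r : Fin m}
    (hy : y r = b l) : polar (D 0) (b l) (b i) * midProd D m y = 0 := by
  rcases m with _ | m
  · exact r.elim0
  refine eq_zero_of_comp_perm (h := fun y => polar (D 0) (b l) (b i) * midProd D (m + 1) y)
    (π := Equiv.swap 0 r) ?_ ?_
  · simp only [h.midProd_perm, Matrix.mul_smul]
  · rw [midProd, pathProd_succ_left, ← Matrix.mul_assoc, Function.comp_apply,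
      Equiv.swap_apply_left, hy]
    obtain ⟨Q, hQ⟩ := h.first
    obtain ⟨M, hM⟩ := h.mid 0 (by omega)
    have := polar_mul_left (Q := Q) (M := M)
      (fun x => by rw [hM, hQ]; exact h.mul_eq_zero 0 x) (u := b l) (v := b i)
      (by rw [hQ]; exact h.first_zero l) (by rw [hQ]; exact h.first_zero i)
    rw [hQ, hM] at this
    exact (congrArg (· * _) this).trans (Matrix.zero_mul _)

/-- The mirror image of `first_mul_midProd`. -/
lemma midProd_mul_last (h : IsQuadraticChain m b D) (i l : ι) {y : Fin m → V} {r : Fin m}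
    (hy : y r = b l) : midProd D m y * polar (D (m + 1)) (b l) (b i) = 0 := by
  rcases m with _ | m
  · exact r.elim0
  refine eq_zero_of_comp_perm
    (h := fun y => midProd D (m + 1) y * polar (D (m + 2)) (b l) (b i))
    (π := Equiv.swap (Fin.last m) r) ?_ ?_
  · simp only [h.midProd_perm, Matrix.smul_mul]
  · rw [midProd, pathProd, Matrix.mul_assoc, Function.comp_apply, Equiv.swap_apply_left, hy]
    obtain ⟨Q, hQ⟩ := h.last
    obtain ⟨M, hM⟩ := h.mid m (by omega)
    have := mul_polar_right (Q := Q) (M := M)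
      (fun x => by rw [hM, hQ]; exact h.mul_eq_zero (m + 1) x) (u := b l) (v := b i)
      (by rw [hQ]; exact h.last_zero l) (by rw [hQ]; exact h.last_zero i)
    rw [hQ, hM] at this
    exact (congrArg (_ * ·) this).trans (Matrix.mul_zero _)

/-- The product along a chain, with both quadratic ends polarised against the same point `b l`. -/
def corner (m : ℕ) (b : ι → V) (D : ∀ k, V → Matrix (Fin (ρ k)) (Fin (ρ (k + 1))) L) (l : ι)
    (a : Fin (m + 2) → ι) : Matrix (Fin (ρ 0)) (Fin (ρ (m + 2))) L :=
  polar (D 0) (b l) (b (a 0)) * midProd D m (fun r => b (a r.castSucc.succ)) *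
    polar (D (m + 1)) (b (a (Fin.last (m + 1)))) (b l)

omit [Infinite L] in
lemma corner_eq_zero_of_zero (h : IsQuadraticChain m b D) (l : ι) (a : Fin (m + 2) → ι)
    (ha : a 0 = l) : corner m b D l a = 0 := by
  obtain ⟨Q, hQ⟩ := h.first
  have : polar (D 0) (b l) (b l) = 0 := by
    rw [← hQ, polar_self, hQ, h.first_zero, smul_zero]
  rw [corner, ha, this, Matrix.zero_mul, Matrix.zero_mul]

lemma corner_eq_zero_of_zero_one (h : IsQuadraticChain m b D) (l : ι) (a : Fin (m + 2) → ι)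
    (ha : a 0 = a 1) : corner m b D l a = 0 := by
  rcases m with _ | m
  · obtain ⟨Q, hQ⟩ := h.first
    obtain ⟨Q', hQ'⟩ := h.last
    have := polar_mul_polar_self (Q := Q) (Q' := Q')
      (fun x => by rw [hQ, hQ']; exact h.mul_eq_zero 0 x) (u := b l) (v := b (a 0))
      (by rw [hQ]; exact h.first_zero _) (by rw [hQ]; exact h.first_zero _)
      (by rw [hQ']; exact h.last_zero _) (by rw [hQ']; exact h.last_zero _)
    rw [corner, midProd, pathProd]
    have e : a (Fin.last 1) = a 0 := ha.symm
    rw [e, polar_comm _ (b (a 0)) (b l)]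
    rw [hQ, hQ'] at this
    exact (congrArg (· * _) (Matrix.mul_one _)).trans this
  · have h1 := h.first_mul_midProd l (a 0) (y := fun r => b (a r.castSucc.succ)) (r := 0)
      (congrArg b ha.symm)
    rw [corner, polar_comm _ (b l), h1, Matrix.zero_mul]

/-- Corner products change sign when neighbouring points are exchanged. At an end this is
`polar_mul_cyclic`: the term in which `b l` has moved into the linear part dies at the opposite
end, which is polarised against `b l` as well. -/
lemma corner_swap (h : IsQuadraticChain m b D) (l : ι) (a : Fin (m + 2) → ι) (r : ℕ)
    (hr : r + 1 < m + 2) :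
    corner m b D l (a ∘ Equiv.swap ⟨r, by omega⟩ ⟨r + 1, hr⟩) = -corner m b D l a := by
  obtain ⟨Q, hQ⟩ := h.first
  obtain ⟨Q', hQ'⟩ := h.last
  have hz : ∀ i, Q (b i) = 0 := fun i => by rw [hQ]; exact h.first_zero i
  have hz' : ∀ i, Q' (b i) = 0 := fun i => by rw [hQ']; exact h.last_zero i
  rcases m with _ | m
  -- without linear matrices, the two quadratic ends meet
  · obtain rfl : r = 0 := by omega
    have := polar_mul_polar_anticomm (Q := Q) (Q' := Q')
      (fun x => by rw [hQ, hQ']; exact h.mul_eq_zero 0 x) (hz l) (hz (a 1)) (hz (a 0))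
      (hz' l) (hz' (a 1)) (hz' (a 0))
    rw [hQ, hQ'] at this
    rw [corner, corner, midProd, midProd, pathProd, pathProd, polar_comm (D (0 + 1)),
      polar_comm (D (0 + 1)) _ (b l)]
    have e0 : (a ∘ Equiv.swap ⟨0, by omega⟩ ⟨0 + 1, hr⟩) 0 = a 1 :=
      congrArg a (Equiv.swap_apply_left _ _)
    have e1 : (a ∘ Equiv.swap ⟨0, by omega⟩ ⟨0 + 1, hr⟩) (Fin.last (0 + 1)) = a 0 :=
      congrArg a (Equiv.swap_apply_right _ _)
    rw [e0, e1]
    refine (congrArg (· * _) (Matrix.mul_one _)).trans (this.trans ?_)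
    exact congrArg (-·) (congrArg (· * _) (Matrix.mul_one _).symm)
  · rcases Nat.eq_zero_or_pos r with rfl | hr0
    -- the exchange involves the first end
    · have e0 : (a ∘ Equiv.swap ⟨0, by omega⟩ ⟨0 + 1, hr⟩) 0 = a 1 :=
        congrArg a (Equiv.swap_apply_left _ _)
      have e1 : (a ∘ Equiv.swap ⟨0, by omega⟩ ⟨0 + 1, hr⟩) (Fin.succ (Fin.castSucc 0)) = a 0 :=
        congrArg a (Equiv.swap_apply_right _ _)
      have e2 : ∀ s : Fin (m + 1 + 2), 1 < (s : ℕ) →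
          (a ∘ Equiv.swap ⟨0, by omega⟩ ⟨0 + 1, hr⟩) s = a s := fun s hs =>
        congrArg a (Equiv.swap_apply_of_ne_of_ne (by rw [Ne, Fin.ext_iff]; exact (zero_lt_one.trans hs).ne')
          (by rw [Ne, Fin.ext_iff]; exact hs.ne'))
      have e3 : (fun s : Fin m =>
          b ((a ∘ Equiv.swap ⟨0, by omega⟩ ⟨0 + 1, hr⟩) s.succ.castSucc.succ)) =
          fun s : Fin m => b (a s.succ.castSucc.succ) :=
        funext fun s => congrArg b (e2 _ (by simp))
      obtain ⟨M, hM⟩ := h.mid 0 (by omega)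
      have key := polar_mul_cyclic (Q := Q) (M := M)
        (fun x => by rw [hM, hQ]; exact h.mul_eq_zero 0 x) (hz l) (hz (a 1)) (hz (a 0))
      rw [hQ, hM] at key
      have h0 := h.midProd_mul_last (a (Fin.last (m + 2))) l
        (y := Fin.cons (b l) fun s : Fin m => b (a s.succ.castSucc.succ)) (r := 0) rfl
      rw [midProd, pathProd_succ_left] at h0
      simp only [Fin.cons_zero, Fin.cons_succ] at h0
      rw [corner, corner, midProd, midProd, pathProd_succ_left, pathProd_succ_left, e0, e1, e3,
        e2 (Fin.last (m + 1 + 1)) (by simp), eq_neg_iff_add_eq_zero, polar_comm (D (m + 1 + 1)),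
        ← Matrix.mul_assoc, ← Matrix.mul_assoc, ← Matrix.add_mul, ← Matrix.add_mul]
      refine (congrArg (fun A => A * _ * _) key).trans ?_
      rw [Matrix.neg_mul, Matrix.neg_mul, neg_eq_zero, Matrix.mul_assoc, Matrix.mul_assoc,
        ← Matrix.mul_assoc (D (0 + 1) (b l))]
      exact (congrArg (_ * ·) h0).trans (Matrix.mul_zero _)
    rcases Nat.lt_or_ge r (m + 1) with hr1 | hr1
    -- the exchange takes place among the linear matrices
    · obtain ⟨r, rfl⟩ := Nat.exists_eq_succ_of_ne_zero hr0.ne'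
      have e0 : (a ∘ Equiv.swap ⟨r + 1, by omega⟩ ⟨r + 1 + 1, hr⟩) 0 = a 0 :=
        congrArg a (Equiv.swap_apply_of_ne_of_ne (by simp [Fin.ext_iff]) (by simp [Fin.ext_iff]))
      have e1 : (a ∘ Equiv.swap ⟨r + 1, by omega⟩ ⟨r + 1 + 1, hr⟩) (Fin.last (m + 2)) =
          a (Fin.last (m + 2)) :=
        congrArg a (Equiv.swap_apply_of_ne_of_ne (by simp [Fin.ext_iff]; omega)
          (by simp [Fin.ext_iff]; omega))
      have e2 : (fun s : Fin (m + 1) =>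
          b ((a ∘ Equiv.swap ⟨r + 1, by omega⟩ ⟨r + 1 + 1, hr⟩) s.castSucc.succ)) =
          (fun s : Fin (m + 1) => b (a s.castSucc.succ)) ∘
            Equiv.swap ⟨r, by omega⟩ ⟨r + 1, by omega⟩ := by
        ext1 s
        simp only [Function.comp_apply]
        congr 2
        simp only [Equiv.swap_apply_def]
        split_ifs <;> simp_all [Fin.ext_iff]
      rw [corner, corner]
      simp only [Nat.succ_eq_add_one]
      rw [e0, e1, e2, h.midProd_swap, Matrix.mul_neg, Matrix.neg_mul]
    -- the exchange involves the last end
    · obtain rfl : r = m + 1 := by omega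
      have e0 : (a ∘ Equiv.swap ⟨m + 1, by omega⟩ ⟨m + 1 + 1, hr⟩) 0 = a 0 :=
        congrArg a (Equiv.swap_apply_of_ne_of_ne (by simp [Fin.ext_iff]) (by simp [Fin.ext_iff]))
      have e1 : (a ∘ Equiv.swap ⟨m + 1, by omega⟩ ⟨m + 1 + 1, hr⟩) (Fin.last (m + 1 + 1)) =
          a (Fin.last m).castSucc.succ := congrArg a (Equiv.swap_apply_right _ _)
      have e2 : (a ∘ Equiv.swap ⟨m + 1, by omega⟩ ⟨m + 1 + 1, hr⟩) (Fin.last m).castSucc.succ =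
          a (Fin.last (m + 1 + 1)) := congrArg a (Equiv.swap_apply_left _ _)
      have e3 : ∀ s : Fin m, (a ∘ Equiv.swap ⟨m + 1, by omega⟩ ⟨m + 1 + 1, hr⟩)
          s.castSucc.castSucc.succ = a s.castSucc.castSucc.succ := fun s =>
        congrArg a (Equiv.swap_apply_of_ne_of_ne (by simp [Fin.ext_iff]; omega)
          (by simp [Fin.ext_iff]; omega))
      obtain ⟨M, hM⟩ := h.mid m (by omega)
      have key := mul_polar_cyclic (Q := Q') (M := M)
        (fun x => by rw [hM, hQ']; exact h.mul_eq_zero (m + 1) x)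
        (hz' (a (Fin.last (m + 1 + 1)))) (hz' (a (Fin.last m).castSucc.succ)) (hz' l)
      rw [hQ', hM] at key
      have h0 := h.first_mul_midProd (a 0) l
        (y := Fin.snoc (fun s : Fin m => b (a s.castSucc.castSucc.succ)) (b l))
        (r := Fin.last m) (Fin.snoc_last _ _)
      rw [midProd, pathProd] at h0
      simp only [Fin.snoc_last, Fin.snoc_castSucc] at h0
      rw [corner, corner, midProd, midProd, pathProd, pathProd]
      simp only [e0, e1, e2, e3]
      rw [eq_neg_iff_add_eq_zero, ← Matrix.mul_assoc, ← Matrix.mul_assoc, Matrix.mul_assoc,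
        Matrix.mul_assoc _ (D (m + 1) (b (a (Fin.last m).castSucc.succ))), ← Matrix.mul_add]
      refine (congrArg (_ * ·) key).trans ?_
      rw [Matrix.mul_neg, neg_eq_zero, ← Matrix.mul_assoc]
      rw [← Matrix.mul_assoc] at h0
      exact (congrArg (· * _) h0).trans (Matrix.zero_mul _)

lemma corner_perm (h : IsQuadraticChain m b D) (l : ι) (π : Equiv.Perm (Fin (m + 2)))
    (a : Fin (m + 2) → ι) :
    corner m b D l (a ∘ π) = (Equiv.Perm.sign π : ℤ) • corner m b D l a :=
  comp_perm_of_adjacent (corner m b D l) (fun a r hr => h.corner_swap l a r hr) π a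

end IsQuadraticChain

end Chain

section Formula

open QuadraticMap

variable {L V : Type*} [Field L] [AddCommGroup V] [Module L V] {m : ℕ} {ρ : ℕ → ℕ}

/-- The sum of the entries of a matrix, as a linear map. -/
def entryLin (L : Type*) [Field L] (p q : ℕ) : Matrix (Fin p) (Fin q) L →ₗ[L] L where
  toFun := entry
  map_add' A B := by simp [entry, Finset.sum_add_distrib]
  map_smul' c A := by simp [entry, Finset.mul_sum]

lemma entryLin_apply {p q : ℕ} (A : Matrix (Fin p) (Fin q) L) : entryLin L p q A = entry A := rfl

/-- The tuple `u, x, y 0, …, y (m - 1), z`. -/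
def tuple (u x : V) (y : Fin m → V) (z : V) : Fin (m + 3) → V :=
  Fin.cons u (Fin.cons x (Fin.snoc y z))

/-- The value of an alternating form at `u, x, y 0, …, y (m - 1), z`, as a linear function of
`u`, `x` and `z` and a multilinear function of `y`. -/
def altForm (ω : V [⋀^Fin (m + 3)]→ₗ[L] L) (u x : V) (y : Fin m → V) (z : V) : L :=
  ω (tuple u x y z)

variable (ω : V [⋀^Fin (m + 3)]→ₗ[L] L)

lemma altForm_eq_curry (u x : V) (y : Fin m → V) (z : V) :
    altForm ω u x y z = AlternatingMap.curryLeft (AlternatingMap.curryLeft ω u) x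
      (Fin.snoc y z) := rfl

lemma altForm_add_fst (u u' x : V) (y : Fin m → V) (z : V) :
    altForm ω (u + u') x y z = altForm ω u x y z + altForm ω u' x y z :=
  ω.toMultilinearMap.cons_add _ _ _

lemma altForm_smul_fst (c : L) (u x : V) (y : Fin m → V) (z : V) :
    altForm ω (c • u) x y z = c * altForm ω u x y z :=
  ω.toMultilinearMap.cons_smul _ _ _

lemma altForm_add_snd (u x x' : V) (y : Fin m → V) (z : V) :
    altForm ω u (x + x') y z = altForm ω u x y z + altForm ω u x' y z :=
  (AlternatingMap.curryLeft ω u).toMultilinearMap.cons_add _ _ _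

lemma altForm_smul_snd (c : L) (u x : V) (y : Fin m → V) (z : V) :
    altForm ω u (c • x) y z = c * altForm ω u x y z :=
  (AlternatingMap.curryLeft ω u).toMultilinearMap.cons_smul _ _ _

lemma altForm_add_last (u x : V) (y : Fin m → V) (z z' : V) :
    altForm ω u x y (z + z') = altForm ω u x y z + altForm ω u x y z' := by
  simp only [altForm_eq_curry]
  exact MultilinearMap.snoc_add (AlternatingMap.curryLeft
    (AlternatingMap.curryLeft ω u) x).toMultilinearMap y z z'

lemma altForm_smul_last (c : L) (u x : V) (y : Fin m → V) (z : V) :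
    altForm ω u x y (c • z) = c * altForm ω u x y z := by
  simp only [altForm_eq_curry]
  exact MultilinearMap.snoc_smul (AlternatingMap.curryLeft
    (AlternatingMap.curryLeft ω u) x).toMultilinearMap y c z

lemma altForm_update_add (u x : V) (y : Fin m → V) (i : Fin m) (v w z : V) :
    altForm ω u x (Function.update y i (v + w)) z =
      altForm ω u x (Function.update y i v) z + altForm ω u x (Function.update y i w) z := by
  simp only [altForm_eq_curry, Fin.snoc_update]
  exact AlternatingMap.map_update_add _ _ _ _ _

lemma altForm_update_smul (u x : V) (y : Fin m → V) (i : Fin m) (c : L) (v z : V) :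
    altForm ω u x (Function.update y i (c • v)) z =
      c * altForm ω u x (Function.update y i v) z := by
  simp only [altForm_eq_curry, Fin.snoc_update]
  exact AlternatingMap.map_update_smul _ _ _ _ _

lemma altForm_fst_eq_snd (u : V) (y : Fin m → V) (z : V) : altForm ω u u y z = 0 :=
  ω.map_eq_zero_of_eq _ (i := 0) (j := 1) rfl (by simp)

lemma altForm_fst_eq_last (u x : V) (y : Fin m → V) : altForm ω u x y u = 0 := by
  refine ω.map_eq_zero_of_eq _ (i := 0) (j := Fin.last (m + 2)) ?_ (by simp [Fin.ext_iff])
  rw [tuple, Fin.cons_zero, ← Fin.succ_last, Fin.cons_succ, ← Fin.succ_last, Fin.cons_succ,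
    Fin.snoc_last]

lemma altForm_snd_eq_last (u x : V) (y : Fin m → V) : altForm ω u x y x = 0 := by
  rw [altForm_eq_curry]
  refine AlternatingMap.map_eq_zero_of_eq (AlternatingMap.curryLeft ω u) _
    (i := 0) (j := Fin.last (m + 1)) ?_ (by simp [Fin.ext_iff])
  change x = (Fin.cons x (Fin.snoc y x) : Fin (m + 2) → V) (Fin.last (m + 1))
  rw [← Fin.succ_last, Fin.cons_succ, Fin.snoc_last]

lemma pathProd_update_add {W : Type*} [AddCommGroup W] [Module L W]
    (D : ∀ k, W → Matrix (Fin (ρ k)) (Fin (ρ (k + 1))) L) (t : ℕ)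
    (hD : ∀ k < t, ∀ v w, D k (v + w) = D k v + D k w) (y : Fin t → W) (i : Fin t) (v w : W) :
    pathProd D t (Function.update y i (v + w)) =
      pathProd D t (Function.update y i v) + pathProd D t (Function.update y i w) := by
  induction t with
  | zero => exact i.elim0
  | succ t ih =>
    simp only [pathProd]
    induction i using Fin.lastCases with
    | last =>
      have h : ∀ v, (fun r : Fin t => Function.update y (Fin.last t) v r.castSucc) =
          fun r => y r.castSucc := fun v => by
        ext1 r; rw [Function.update_of_ne (Fin.castSucc_lt_last r).ne]
      simp only [h, Function.update_self, hD t (by omega), Matrix.mul_add]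
    | cast i =>
      have h : ∀ v, (fun r : Fin t => Function.update y i.castSucc v r.castSucc) =
          Function.update (fun r => y r.castSucc) i v := fun v => by
        ext1 r
        simp [Function.update_apply]
      simp only [h, Function.update_of_ne (Fin.castSucc_lt_last i).ne',
        ih (fun k hk => hD k (by omega)), Matrix.add_mul]

lemma pathProd_update_smul {W : Type*} [AddCommGroup W] [Module L W]
    (D : ∀ k, W → Matrix (Fin (ρ k)) (Fin (ρ (k + 1))) L) (t : ℕ)
    (hD : ∀ k < t, ∀ (c : L) v, D k (c • v) = c • D k v) (y : Fin t → W) (i : Fin t) (c : L)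
    (v : W) :
    pathProd D t (Function.update y i (c • v)) = c • pathProd D t (Function.update y i v) := by
  induction t with
  | zero => exact i.elim0
  | succ t ih =>
    simp only [pathProd]
    induction i using Fin.lastCases with
    | last =>
      have h : ∀ v, (fun r : Fin t => Function.update y (Fin.last t) v r.castSucc) =
          fun r => y r.castSucc := fun v => by
        ext1 r; rw [Function.update_of_ne (Fin.castSucc_lt_last r).ne]
      simp only [h, Function.update_self, hD t (by omega), Matrix.mul_smul]
    | cast i =>
      have h : ∀ v, (fun r : Fin t => Function.update y i.castSucc v r.castSucc) =
          Function.update (fun r => y r.castSucc) i v := fun v => by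
        ext1 r
        simp [Function.update_apply]
      simp only [h, Function.update_of_ne (Fin.castSucc_lt_last i).ne',
        ih (fun k hk => hD k (by omega)), Matrix.smul_mul]

namespace IsQuadraticChain

variable {ω} [Infinite L] {b : Module.Basis (Fin (m + 3)) L V}
  {D : ∀ k, V → Matrix (Fin (ρ k)) (Fin (ρ (k + 1))) L}

/-- The corner product at `l` is alternating in the other points, hence it is a multiple of the
determinant. -/
lemma exists_corner_eq (h : IsQuadraticChain m b D) (hω : ω b ≠ 0) (l : Fin (m + 3)) :
    ∃ γ : L, ∀ a : Fin (m + 2) → Fin (m + 3), entry (corner m b D l a) =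
      γ * ω (Fin.cons (b l) fun r => b (a r)) := by
  have hperm : ∀ (π : Equiv.Perm (Fin (m + 2))) (a : Fin (m + 2) → Fin (m + 3)),
      ω (Fin.cons (b l) fun r => b ((a ∘ π) r)) =
        (Equiv.Perm.sign π : ℤ) • ω (Fin.cons (b l) fun r => b (a r)) := fun π a =>
    (AlternatingMap.curryLeft ω (b l)).map_perm (fun r => b (a r)) π
  have h0 : ω (Fin.cons (b l) fun r => b (l.succAbove r)) ≠ 0 := by
    have hinj : Function.Injective (Fin.cons l l.succAbove : Fin (m + 3) → Fin (m + 3)) := by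
      rw [Fin.cons_injective_iff]
      exact ⟨fun ⟨r, hr⟩ => Fin.succAbove_ne l r hr, Fin.succAbove_right_injective⟩
    have e : (Fin.cons (b l) fun r => b (l.succAbove r) : Fin (m + 3) → V) =
        b ∘ Equiv.ofBijective _ (Finite.injective_iff_bijective.1 hinj) := by
      ext1 s
      induction s using Fin.cases <;> simp
    rw [e, ω.map_perm]
    rcases Int.units_eq_one_or (Equiv.Perm.sign (Equiv.ofBijective _
      (Finite.injective_iff_bijective.1 hinj))) with h3 | h3 <;> simpa [h3] using hω
  -- the ratio is read off from one enumeration of the points other than `b l`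
  refine ⟨entry (corner m b D l l.succAbove) / ω (Fin.cons (b l) fun r => b (l.succAbove r)),
    fun a => ?_⟩
  by_cases ha : Function.Injective a
  · by_cases hl : ∃ r, a r = l
    · obtain ⟨r, hr⟩ := hl
      have h1 : corner m b D l a = 0 :=
        eq_zero_of_comp_perm (h := corner m b D l) (h.corner_perm l (Equiv.swap 0 r) a)
          (h.corner_eq_zero_of_zero l _ (by simpa using hr))
      have h2 : ω (Fin.cons (b l) fun r => b (a r)) = 0 :=
        ω.map_eq_zero_of_eq _ (i := 0) (j := r.succ) (by simp [hr]) (Fin.succ_ne_zero r).symm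
      rw [h1, h2, mul_zero]
      exact (entryLin L _ _).map_zero
    · push Not at hl
      choose π hπ using fun r => Fin.exists_succAbove_eq (hl r)
      have hπi : Function.Injective π := fun r s hrs => ha (by rw [← hπ, ← hπ, hrs])
      have e : a = l.succAbove ∘ Equiv.ofBijective π (Finite.injective_iff_bijective.1 hπi) :=
        funext fun r => (hπ r).symm
      rw [e, hperm, h.corner_perm, ← entryLin_apply, map_zsmul, entryLin_apply, mul_smul_comm,
        div_mul_cancel₀ _ h0]
  · have h1 : corner m b D l a = 0 :=
      eq_zero_of_not_injective _ (h.corner_perm l) (h.corner_eq_zero_of_zero_one l) ha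
    have h2 : ω (Fin.cons (b l) fun r => b (a r)) = 0 := by
      refine ω.map_eq_zero_of_not_injective _ fun h3 => ha fun r s hrs => ?_
      have := @h3 r.succ s.succ (by simp [hrs])
      simpa using this
    rw [h1, h2, mul_zero]
    exact (entryLin L _ _).map_zero

/-- There are not enough points for a nonzero product in which the two ends share no point. -/
lemma disjoint_ends (h : IsQuadraticChain m b D) {i j k l : Fin (m + 3)} (hij : i ≠ j)
    (hkl : k ≠ l) (hik : i ≠ k) (hil : i ≠ l) (hjk : j ≠ k) (hjl : j ≠ l)
    (c : Fin m → Fin (m + 3)) :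
    polar (D 0) (b i) (b j) * midProd D m (fun r => b (c r)) *
      polar (D (m + 1)) (b k) (b l) = 0 := by
  by_cases hc : Function.Injective c
  · by_cases h1 : ∃ r, c r = i ∨ c r = j ∨ c r = k ∨ c r = l
    · obtain ⟨r, hr | hr | hr | hr⟩ := h1
      · rw [h.first_mul_midProd j i (r := r) (by rw [hr]), Matrix.zero_mul]
      · rw [polar_comm, h.first_mul_midProd i j (r := r) (by rw [hr]), Matrix.zero_mul]
      · rw [Matrix.mul_assoc, h.midProd_mul_last l k (r := r) (by rw [hr]), Matrix.mul_zero]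
      · rw [Matrix.mul_assoc, polar_comm _ (b k), h.midProd_mul_last k l (r := r) (by rw [hr]),
          Matrix.mul_zero]
    · exfalso
      push Not at h1
      have h2 : ({i, j, k, l} ∪ Finset.univ.image c).card ≤ m + 3 := by
        simpa using Finset.card_le_univ ({i, j, k, l} ∪ Finset.univ.image c)
      rw [Finset.card_union_of_disjoint, Finset.card_image_of_injective _ hc] at h2
      · have h3 : ({i, j, k, l} : Finset (Fin (m + 3))).card = 4 := by
          rw [Finset.card_insert_of_notMem (by simp [*]), Finset.card_insert_of_notMem (by simp [*]),
            Finset.card_pair hkl]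
        rw [h3] at h2
        simp at h2
        omega
      · rw [Finset.disjoint_left]
        intro a ha ha'
        obtain ⟨r, -, rfl⟩ := Finset.mem_image.1 ha'
        have := h1 r
        simp_all
  · rw [h.midProd_eq_zero (fun h3 => hc fun r s hrs => h3 (congrArg b hrs)), Matrix.mul_zero,
      Matrix.zero_mul]

/-- A chain of quadratic and linear families of matrices is governed by the symmetric bilinear
product for which the points `b l` are orthogonal and `b l * b l` is a multiple of `b l`. -/
theorem exists_det_formula (h : IsQuadraticChain m b D) (hω : ω b ≠ 0) :
    ∃ β : V →ₗ[L] V →ₗ[L] V, (∀ x y, β x y = β y x) ∧ ∀ x y z,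
      entry (D 0 x * midProd D m y * D (m + 1) z) = -altForm ω (β x z) x y z := by
  choose γ hγ using h.exists_corner_eq hω
  -- `β (b l) (b l) = -γ l • b l`: with this sign, the coordinates of `β` turn out to be the
  -- structure constants themselves
  let β : V →ₗ[L] V →ₗ[L] V := LinearMap.mk₂ L
    (fun x z => ∑ l, (-γ l * b.repr x l * b.repr z l) • b l)
    (fun x x' z => by simp [mul_add, add_mul, add_smul, Finset.sum_add_distrib])
    (fun c x z => by
      rw [Finset.smul_sum]
      exact Finset.sum_congr rfl fun l _ => by simp [smul_smul]; ring_nf)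
    (fun x z z' => by simp [mul_add, add_smul, Finset.sum_add_distrib])
    (fun c x z => by
      rw [Finset.smul_sum]
      exact Finset.sum_congr rfl fun l _ => by simp [smul_smul]; ring_nf)
  have hβs : ∀ i, β (b i) (b i) = -γ i • b i := fun i => by
    simp only [β, LinearMap.mk₂_apply, b.repr_self]
    rw [Finset.sum_eq_single i] <;> simp +contextual [eq_comm]
  have hβn : ∀ i j, i ≠ j → β (b i) (b j) = 0 := fun i j hij => by
    simp only [β, LinearMap.mk₂_apply, b.repr_self]
    refine Finset.sum_eq_zero fun l _ => ?_
    by_cases hl : i = l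
    · subst hl; simp [hij.symm]
    · simp [Finsupp.single_apply, hl]
  have hβc : ∀ x y, β x y = β y x := fun x y => by
    simp only [β, LinearMap.mk₂_apply]
    exact Finset.sum_congr rfl fun l _ => by ring_nf
  obtain ⟨Q, hQ⟩ := h.first
  obtain ⟨Q', hQ'⟩ := h.last
  have hz : ∀ i, Q (b i) = 0 := fun i => by rw [hQ]; exact h.first_zero i
  have hz' : ∀ i, Q' (b i) = 0 := fun i => by rw [hQ']; exact h.last_zero i
  refine ⟨β, hβc, ?_⟩
  -- the two ends share the point `b i`
  have key1 : ∀ i j k (c : Fin m → Fin (m + 3)), i ≠ j → i ≠ k →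
      entry (Q (b i + b j) * midProd D m (fun r => b (c r)) * Q' (b i + b k)) =
        -altForm ω (β (b i + b j) (b i + b k)) (b i + b j) (fun r => b (c r)) (b i + b k) := by
    intro i j k c hij hik
    have h1 : entry (Q (b i + b j) * midProd D m (fun r => b (c r)) * Q' (b i + b k)) =
        γ i * altForm ω (b i) (b j) (fun r => b (c r)) (b k) := by
      have h2 := hγ i (Fin.cons j (Fin.snoc c k))
      rw [corner, Fin.cons_zero, ← Fin.succ_last, Fin.cons_succ, Fin.snoc_last] at h2
      simp only [Fin.cons_succ, Fin.snoc_castSucc] at h2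
      rw [QuadraticMap.map_add Q, QuadraticMap.map_add Q', hz, hz, hz', hz', zero_add, zero_add,
        zero_add, zero_add, hQ, hQ', polar_comm (D (m + 1))]
      refine h2.trans ?_
      rw [altForm, tuple]
      congr 3
      ext1 r
      induction r using Fin.cases with
      | zero => rfl
      | succ r => induction r using Fin.lastCases <;> simp
    have hb : β (b i + b j) (b i + b k) = -γ i • b i + β (b j) (b k) := by
      rw [map_add, map_add, LinearMap.add_apply, LinearMap.add_apply, hβs, hβn i k hik,
        hβn j i hij.symm]
      abel
    rw [h1, hb]
    by_cases hjk : j = k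
    · subst hjk
      rw [altForm_snd_eq_last, altForm_snd_eq_last, mul_zero, neg_zero]
    · rw [hβn j k hjk, add_zero, altForm_smul_fst, altForm_add_snd, altForm_add_last,
        altForm_add_last, altForm_fst_eq_snd, altForm_fst_eq_snd, altForm_fst_eq_last]
      ring
  -- any two ends: if they share no point, both sides vanish
  have key2 : ∀ i j k l (c : Fin m → Fin (m + 3)), i ≠ j → k ≠ l →
      entry (Q (b i + b j) * midProd D m (fun r => b (c r)) * Q' (b k + b l)) =
        -altForm ω (β (b i + b j) (b k + b l)) (b i + b j) (fun r => b (c r)) (b k + b l) := by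
    intro i j k l c hij hkl
    by_cases hik : i = k
    · subst hik; exact key1 i j l c hij hkl
    by_cases hil : i = l
    · subst hil; rw [add_comm (b k)]; exact key1 i j k c hij hkl.symm
    by_cases hjk : j = k
    · subst hjk; rw [add_comm (b i)]; exact key1 j i l c hij.symm hkl
    by_cases hjl : j = l
    · subst hjl; rw [add_comm (b i), add_comm (b k)]; exact key1 j i k c hij.symm hkl.symm
    rw [QuadraticMap.map_add Q, QuadraticMap.map_add Q', hz, hz, hz', hz', zero_add, zero_add,
      zero_add, zero_add, hQ, hQ', h.disjoint_ends hij hkl hik hil hjk hjl, map_add, map_add,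
      LinearMap.add_apply, LinearMap.add_apply, hβn _ _ hik, hβn _ _ hil, hβn _ _ hjk,
      hβn _ _ hjl, add_zero, add_zero]
    rw [← zero_smul L (0 : V), altForm_smul_fst, zero_mul, neg_zero]
    exact (entryLin L _ _).map_zero
  -- the remaining cases follow by linearity in `y` and quadraticity in `x` and `z`
  have hmid : ∀ k < m, ∃ M : V →ₗ[L] Matrix (Fin (ρ (k + 1))) (Fin (ρ (k + 2))) L, ⇑M = D (k + 1) :=
    h.mid
  have lin : ∀ x z y, (∀ c : Fin m → Fin (m + 3),
      entry (Q x * midProd D m (fun r => b (c r)) * Q' z) =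
        -altForm ω (β x z) x (fun r => b (c r)) z) →
      entry (Q x * midProd D m y * Q' z) = -altForm ω (β x z) x y z := by
    intro x z y H
    let T : MultilinearMap L (fun _ : Fin m => V) L := MultilinearMap.mk' (fun y =>
      entryLin L _ _ (Q x * midProd D m y * Q' z) + altForm ω (β x z) x y z)
      (fun y i v w => by
        rw [midProd, pathProd_update_add (ρ := fun k => ρ (k + 1)), Matrix.mul_add, Matrix.add_mul,
          map_add, altForm_update_add]
        · simp only [midProd]; ring
        · intro k hk v w
          obtain ⟨M, hM⟩ := hmid k hk
          rw [← hM, map_add])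
      (fun y i a v => by
        rw [midProd, pathProd_update_smul (ρ := fun k => ρ (k + 1)), Matrix.mul_smul,
          Matrix.smul_mul, map_smul, altForm_update_smul]
        · simp only [midProd, smul_eq_mul]; ring
        · intro k hk a v
          obtain ⟨M, hM⟩ := hmid k hk
          rw [← hM, map_smul])
    have hT : T = 0 := by
      refine Module.Basis.ext_multilinear (fun _ => b) fun c => ?_
      exact add_eq_zero_iff_eq_neg.2 (H c)
    exact add_eq_zero_iff_eq_neg.1 (congrArg (fun T => T y) hT)
  have quadz : ∀ x y, (∀ k l, k ≠ l → entry (Q x * midProd D m y * Q' (b k + b l)) =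
        -altForm ω (β x (b k + b l)) x y (b k + b l)) →
      (∀ k, altForm ω (β x (b k)) x y (b k) = 0) → ∀ z,
      entry (Q x * midProd D m y * Q' z) = -altForm ω (β x z) x y z := by
    intro x y H H' z
    let B : V →ₗ[L] V →ₗ[L] L := LinearMap.mk₂ L (fun z z' => altForm ω (β x z) x y z')
      (fun z z' w => by simp [altForm_add_fst]) (fun c z w => by simp [altForm_smul_fst])
      (fun z w w' => altForm_add_last ω _ _ _ _ _) (fun c z w => altForm_smul_last ω _ _ _ _ _)
    let A : Matrix (Fin (ρ (m + 1))) (Fin (ρ (m + 2))) L →ₗ[L] L :=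
      { toFun := fun N => entryLin L _ _ (Q x * midProd D m y * N)
        map_add' := fun N N' => by rw [Matrix.mul_add, map_add]
        map_smul' := fun c N => by rw [Matrix.mul_smul, map_smul]; rfl }
    have := quadraticMap_eq_zero b (A.compQuadraticMap Q' + LinearMap.BilinMap.toQuadraticMap B)
      (fun k => by
        have : A (Q' (b k)) + altForm ω (β x (b k)) x y (b k) = 0 := by
          rw [hz', map_zero, H', add_zero]
        exact this)
      (fun k l hkl => add_eq_zero_iff_eq_neg.2 (H k l hkl)) z
    exact add_eq_zero_iff_eq_neg.1 this
  have quadx : ∀ y z, (∀ k l, k ≠ l → entry (Q (b k + b l) * midProd D m y * Q' z) =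
        -altForm ω (β (b k + b l) z) (b k + b l) y z) →
      (∀ k, altForm ω (β (b k) z) (b k) y z = 0) → ∀ x,
      entry (Q x * midProd D m y * Q' z) = -altForm ω (β x z) x y z := by
    intro y z H H' x
    let B : V →ₗ[L] V →ₗ[L] L := LinearMap.mk₂ L (fun x x' => altForm ω (β x z) x' y z)
      (fun z z' w => by simp [altForm_add_fst]) (fun c z w => by simp [altForm_smul_fst])
      (fun z w w' => altForm_add_snd ω _ _ _ _ _) (fun c z w => altForm_smul_snd ω _ _ _ _ _)
    let A : Matrix (Fin (ρ 0)) (Fin (ρ 1)) L →ₗ[L] L :=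
      { toFun := fun N => entryLin L _ _ (N * midProd D m y * Q' z)
        map_add' := fun N N' => by rw [Matrix.add_mul, Matrix.add_mul, map_add]
        map_smul' := fun c N => by rw [Matrix.smul_mul, Matrix.smul_mul, map_smul]; rfl }
    have := quadraticMap_eq_zero b (A.compQuadraticMap Q + LinearMap.BilinMap.toQuadraticMap B)
      (fun k => by
        have : A (Q (b k)) + altForm ω (β (b k) z) (b k) y z = 0 := by
          rw [hz, map_zero, H', add_zero]
        exact this)
      (fun k l hkl => add_eq_zero_iff_eq_neg.2 (H k l hkl)) x
    exact add_eq_zero_iff_eq_neg.1 this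
  have hmulb : ∀ x k, ∃ a : L, β x (b k) = a • b k := fun x k => by
    refine ⟨-γ k * b.repr x k, ?_⟩
    simp only [β, LinearMap.mk₂_apply, b.repr_self]
    rw [Finset.sum_eq_single k] <;> simp +contextual [eq_comm]
  intro x y z
  rw [← hQ, ← hQ']
  refine quadz x y (fun k l hkl => quadx y _ (fun i j hij => lin _ _ y fun c => key2 i j k l c hij hkl)
    (fun i => ?_) x) (fun k => ?_) z
  · obtain ⟨a, ha⟩ := hmulb (b k + b l) i
    rw [hβc, ha, altForm_smul_fst, altForm_fst_eq_snd, mul_zero]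
  · obtain ⟨a, ha⟩ := hmulb x k
    rw [ha, altForm_smul_fst, altForm_fst_eq_last, mul_zero]

end IsQuadraticChain

end Formula

/-! ### Signs of lists of indices -/

section Signs

variable {N : ℕ} [NeZero N]

omit [NeZero N] in
lemma mem_omitted {l : List (Fin N)} {a : Fin N} : a ∈ omitted l ↔ a ∉ l := by
  simp [omitted]

omit [NeZero N] in
lemma nodup_omitted (l : List (Fin N)) : (omitted l).Nodup :=
  (List.nodup_finRange N).filter _

omit [NeZero N] in
lemma append_omitted_perm {l : List (Fin N)} (hl : l.Nodup) :
    (l ++ omitted l).Perm (List.finRange N) := by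
  rw [List.perm_ext_iff_of_nodup _ (List.nodup_finRange N)]
  · intro a
    simp [mem_omitted, em]
  · rw [List.nodup_append]
    refine ⟨hl, nodup_omitted l, fun a ha b hb hab => ?_⟩
    exact mem_omitted.1 hb (hab ▸ ha)

omit [NeZero N] in
lemma length_add_length_omitted {l : List (Fin N)} (hl : l.Nodup) :
    l.length + (omitted l).length = N := by
  rw [← List.length_append, (append_omitted_perm hl).length_eq, List.length_finRange]

lemma toSeq_cons_succ (t : ℕ) (a : Fin N) (l : List (Fin N)) (r : Fin t) :
    toSeq (t + 1) (a :: l) r.succ = toSeq t l r := rfl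

lemma toSeq_eq_getElem {t : ℕ} {l : List (Fin N)} (hl : l.length = t) (r : Fin t) :
    toSeq t l r = l[(r : ℕ)]'(hl ▸ r.2) := by
  rw [toSeq, List.getD_eq_getElem]

lemma toSeq_injective {t : ℕ} {l : List (Fin N)} (hl : l.length = t) (h : l.Nodup) :
    Function.Injective (toSeq t l) := by
  intro r s hrs
  rw [toSeq_eq_getElem hl, toSeq_eq_getElem hl] at hrs
  exact Fin.ext ((h.getElem_inj_iff).1 hrs)

variable (L : Type*) [Field L]

/-- The determinant of the standard basis vectors listed by `l`: the sign of `l` as a permutation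
of the indices, and zero if `l` has a repeated entry. -/
def signDet (l : List (Fin N)) : L :=
  Matrix.detRowAlternating (fun r => Pi.single (toSeq N l r) (1 : L))

variable {L}

lemma signDet_eq_zero {l : List (Fin N)} (hl : l.length = N) (h : ¬ l.Nodup) :
    signDet L l = 0 := by
  refine AlternatingMap.map_eq_zero_of_not_injective _ _ fun hinj => h ?_
  rw [List.nodup_iff_injective_getElem]
  intro r s hrs
  have h1 := @hinj ⟨r, by omega⟩ ⟨s, by omega⟩ (by
    simp only [toSeq_eq_getElem hl]
    exact congrArg (fun i => Pi.single i (1 : L)) hrs)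
  simpa [Fin.ext_iff] using h1

lemma signDet_swap (l₁ l₂ : List (Fin N)) (a b : Fin N) (h : l₁.length + 1 < N) :
    signDet L (l₁ ++ a :: b :: l₂) = -signDet L (l₁ ++ b :: a :: l₂) := by
  rw [signDet, signDet, ← AlternatingMap.map_swap _ _ (i := ⟨l₁.length, by omega⟩)
    (j := ⟨l₁.length + 1, h⟩) (by simp [Fin.ext_iff])]
  congr 1
  ext1 r
  simp only [Function.comp_apply]
  congr 1
  rcases lt_trichotomy (r : ℕ) l₁.length with h1 | h1 | h1
  · rw [Equiv.swap_apply_of_ne_of_ne (by rw [Ne, Fin.ext_iff]; exact h1.ne)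
      (by rw [Ne, Fin.ext_iff]; exact (h1.trans (Nat.lt_succ_self _)).ne)]
    simp [toSeq, List.getElem?_append_left h1]
  · have : r = ⟨l₁.length, by omega⟩ := Fin.ext h1
    rw [this]
    simp [toSeq]
  · rcases Nat.lt_or_ge (l₁.length + 1) r with h2 | h2
    · rw [Equiv.swap_apply_of_ne_of_ne (by rw [Ne, Fin.ext_iff]; exact h1.ne')
        (by rw [Ne, Fin.ext_iff]; exact h2.ne')]
      obtain ⟨s, hs⟩ : ∃ s, (r : ℕ) - l₁.length = s + 1 + 1 := ⟨r - l₁.length - 2, by omega⟩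
      simp [toSeq, List.getElem?_append_right h1.le, hs]
    · have : r = ⟨l₁.length + 1, by omega⟩ := Fin.ext (by simp; omega)
      rw [this]
      simp [toSeq]

lemma signDet_move (l₁ c l₂ : List (Fin N)) (a : Fin N)
    (h : l₁.length + c.length + l₂.length + 1 = N) :
    signDet L (l₁ ++ a :: (c ++ l₂)) = (-1) ^ c.length * signDet L (l₁ ++ (c ++ a :: l₂)) := by
  induction c generalizing l₁ with
  | nil => simp
  | cons x c ih =>
    have h1 := ih (l₁ ++ [x]) (by simp at h ⊢; omega)
    rw [List.append_assoc, List.append_assoc, List.singleton_append, List.singleton_append] at h1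
    rw [List.cons_append, signDet_swap _ _ _ _ (by simp at h; omega), h1]
    simp [pow_succ]

lemma eps_cast (l : List (Fin N)) : (eps l : L) = signDet L (l ++ omitted l) := by
  rw [eps]
  split_ifs with h
  · have h1 := (Matrix.detRowAlternating (n := Fin N) (R := L)).map_perm
      (fun r => Pi.single r (1 : L)) (Equiv.ofBijective _ h)
    have h2 : Matrix.detRowAlternating (fun r : Fin N => Pi.single r (1 : L)) = 1 := by
      have : (fun r : Fin N => Pi.single r (1 : L)) = (1 : Matrix (Fin N) (Fin N) L) := by
        ext r s
        simp [Matrix.one_apply, Pi.single_apply, eq_comm]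
      rw [this]
      exact Matrix.det_one
    rw [h2] at h1
    refine Eq.trans ?_ h1.symm
    rw [Units.smul_def, zsmul_one]
  · rw [Int.cast_zero, signDet, AlternatingMap.map_eq_zero_of_not_injective]
    intro h1
    refine h (Finite.injective_iff_bijective.1 fun r s hrs => h1 ?_)
    simp only [hrs]

lemma eps_singleton (k : Fin N) : (eps [k] : L) = (-1) ^ (k : ℕ) := by
  have h0 : signDet L (List.finRange N) = 1 := by
    have : (fun r => Pi.single (toSeq N (List.finRange N) r) (1 : L)) =
        (1 : Matrix (Fin N) (Fin N) L) := by
      ext r s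
      rw [toSeq_eq_getElem (List.length_finRange)]
      simp [Matrix.one_apply, Pi.single_apply, eq_comm]
    rw [signDet, this]
    exact Matrix.det_one
  have h1 : List.finRange N = (List.finRange N).take k ++ k :: (List.finRange N).drop (k + 1) := by
    conv_lhs => rw [← List.take_append_drop (k : ℕ) (List.finRange N)]
    rw [List.drop_eq_getElem_cons (by simp)]
    simp
  have h2 : omitted [k] = (List.finRange N).take k ++ (List.finRange N).drop (k + 1) := by
    have hnd := List.nodup_finRange N
    rw [omitted]
    conv_lhs => rw [h1]
    rw [h1] at hnd
    have hnd' := List.nodup_append.1 hnd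
    rw [List.filter_append, List.filter_cons_of_neg (by simp)]
    congr 1
    · refine List.filter_eq_self.2 fun a ha => ?_
      simpa using hnd'.2.2 a ha k (by simp)
    · refine List.filter_eq_self.2 fun a ha => ?_
      have := (List.nodup_cons.1 hnd'.2.1).1
      simp only [List.mem_singleton, decide_not, Bool.not_eq_eq_eq_not, Bool.not_true,
        decide_eq_false_iff_not]
      rintro rfl
      exact this ha
  have h3 := signDet_move (L := L) [] ((List.finRange N).take k) ((List.finRange N).drop (k + 1)) k
    (by simp; omega)
  rw [List.nil_append, List.nil_append, ← h1, h0, ← h2] at h3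
  rw [eps_cast]
  simpa using h3

end Signs

/-! ### Coordinates of the determinantal formula -/

section Coordinates

variable {L : Type*} [Field L] {m : ℕ}

/-- The standard basis vectors. -/
abbrev stdVec (L : Type*) [Field L] {m : ℕ} (i : Fin (m + 3)) : Fin (m + 3) → L := Pi.single i 1

lemma altForm_fst_sum (ω : (Fin (m + 3) → L) [⋀^Fin (m + 3)]→ₗ[L] L) (u x : Fin (m + 3) → L)
    (y : Fin m → Fin (m + 3) → L) (z : Fin (m + 3) → L) :
    altForm ω u x y z = ∑ s, u s * altForm ω (stdVec L s) x y z := by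
  let f : (Fin (m + 3) → L) →ₗ[L] L :=
    { toFun := fun u => altForm ω u x y z
      map_add' := fun u v => altForm_add_fst ω u v x y z
      map_smul' := fun c u => altForm_smul_fst ω c u x y z }
  have h := congrArg f (pi_eq_sum_univ' u)
  rw [map_sum] at h
  refine h.trans (Finset.sum_congr rfl fun s _ => ?_)
  rw [map_smul, smul_eq_mul]
  rfl

lemma altForm_stdVec (s a d : Fin (m + 3)) {c : List (Fin (m + 3))} (hc : c.length = m) :
    altForm Matrix.detRowAlternating (stdVec L s) (stdVec L a)
      (fun r => stdVec L (toSeq m c r)) (stdVec L d) = signDet L (s :: a :: (c ++ [d])) := by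
  rw [altForm, signDet]
  congr 1
  ext1 r
  induction r using Fin.cases with
  | zero => rfl
  | succ r =>
    induction r using Fin.cases with
    | zero => rfl
    | succ r =>
      rw [tuple, Fin.cons_succ, Fin.cons_succ, toSeq_cons_succ, toSeq_cons_succ,
        toSeq_eq_getElem (by simp [hc])]
      induction r using Fin.lastCases with
      | last => simp [hc]
      | cast r => simp [toSeq_eq_getElem hc, hc]

/-- If only the index `k` is missing from `a, c, d`, then only the `k`-th coordinate of the first
vector matters. -/
lemma altForm_eq_single (u : Fin (m + 3) → L) {a d : Fin (m + 3)} (k : Fin (m + 3))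
    {c : List (Fin (m + 3))} (hc : c.length = m) (h : ∀ s, s ≠ k → s ∈ a :: (c ++ [d])) :
    altForm Matrix.detRowAlternating u (stdVec L a)
      (fun r => stdVec L (toSeq m c r)) (stdVec L d) = u k * signDet L (k :: a :: (c ++ [d])) := by
  rw [altForm_fst_sum, Finset.sum_eq_single k]
  · rw [altForm_stdVec _ _ _ hc]
  · intro s _ hs
    rw [altForm_stdVec _ _ _ hc, signDet_eq_zero (by simp [hc]), mul_zero]
    intro h1
    exact (List.nodup_cons.1 h1).1 (h s hs)
  · simp

end Coordinates

/-! ### Rotations and traces -/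

section Rotation

/-- The even powers of the rotation move the last and the first slot to adjacent slots; together
they run over the cycle twice. -/
lemma sum_rotate_sq {A : Type*} [AddCommGroup A] (n : ℕ) (g : Fin (n + 1) → A) :
    ∑ k ∈ Finset.Icc 1 (n + 1), (g (((finRotate (n + 1)) ^ (2 * k)) (Fin.last n)) +
      g (((finRotate (n + 1)) ^ (2 * k)) 0)) = 2 • ∑ r, g r := by
  have hadd : ∀ s : ℕ, Fin.ofNat (n + 1) s + 1 = Fin.ofNat (n + 1) (s + 1) := fun s => by
    ext; simp [Fin.val_add]
  have h0 : ∀ s : ℕ, ((finRotate (n + 1)) ^ s) 0 = Fin.ofNat (n + 1) s := by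
    intro s
    induction s with
    | zero => rfl
    | succ s ih => rw [pow_succ', Equiv.Perm.mul_apply, ih, finRotate_apply, hadd]
  have h1 : ∀ s : ℕ, ((finRotate (n + 1)) ^ (s + 1)) (Fin.last n) = Fin.ofNat (n + 1) s := by
    intro s
    rw [pow_succ, Equiv.Perm.mul_apply, finRotate_last, h0]
  have h2 : ∀ p : ℕ, ∑ k ∈ Finset.Icc 1 p, (g (((finRotate (n + 1)) ^ (2 * k)) (Fin.last n)) +
      g (((finRotate (n + 1)) ^ (2 * k)) 0)) =
      ∑ s ∈ Finset.range (2 * p), g (Fin.ofNat (n + 1) (s + 1)) := by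
    intro p
    induction p with
    | zero => simp
    | succ p ih =>
      rw [Finset.sum_Icc_succ_top (by omega), ih, mul_add, mul_one, Finset.sum_range_succ,
        Finset.sum_range_succ, h0, h1, add_assoc]
  have h3 : ∑ s ∈ Finset.range (n + 1), g (Fin.ofNat (n + 1) (s + 1)) = ∑ r, g r := by
    rw [Finset.sum_range, ← Equiv.sum_comp (finRotate (n + 1)) g]
    refine Finset.sum_congr rfl fun r _ => ?_
    rw [finRotate_apply, ← hadd]
    congr 2
    ext; simp
  rw [h2, two_mul, Finset.sum_range_add, two_smul, h3]
  congr 1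
  rw [← h3]
  refine Finset.sum_congr rfl fun s _ => ?_
  congr 1
  exact Fin.ext ((congrArg (· % (n + 1)) (add_assoc (n + 1) s 1)).trans (Nat.add_mod_left _ _))

lemma sign_rotate_sq (n k : ℕ) : Equiv.Perm.sign ((finRotate n) ^ (2 * k)) = 1 := by
  rw [pow_mul, map_pow, map_pow, Int.units_sq, one_pow]

variable {L : Type*} [Field L] {m : ℕ}

/-- The value of the determinant at `B (w r)`, `w`, after `w r` is replaced by `v`. -/
def exchange (B : (Fin (m + 3) → L) →ₗ[L] (Fin (m + 3) → L)) (v : Fin (m + 3) → L)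
    (w : Fin (m + 2) → Fin (m + 3) → L) (r : Fin (m + 2)) : L :=
  Matrix.detRowAlternating (Fin.cons (B (w r)) (Function.update w r v) :
    Fin (m + 3) → Fin (m + 3) → L)

lemma det_cons_perm (u : Fin (m + 3) → L) (w : Fin (m + 2) → Fin (m + 3) → L)
    {π : Equiv.Perm (Fin (m + 2))} (hπ : Equiv.Perm.sign π = 1) :
    Matrix.detRowAlternating (Fin.cons u (w ∘ π) : Fin (m + 3) → Fin (m + 3) → L) =
      Matrix.detRowAlternating (Fin.cons u w : Fin (m + 3) → Fin (m + 3) → L) := by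
  have := (AlternatingMap.curryLeft Matrix.detRowAlternating u).map_perm w π
  rwa [hπ, one_smul] at this

lemma exchange_perm (B : (Fin (m + 3) → L) →ₗ[L] (Fin (m + 3) → L)) (v : Fin (m + 3) → L)
    (w : Fin (m + 2) → Fin (m + 3) → L) {π : Equiv.Perm (Fin (m + 2))}
    (hπ : Equiv.Perm.sign π = 1) (r : Fin (m + 2)) :
    exchange B v (w ∘ π) r = exchange B v w (π r) := by
  rw [exchange, exchange, ← det_cons_perm (B (w (π r))) (Function.update w (π r) v) hπ]
  congr 2
  ext1 s
  simp [Function.update_apply]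

/-- If the vectors `w` are the standard basis vectors other than the `k`-th, only the `k`-th
coordinate of `u` matters. -/
lemma det_cons_eq (u : Fin (m + 3) → L) {k : Fin (m + 3)} {w : Fin (m + 2) → Fin (m + 3)}
    (hs : ∀ s, s ≠ k → ∃ r, w r = s) :
    Matrix.detRowAlternating (Fin.cons u (fun r => stdVec L (w r)) :
      Fin (m + 3) → Fin (m + 3) → L) = u k *
    Matrix.detRowAlternating (Fin.cons (stdVec L k) (fun r => stdVec L (w r)) :
      Fin (m + 3) → Fin (m + 3) → L) := by
  let f : (Fin (m + 3) → L) →ₗ[L] L :=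
    { toFun := fun u => (Matrix.detRowAlternating (R := L) (n := Fin (m + 3))).curryLeft u
        (fun r => stdVec L (w r))
      map_add' := fun u v => by rw [map_add, AlternatingMap.add_apply]
      map_smul' := fun c u => by rw [map_smul, AlternatingMap.smul_apply, RingHom.id_apply] }
  have hf : ∀ u, Matrix.detRowAlternating (Fin.cons u (fun r => stdVec L (w r)) :
      Fin (m + 3) → Fin (m + 3) → L) = f u := fun u => rfl
  have h := congrArg f (pi_eq_sum_univ' u)
  rw [map_sum] at h
  rw [hf, hf, h, Finset.sum_eq_single k]
  · rw [map_smul, smul_eq_mul]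
  · intro s _ hsk
    obtain ⟨r, hr⟩ := hs s hsk
    rw [map_smul, ← hf, AlternatingMap.map_eq_zero_of_eq _ _ (i := 0) (j := r.succ) (by simp [hr])
      (Fin.succ_ne_zero r).symm, smul_zero]
  · simp

/-- The exchange at `r` is nonzero only if `e_j` replaces itself, or if `j = k` is the missing
index; in the latter case `w r` becomes the missing index. -/
lemma exchange_eq (B : (Fin (m + 3) → L) →ₗ[L] (Fin (m + 3) → L)) (j : Fin (m + 3))
    {k : Fin (m + 3)} {w : Fin (m + 2) → Fin (m + 3)}
    (hk : ∀ r, w r ≠ k) (hs : ∀ s, s ≠ k → ∃ r, w r = s) (r : Fin (m + 2)) :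
    exchange B (stdVec L j) (fun r => stdVec L (w r)) r =
      ((if w r = j then B (stdVec L j) k else 0) -
        (if j = k then B (stdVec L (w r)) (w r) else 0)) *
      Matrix.detRowAlternating (Fin.cons (stdVec L k) (fun r => stdVec L (w r)) :
        Fin (m + 3) → Fin (m + 3) → L) := by
  have hup : Function.update (fun r => stdVec L (w r)) r (stdVec L j) =
      fun s => stdVec L (Function.update w r j s) := by
    ext1 s
    by_cases h : s = r
    · subst h; simp
    · simp [h]
  rw [exchange, hup]
  by_cases hrj : w r = j
  · subst hrj
    rw [Function.update_eq_self, det_cons_eq _ hs, if_pos rfl, if_neg (hk r), sub_zero]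
  rw [if_neg hrj, zero_sub]
  by_cases hjk : j = k
  · subst hjk
    rw [if_pos rfl, det_cons_eq _ (k := w r) (w := Function.update w r j), neg_mul, ← mul_neg]
    · congr 1
      rw [← AlternatingMap.map_swap _ _ (i := 0) (j := r.succ) (Fin.succ_ne_zero r).symm]
      congr 1
      ext1 s
      induction s using Fin.cases with
      | zero => simp
      | succ s =>
        by_cases h : s = r
        · subst h; simp
        · rw [Function.comp_apply, Equiv.swap_apply_of_ne_of_ne (Fin.succ_ne_zero s)
            (fun h' => h (Fin.succ_injective _ h'))]
          simp [h]
    · intro s hsr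
      by_cases hsj : s = j
      · exact ⟨r, by simp [hsj]⟩
      · obtain ⟨q, hq⟩ := hs s hsj
        refine ⟨q, ?_⟩
        rw [Function.update_of_ne, hq]
        rintro rfl
        exact hsr hq.symm
  · rw [if_neg hjk, neg_zero, zero_mul]
    obtain ⟨q, hq⟩ := hs j hjk
    have hqr : q ≠ r := fun h => hrj (h ▸ hq)
    refine AlternatingMap.map_eq_zero_of_eq _ _ (i := q.succ) (j := r.succ) ?_
      (fun h => hqr (Fin.succ_injective _ h))
    simp [hqr, hq]

/-- Summing the exchanges over all positions produces the trace of `B`. -/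
lemma sum_exchange (B : (Fin (m + 3) → L) →ₗ[L] (Fin (m + 3) → L)) (j : Fin (m + 3))
    {k : Fin (m + 3)} {w : Fin (m + 2) → Fin (m + 3)} (hw : Function.Injective w)
    (hk : ∀ r, w r ≠ k) (hs : ∀ s, s ≠ k → ∃ r, w r = s) :
    ∑ r, exchange B (stdVec L j) (fun r => stdVec L (w r)) r =
      (B (stdVec L j) k - if j = k then ∑ s, B (stdVec L s) s else 0) *
      Matrix.detRowAlternating (Fin.cons (stdVec L k) (fun r => stdVec L (w r)) :
        Fin (m + 3) → Fin (m + 3) → L) := by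
  have hsum : ∀ g : Fin (m + 3) → L, ∑ s, g s = g k + ∑ r, g (w r) := by
    intro g
    rw [← Finset.add_sum_erase _ _ (Finset.mem_univ k)]
    congr 1
    refine (Finset.sum_bij (fun r _ => w r) (fun r _ => by simp [hk r])
      (fun r _ s _ h => hw h) (fun s hsk => ?_) (fun _ _ => rfl)).symm
    obtain ⟨r, hr⟩ := hs s (Finset.ne_of_mem_erase hsk)
    exact ⟨r, Finset.mem_univ r, hr⟩
  rw [Finset.sum_congr rfl fun r _ => exchange_eq B j hk hs r, ← Finset.sum_mul,
    Finset.sum_sub_distrib]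
  congr 1
  have h1 := hsum fun s => if s = j then B (stdVec L j) k else 0
  rw [Finset.sum_ite_eq' , if_pos (Finset.mem_univ j)] at h1
  by_cases hjk : j = k
  · subst hjk
    have h2 := hsum fun s => B (stdVec L s) s
    simp only [if_true] at h1 ⊢
    rw [h2]
    linear_combination -h1
  · simp only [if_neg hjk, if_neg (Ne.symm hjk), zero_add] at h1 ⊢
    rw [← h1, Finset.sum_const_zero]

end Rotation

/-! ### Linear and quadratic forms -/

section Forms

open QuadraticMap

variable {σ K : Type*} [Field K]

lemma isHomogeneous_two_induction {p : MvPolynomial σ K → Prop} (h0 : p 0)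
    (hadd : ∀ f g, p f → p g → p (f + g)) (hX : ∀ c a b, p (C c * (X a * X b)))
    {f : MvPolynomial σ K} (hf : f.IsHomogeneous 2) : p f := by
  classical
  rw [← support_sum_monomial_coeff f]
  refine Finset.sum_induction _ p hadd h0 fun e he => ?_
  have hdeg : e.degree = 2 := by
    by_contra h
    exact (mem_support_iff.1 he) (hf.coeff_eq_zero h)
  have hcard : Multiset.card (Finsupp.toMultiset e) = 2 := by
    rw [Finsupp.card_toMultiset, ← hdeg]; rfl
  obtain ⟨a, b, hab⟩ := Multiset.card_eq_two.1 hcard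
  have he' : e = Finsupp.single a 1 + Finsupp.single b 1 := by
    rw [← Finsupp.toMultiset_toFinsupp e, hab, Multiset.insert_eq_cons, ← Multiset.singleton_add,
      map_add, Multiset.toFinsupp_singleton, Multiset.toFinsupp_singleton]
  have h1 := hX (coeff e f) a b
  rw [X, X, monomial_mul, C_mul_monomial, ← he'] at h1
  simpa using h1

lemma isHomogeneous_one_induction {p : MvPolynomial σ K → Prop} (h0 : p 0)
    (hadd : ∀ f g, p f → p g → p (f + g)) (hX : ∀ c a, p (C c * X a))
    {f : MvPolynomial σ K} (hf : f.IsHomogeneous 1) : p f := by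
  classical
  rw [← support_sum_monomial_coeff f]
  refine Finset.sum_induction _ p hadd h0 fun e he => ?_
  have hdeg : e.degree = 1 := by
    by_contra h
    exact (mem_support_iff.1 he) (hf.coeff_eq_zero h)
  have hcard : Multiset.card (Finsupp.toMultiset e) = 1 := by
    rw [Finsupp.card_toMultiset, ← hdeg]; rfl
  obtain ⟨a, ha⟩ := Multiset.card_eq_one.1 hcard
  have he' : e = Finsupp.single a 1 := by
    rw [← Finsupp.toMultiset_toFinsupp e, ha, Multiset.toFinsupp_singleton]
  have h1 := hX (coeff e f) a
  rw [X, C_mul_monomial, ← he'] at h1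
  simpa using h1

variable {L : Type*} [Field L] [Algebra K L] {f : MvPolynomial σ K}

lemma aeval_add_of_linear (hf : f.IsHomogeneous 1) (x y : σ → L) :
    aeval (x + y) f = aeval x f + aeval y f :=
  isHomogeneous_one_induction (p := fun f => aeval (x + y) f = aeval x f + aeval y f)
    (by simp) (fun f g hf hg => by simp only [map_add, hf, hg]; ring)
    (fun c a => by simp; ring) hf

lemma aeval_smul_of_linear (hf : f.IsHomogeneous 1) (c : L) (x : σ → L) :
    aeval (c • x) f = c * aeval x f :=
  isHomogeneous_one_induction (p := fun f => aeval (c • x) f = c * aeval x f)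
    (by simp) (fun f g hf hg => by simp only [map_add, hf, hg]; ring)
    (fun c a => by simp; ring) hf

lemma aeval_smul_of_quadratic (hf : f.IsHomogeneous 2) (c : L) (x : σ → L) :
    aeval (c • x) f = (c * c) * aeval x f :=
  isHomogeneous_two_induction (p := fun f => aeval (c • x) f = (c * c) * aeval x f)
    (by simp) (fun f g hf hg => by simp only [map_add, hf, hg]; ring)
    (fun c a b => by simp; ring) hf

lemma polar_aeval_add (hf : f.IsHomogeneous 2) (x x' y : σ → L) :
    polar (fun x => aeval x f) (x + x') y =
      polar (fun x => aeval x f) x y + polar (fun x => aeval x f) x' y :=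
  isHomogeneous_two_induction (p := fun f => polar (fun x => aeval x f) (x + x') y =
      polar (fun x => aeval x f) x y + polar (fun x => aeval x f) x' y)
    (by simp [polar]) (fun f g hf hg => by
      simp only [polar, map_add] at hf hg ⊢
      linear_combination hf + hg)
    (fun c a b => by simp [polar]; ring) hf

lemma polar_aeval_smul (hf : f.IsHomogeneous 2) (c : L) (x y : σ → L) :
    polar (fun x => aeval x f) (c • x) y = c • polar (fun x => aeval x f) x y :=
  isHomogeneous_two_induction (p := fun f => polar (fun x => aeval x f) (c • x) y =
      c • polar (fun x => aeval x f) x y)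
    (by simp [polar]) (fun f g hf hg => by
      simp only [polar, map_add, smul_eq_mul] at hf hg ⊢
      linear_combination hf + hg)
    (fun c a b => by simp [polar]; ring) hf

lemma pderiv_pderiv_pderiv_eq_zero (hf : f.IsHomogeneous 2) (i j k : σ) :
    pderiv i (pderiv j (pderiv k f)) = 0 := by
  classical
  exact isHomogeneous_two_induction (p := fun f => pderiv i (pderiv j (pderiv k f)) = 0)
    (by simp) (fun f g hf hg => by simp only [map_add, hf, hg, add_zero])
    (fun c a b => by
      simp only [Derivation.leibniz, pderiv_C, pderiv_X, Pi.single_apply, smul_eq_mul]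
      split_ifs <;> simp [Pi.single_apply] <;> split_ifs <;> simp) hf

lemma pderiv_eq_C (hf : f.IsHomogeneous 1) (i : σ) :
    pderiv i f = C (constantCoeff (pderiv i f)) := by
  classical
  exact isHomogeneous_one_induction (p := fun f => pderiv i f = C (constantCoeff (pderiv i f)))
    (by simp) (fun f g hf hg => by rw [map_add, map_add, map_add, ← hf, ← hg])
    (fun c a => by simp [Pi.single_apply]; split_ifs <;> simp) hf

variable [DecidableEq σ]

lemma algebraMap_constantCoeff_pderiv (hf : f.IsHomogeneous 1) (i : σ) :
    algebraMap K L (constantCoeff (pderiv i f)) = aeval (Pi.single i (1 : L)) f :=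
  isHomogeneous_one_induction
    (p := fun f => algebraMap K L (constantCoeff (pderiv i f)) = aeval (Pi.single i (1 : L)) f)
    (by simp) (fun f g hf hg => by simp only [map_add, hf, hg])
    (fun c a => by simp [Pi.single_apply]; split_ifs <;> simp_all) hf

/-- The second derivatives of a quadratic form are the values of its polar form, also on the
diagonal, where both are twice the coefficient. -/
lemma map_pderiv_pderiv (hf : f.IsHomogeneous 2) (i j : σ) :
    MvPolynomial.map (algebraMap K L) (pderiv i (pderiv j f)) =
      C (polar (fun x => aeval x f) (Pi.single i (1 : L)) (Pi.single j 1)) :=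
  isHomogeneous_two_induction
    (p := fun f => MvPolynomial.map (algebraMap K L) (pderiv i (pderiv j f)) =
      C (polar (fun x => aeval x f) (Pi.single i (1 : L)) (Pi.single j 1)))
    (by simp [polar]) (fun f g hf hg => by
      simp only [map_add, hf, hg]
      rw [← C_add]
      congr 1
      simp only [polar]
      ring)
    (fun c a b => by
      have h1 : ∀ i a : σ, pderiv i (X a : MvPolynomial σ K) = 
          C ((Pi.single i 1 : σ → K) a) := fun i a => by
        rw [pderiv_X, Pi.single_apply, Pi.single_apply]
        split_ifs <;> simp
      have h2 : ∀ i a : σ, (Pi.single i 1 : σ → L) a = 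
          algebraMap K L ((Pi.single i 1 : σ → K) a) :=
        fun i a => by
          rw [Pi.single_apply, Pi.single_apply]
          split_ifs <;> simp
      simp only [polar, Derivation.leibniz, pderiv_C, h1, h2, smul_eq_mul, mul_zero, add_zero,
        zero_add, map_mul, map_add, map_sub, map_C, aeval_C, aeval_X, Pi.add_apply]
      ring) hf

/-- On the diagonal, the coefficient is the value of the form and not half of a polar value; this
keeps characteristic two included. -/
lemma algebraMap_coeff_self (hf : f.IsHomogeneous 2) (i : σ) :
    algebraMap K L (coeff (Finsupp.single i 1 + Finsupp.single i 1) f) =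
      aeval (Pi.single i (1 : L)) f :=
  isHomogeneous_two_induction
    (p := fun f => algebraMap K L (coeff (Finsupp.single i 1 + Finsupp.single i 1) f) =
      aeval (Pi.single i (1 : L)) f)
    (by simp) (fun f g hf hg => by simp only [coeff_add, map_add, hf, hg])
    (fun c a b => by
      rw [coeff_C_mul, coeff_mul_X', coeff_X]
      simp only [map_mul, aeval_C, aeval_X, Pi.single_apply]
      by_cases h1 : a = i <;> by_cases h2 : b = i
      · subst h1; subst h2; simp
      · simp [h1, h2]
      · subst h2
        simp [h1, Finsupp.single_left_inj]
      · simp [h1, h2]) hf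

lemma algebraMap_coeff_of_ne (hf : f.IsHomogeneous 2) {i j : σ} (hij : i ≠ j) :
    algebraMap K L (coeff (Finsupp.single i 1 + Finsupp.single j 1) f) =
      polar (fun x => aeval x f) (Pi.single i (1 : L)) (Pi.single j 1) :=
  isHomogeneous_two_induction
    (p := fun f => algebraMap K L (coeff (Finsupp.single i 1 + Finsupp.single j 1) f) =
      polar (fun x => aeval x f) (Pi.single i (1 : L)) (Pi.single j 1))
    (by simp [polar]) (fun f g hf hg => by
      simp only [coeff_add, map_add, hf, hg]
      simp only [polar]
      ring)
    (fun c a b => by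
      rw [coeff_C_mul, coeff_mul_X', coeff_X]
      simp only [map_mul, aeval_C, aeval_X, Pi.single_apply, polar, Pi.add_apply]
      by_cases h2 : b = i
      · subst h2
        by_cases h1 : a = j
        · subst h1; simp [hij, hij.symm]
        · by_cases h3 : a = b
          · subst h3; simp [hij, Finsupp.single_left_inj]
          · simp [h1, h3, hij, Finsupp.single_left_inj]
      · by_cases h4 : b = j
        · subst h4
          by_cases h1 : a = i
          · subst h1; simp [hij, hij.symm]
          · simp [h1, h2, Finsupp.single_left_inj]
        · simp [h2, h4]) hf

end Forms

section Matrices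

lemma map_pderiv_mul {σ K : Type*} [CommRing K] {p q r : ℕ}
    (A : Matrix (Fin p) (Fin q) (MvPolynomial σ K)) (B : Matrix (Fin q) (Fin r) (MvPolynomial σ K))
    (i : σ) : (A * B).map (pderiv i) = A.map (pderiv i) * B + A * B.map (pderiv i) := by
  ext1 s t
  simp only [Matrix.map_apply, Matrix.mul_apply, map_sum, Derivation.leibniz, smul_eq_mul,
    Matrix.add_apply, ← Finset.sum_add_distrib]
  exact Finset.sum_congr rfl fun _ _ => by ring

lemma map_entry {S T : Type*} [CommRing S] [CommRing T] {p q : ℕ} (f : S →+* T)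
    (M : Matrix (Fin p) (Fin q) S) : f (entry M) = entry (M.map f) := by
  simp [entry]

lemma pderiv_entry {σ K : Type*} [CommRing K] {p q : ℕ}
    (M : Matrix (Fin p) (Fin q) (MvPolynomial σ K)) (i : σ) :
    pderiv i (entry M) = entry (M.map (pderiv i)) := by
  simp [entry]

lemma entry_add {S : Type*} [CommRing S] {p q : ℕ} (M N : Matrix (Fin p) (Fin q) S) :
    entry (M + N) = entry M + entry N := by
  simp [entry, Finset.sum_add_distrib]

lemma entry_sub {S : Type*} [CommRing S] {p q : ℕ} (M N : Matrix (Fin p) (Fin q) S) :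
    entry (M - N) = entry M - entry N := by
  simp [entry, Finset.sum_sub_distrib]

lemma pathProd_map_eq {R S T V W : Type*} [CommRing R] [CommRing S] [CommRing T] {ρ : ℕ → ℕ}
    (f : R →+* T) (g : S →+* T) (D : ∀ k, V → Matrix (Fin (ρ k)) (Fin (ρ (k + 1))) R)
    (E : ∀ k, W → Matrix (Fin (ρ k)) (Fin (ρ (k + 1))) S) (t : ℕ) (a : Fin t → V) (c : Fin t → W)
    (h : ∀ k < t, ∀ r, (D k (a r)).map f = (E k (c r)).map g) :
    (pathProd D t a).map f = (pathProd E t c).map g := by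
  induction t with
  | zero => simp [pathProd]
  | succ t ih =>
    rw [pathProd, pathProd, Matrix.map_mul, Matrix.map_mul,
      ih _ (fun r => c r.castSucc) (fun k hk r => h k (by omega) _), h t (by omega)]

end Matrices

/-! ### The symbols of a resolution as determinants -/

namespace MinFreeRes

open QuadraticMap

variable {K : Type*} [Field K] {m : ℕ} {I : Ideal (MvPolynomial (Fin (m + 3)) K)}
  (F : MinFreeRes I) (L : Type*) [Field L] [Algebra K L]

/-- The matrix of a differential, evaluated at a vector with coordinates in an extension field. -/
def evalMat (k : ℕ) (x : Fin (m + 3) → L) : Matrix (Fin (F.rank k)) (Fin (F.rank (k + 1))) L :=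
  (F.φ k).map (aeval x)

/-- The differentials are quadratic at the ends and linear in between. -/
structure HasQuadraticEnds : Prop where
  first : ∀ r s, (F.φ 0 r s).IsHomogeneous 2
  last : ∀ r s, (F.φ (m + 1) r s).IsHomogeneous 2
  mid : ∀ k, 1 ≤ k → k ≤ m → ∀ r s, (F.φ k r s).IsHomogeneous 1

variable {F L}

lemma φ_mul_φ (k : ℕ) : F.φ k * F.φ (k + 1) = 0 := by
  apply Matrix.mulVec_injective
  ext1 v
  rw [Matrix.zero_mulVec, ← Matrix.mulVec_mulVec]
  exact (F.exact k).apply_apply_eq_zero v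

lemma exists_quadraticMap {k : ℕ} (h : ∀ r s, (F.φ k r s).IsHomogeneous 2) :
    ∃ Q : QuadraticMap L (Fin (m + 3) → L) (Matrix (Fin (F.rank k)) (Fin (F.rank (k + 1))) L),
      ⇑Q = F.evalMat L k :=
  ⟨QuadraticMap.ofPolar (F.evalMat L k)
    (fun c x => by ext r s; exact aeval_smul_of_quadratic (h r s) c x)
    (fun x x' y => by ext r s; exact polar_aeval_add (h r s) x x' y)
    (fun c x y => by ext r s; exact polar_aeval_smul (h r s) c x y), rfl⟩

lemma isQuadraticChain (hF : F.HasQuadraticEnds) {ι : Type*} (b : ι → Fin (m + 3) → L)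
    (h0 : ∀ i r s, aeval (b i) (F.φ 0 r s) = 0) (h1 : ∀ i r s, aeval (b i) (F.φ (m + 1) r s) = 0) :
    IsQuadraticChain m b (F.evalMat L) where
  mul_eq_zero k x := by
    have h := congrArg (fun M => M.map (aeval x : MvPolynomial (Fin (m + 3)) K →ₐ[K] L))
      (F.φ_mul_φ k)
    rw [evalMat, evalMat]
    have e := Matrix.map_mul (L := F.φ k) (M := F.φ (k + 1))
      (f := ((aeval x : MvPolynomial (Fin (m + 3)) K →ₐ[K] L) : MvPolynomial (Fin (m + 3)) K →+* L))
    refine e.symm.trans (h.trans ?_)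
    ext; simp
  first := exists_quadraticMap hF.first
  mid k hk := ⟨
    { toFun := F.evalMat L (k + 1)
      map_add' := fun x y => by
        ext r s; exact aeval_add_of_linear (hF.mid (k + 1) (by omega) (by omega) r s) x y
      map_smul' := fun c x => by
        ext r s; exact aeval_smul_of_linear (hF.mid (k + 1) (by omega) (by omega) r s) c x }, rfl⟩
  last := exists_quadraticMap hF.last
  first_zero i := by ext r s; exact h0 i r s
  last_zero i := by ext r s; exact h1 i r s

lemma quadCoeff_self {k : ℕ} (h : ∀ r s, (F.φ k r s).IsHomogeneous 2) (i : Fin (m + 3)) :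
    (F.quadCoeff k i i).map (algebraMap K L) = F.evalMat L k (stdVec L i) := by
  ext r s
  exact algebraMap_coeff_self (h r s) i

lemma quadCoeff_of_ne {k : ℕ} (h : ∀ r s, (F.φ k r s).IsHomogeneous 2) {i j : Fin (m + 3)}
    (hij : i ≠ j) :
    (F.quadCoeff k i j).map (algebraMap K L) =
      polar (F.evalMat L k) (stdVec L i) (stdVec L j) := by
  ext r s
  exact algebraMap_coeff_of_ne (h r s) hij

/-- Braces are values of the products along the resolution, polarised at an end exactly when its
two indices differ. -/
lemma algebraMap_brace (hF : F.HasQuadraticEnds) (a b d e : Fin (m + 3))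
    {c : List (Fin (m + 3))} (hc : c.length = m) :
    algebraMap K L (F.brace ([a, b] ++ c ++ [d, e])) =
      entry ((F.quadCoeff 0 a b).map (algebraMap K L) *
        midProd (F.evalMat L) m (fun r => stdVec L (toSeq m c r)) *
        (F.quadCoeff (m + 1) d e).map (algebraMap K L)) := by
  have hlen : ([a, b] ++ c ++ [d, e]).length = m + 4 := by simp [hc]
  have e0 : toSeq (m + 4) ([a, b] ++ c ++ [d, e]) 0 = a := rfl
  have e1 : toSeq (m + 4) ([a, b] ++ c ++ [d, e]) 1 = b := rfl
  have e2 : toSeq (m + 4) ([a, b] ++ c ++ [d, e]) (Fin.last (m + 2)).castSucc = d := by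
    rw [toSeq_eq_getElem hlen]
    simp [hc, List.getElem_append_right]
  have e3 : toSeq (m + 4) ([a, b] ++ c ++ [d, e]) (Fin.last (m + 3)) = e := by
    rw [toSeq_eq_getElem hlen]
    simp [hc, List.getElem_append_right]
  have e4 : ∀ r : Fin m, toSeq (m + 4) ([a, b] ++ c ++ [d, e]) r.castSucc.castSucc.succ.succ =
      toSeq m c r := fun r => by
    rw [toSeq_eq_getElem hlen, toSeq_eq_getElem hc]
    simp [hc, List.getElem_append_left]
  rw [brace, map_entry, Matrix.map_mul, Matrix.map_mul]
  simp only [e0, e1, e2, e3, e4]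
  congr 3
  rw [midProd]
  refine (pathProd_map_eq (ρ := fun k => F.rank (k + 1)) (algebraMap K L) (RingHom.id L)
    _ (fun k => F.evalMat L (k + 1)) m _ (fun r => stdVec L (toSeq m c r)) fun k hk r => ?_).trans ?_
  · ext s t
    exact algebraMap_constantCoeff_pderiv (hF.mid (k + 1) (by omega) (by omega) s t) _
  · ext; rfl

/-- In a bracket only the two quadratic ends depend on the variables, so that one derivative has
to fall on each of them. -/
lemma map_pderiv_pderiv_bracket (hF : F.HasQuadraticEnds) (i j : Fin (m + 3))
    (a : Fin (m + 2) → Fin (m + 3)) :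
    MvPolynomial.map (algebraMap K L) (pderiv i (pderiv j (F.bracket a))) =
      C (entry (polar (F.evalMat L 0) (stdVec L j) (stdVec L (a 0)) *
          midProd (F.evalMat L) m (fun r => stdVec L (a r.castSucc.succ)) *
          polar (F.evalMat L (m + 1)) (stdVec L i) (stdVec L (a (Fin.last (m + 1))))) +
        entry (polar (F.evalMat L 0) (stdVec L i) (stdVec L (a 0)) *
          midProd (F.evalMat L) m (fun r => stdVec L (a r.castSucc.succ)) *
          polar (F.evalMat L (m + 1)) (stdVec L j) (stdVec L (a (Fin.last (m + 1)))))) := by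
  set N : Matrix (Fin (F.rank 1)) (Fin (F.rank (m + 1))) (MvPolynomial (Fin (m + 3)) K) :=
    pathProd (ρ := fun k => F.rank (k + 1)) (fun k i => (F.φ (k + 1)).map (pderiv i)) m
      (fun r => a r.castSucc.succ) with hN
  set A := (F.φ 0).map (pderiv (a 0)) with hA
  set B := (F.φ (m + 1)).map (pderiv (a (Fin.last (m + 1)))) with hB
  have hbr : F.bracket a = entry (A * N * B) := by
    rw [bracket, pathProd, pathProd_succ_left]
    rfl
  have hNC : ∃ N₀ : Matrix (Fin (F.rank 1)) (Fin (F.rank (m + 1))) K, N = N₀.map C := by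
    refine ⟨pathProd (ρ := fun k => F.rank (k + 1))
      (fun k i => (F.φ (k + 1)).map fun f => constantCoeff (pderiv i f)) m
      (fun r => a r.castSucc.succ), ?_⟩
    have := pathProd_map_eq (ρ := fun k => F.rank (k + 1)) (RingHom.id _) (C : K →+* _)
      (fun k i => (F.φ (k + 1)).map (pderiv i))
      (fun k i => (F.φ (k + 1)).map fun f => constantCoeff (pderiv i f)) m
      (fun r => a r.castSucc.succ) (fun r => a r.castSucc.succ) (fun k hk r => by
        ext1 s t
        exact pderiv_eq_C (hF.mid (k + 1) (by omega) (by omega) s t) _)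
    rw [← this]
    ext; rfl
  have hNd : ∀ i, N.map (pderiv i) = 0 := by
    obtain ⟨N₀, h⟩ := hNC
    intro i
    rw [h]
    ext1 s t
    simp
  have hNL : N.map (MvPolynomial.map (algebraMap K L)) =
      (midProd (F.evalMat L) m (fun r => stdVec L (a r.castSucc.succ))).map C := by
    refine pathProd_map_eq (ρ := fun k => F.rank (k + 1)) (MvPolynomial.map (algebraMap K L)) C
      _ _ m _ _ fun k hk r => ?_
    ext1 s t
    have h1 := hF.mid (k + 1) (by omega) (by omega) s t
    rw [Matrix.map_apply, Matrix.map_apply, Matrix.map_apply, pderiv_eq_C h1, map_C,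
      algebraMap_constantCoeff_pderiv h1]
    rfl
  have hAA : ∀ i j, (A.map (pderiv j)).map (pderiv i) = 0 := fun i j => by
    ext1 s t; exact pderiv_pderiv_pderiv_eq_zero (hF.first s t) _ _ _
  have hBB : ∀ i j, (B.map (pderiv j)).map (pderiv i) = 0 := fun i j => by
    ext1 s t; exact pderiv_pderiv_pderiv_eq_zero (hF.last s t) _ _ _
  have hAL : ∀ i, (A.map (pderiv i)).map (MvPolynomial.map (algebraMap K L)) =
      (polar (F.evalMat L 0) (stdVec L i) (stdVec L (a 0))).map C := fun i => by
    ext1 s t; exact map_pderiv_pderiv (hF.first s t) _ _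
  have hBL : ∀ i, (B.map (pderiv i)).map (MvPolynomial.map (algebraMap K L)) =
      (polar (F.evalMat L (m + 1)) (stdVec L i) (stdVec L (a (Fin.last (m + 1))))).map C :=
    fun i => by ext1 s t; exact map_pderiv_pderiv (hF.last s t) _ _
  have hadd : ∀ {p q : ℕ} (M M' : Matrix (Fin p) (Fin q) (MvPolynomial (Fin (m + 3)) K)) i,
      (M + M').map (pderiv i) = M.map (pderiv i) + M'.map (pderiv i) := fun M M' i =>
    Matrix.map_add _ (map_add _) _ _
  rw [hbr, pderiv_entry, map_pderiv_mul, map_pderiv_mul, hNd, Matrix.mul_zero, add_zero,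
    pderiv_entry, hadd, map_pderiv_mul, map_pderiv_mul, map_pderiv_mul, map_pderiv_mul, hNd, hAA,
    hBB, Matrix.zero_mul, Matrix.mul_zero, Matrix.mul_zero, Matrix.mul_zero, zero_add,
    Matrix.zero_mul, zero_add, add_zero, add_zero, entry_add, map_add, map_entry, map_entry,
    C_add, map_entry C, map_entry C]
  simp only [Matrix.map_mul, hNL, hAL, hBL]

/-- A symmetric bilinear product that computes the products along a resolution as determinants. -/
structure IsProductOf (F : MinFreeRes I)
    (β : (Fin (m + 3) → L) →ₗ[L] (Fin (m + 3) → L) →ₗ[L] (Fin (m + 3) → L)) : Prop where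
  ends : F.HasQuadraticEnds
  symm : ∀ x y, β x y = β y x
  formula : ∀ x y z, entry (F.evalMat L 0 x * midProd (F.evalMat L) m y * F.evalMat L (m + 1) z) =
    -altForm Matrix.detRowAlternating (β x z) x y z

lemma exists_isProductOf [Infinite L] (hF : F.HasQuadraticEnds)
    (b : Module.Basis (Fin (m + 3)) L (Fin (m + 3) → L))
    (h0 : ∀ i r s, aeval (b i) (F.φ 0 r s) = 0) (h1 : ∀ i r s, aeval (b i) (F.φ (m + 1) r s) = 0) :
    ∃ β : (Fin (m + 3) → L) →ₗ[L] (Fin (m + 3) → L) →ₗ[L] (Fin (m + 3) → L),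
      F.IsProductOf β := by
  have hω : Matrix.detRowAlternating (b : Fin (m + 3) → Fin (m + 3) → L) ≠ 0 := by
    rw [← Pi.basisFun_det]
    exact ((Pi.basisFun L (Fin (m + 3))).isUnit_det b).ne_zero
  obtain ⟨β, hβ, h⟩ := (isQuadraticChain hF b h0 h1).exists_det_formula hω
  exact ⟨β, hF, hβ, h⟩

namespace IsProductOf

variable {β : (Fin (m + 3) → L) →ₗ[L] (Fin (m + 3) → L) →ₗ[L] (Fin (m + 3) → L)}

lemma formula_polar_left (h : F.IsProductOf β) (x x' : Fin (m + 3) → L)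
    (y : Fin m → Fin (m + 3) → L) (z : Fin (m + 3) → L) :
    entry (polar (F.evalMat L 0) x x' * midProd (F.evalMat L) m y * F.evalMat L (m + 1) z) =
      -(altForm Matrix.detRowAlternating (β x z) x' y z +
        altForm Matrix.detRowAlternating (β x' z) x y z) := by
  simp only [polar, Matrix.sub_mul, entry_sub, h.formula, map_add, LinearMap.add_apply,
    altForm_add_fst, altForm_add_snd]
  ring

lemma formula_polar_right (h : F.IsProductOf β) (x : Fin (m + 3) → L)
    (y : Fin m → Fin (m + 3) → L) (z z' : Fin (m + 3) → L) :
    entry (F.evalMat L 0 x * midProd (F.evalMat L) m y * polar (F.evalMat L (m + 1)) z z') =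
      -(altForm Matrix.detRowAlternating (β x z) x y z' +
        altForm Matrix.detRowAlternating (β x z') x y z) := by
  simp only [polar, Matrix.mul_sub, entry_sub, h.formula, map_add, altForm_add_fst,
    altForm_add_last]
  ring

lemma formula_polar (h : F.IsProductOf β) (x x' : Fin (m + 3) → L)
    (y : Fin m → Fin (m + 3) → L) (z z' : Fin (m + 3) → L) :
    entry (polar (F.evalMat L 0) x x' * midProd (F.evalMat L) m y *
      polar (F.evalMat L (m + 1)) z z') =
      -(altForm Matrix.detRowAlternating (β x z) x' y z' +
        altForm Matrix.detRowAlternating (β x z') x' y z +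
        altForm Matrix.detRowAlternating (β x' z) x y z' +
        altForm Matrix.detRowAlternating (β x' z') x y z) := by
  have h1 : polar (F.evalMat L (m + 1)) z z' = F.evalMat L (m + 1) (z + z') -
      F.evalMat L (m + 1) z - F.evalMat L (m + 1) z' := rfl
  simp only [h1, Matrix.mul_sub, entry_sub, h.formula_polar_left, map_add, altForm_add_fst,
    altForm_add_last]
  ring

/-- The second derivatives of a single bracket: the determinant that carries the structure
constants, and exchanges at the two ends, which become traces after the cyclic summation. -/
lemma map_pderiv_pderiv_bracket_eq (h : F.IsProductOf β) (i j : Fin (m + 3))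
    (a : Fin (m + 2) → Fin (m + 3)) :
    MvPolynomial.map (algebraMap K L) (pderiv i (pderiv j (F.bracket a))) =
      C (-(2 * Matrix.detRowAlternating (Fin.cons (β (stdVec L i) (stdVec L j))
            (fun r => stdVec L (a r)) : Fin (m + 3) → Fin (m + 3) → L) +
        (exchange (β (stdVec L i)) (stdVec L j) (fun r => stdVec L (a r)) (Fin.last (m + 1)) +
          exchange (β (stdVec L i)) (stdVec L j) (fun r => stdVec L (a r)) 0) +
        (exchange (β (stdVec L j)) (stdVec L i) (fun r => stdVec L (a r)) (Fin.last (m + 1)) +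
          exchange (β (stdVec L j)) (stdVec L i) (fun r => stdVec L (a r)) 0))) := by
  have e1 : ∀ u, altForm Matrix.detRowAlternating u (stdVec L (a 0))
      (fun r => stdVec L (a r.castSucc.succ)) (stdVec L (a (Fin.last (m + 1)))) =
      Matrix.detRowAlternating (Fin.cons u
            (fun r => stdVec L (a r)) : Fin (m + 3) → Fin (m + 3) → L) := fun u => by
    rw [altForm]
    congr 1
    ext1 r
    induction r using Fin.cases with
    | zero => rfl
    | succ r =>
      rw [tuple, Fin.cons_succ, Fin.cons_succ]
      induction r using Fin.cases with
      | zero => rfl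
      | succ r =>
        rw [Fin.cons_succ]
        induction r using Fin.lastCases with
        | last => rw [Fin.snoc_last, Fin.succ_last]
        | cast r => rw [Fin.snoc_castSucc]
  have e2 : ∀ (B : (Fin (m + 3) → L) →ₗ[L] (Fin (m + 3) → L)) v,
      altForm Matrix.detRowAlternating (B (stdVec L (a (Fin.last (m + 1))))) (stdVec L (a 0))
      (fun r => stdVec L (a r.castSucc.succ)) v =
      exchange B v (fun r => stdVec L (a r)) (Fin.last (m + 1)) := fun B v => by
    rw [altForm, exchange]
    congr 1
    ext1 r
    induction r using Fin.cases with
    | zero => rfl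
    | succ r =>
      rw [tuple, Fin.cons_succ, Fin.cons_succ]
      induction r using Fin.cases with
      | zero =>
        rw [Fin.cons_zero, Function.update_of_ne (by simp [Fin.ext_iff])]
      | succ r =>
        rw [Fin.cons_succ]
        induction r using Fin.lastCases with
        | last => rw [Fin.snoc_last, Fin.succ_last, Function.update_self]
        | cast r =>
          rw [Fin.snoc_castSucc, Function.update_of_ne]
          rw [Ne, Fin.ext_iff]
          exact (Nat.succ_lt_succ r.2).ne
  have e3 : ∀ (B : (Fin (m + 3) → L) →ₗ[L] (Fin (m + 3) → L)) v,
      altForm Matrix.detRowAlternating (B (stdVec L (a 0))) v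
      (fun r => stdVec L (a r.castSucc.succ)) (stdVec L (a (Fin.last (m + 1)))) =
      exchange B v (fun r => stdVec L (a r)) 0 := fun B v => by
    rw [altForm, exchange]
    congr 1
    ext1 r
    induction r using Fin.cases with
    | zero => rfl
    | succ r =>
      rw [tuple, Fin.cons_succ, Fin.cons_succ]
      induction r using Fin.cases with
      | zero => rw [Fin.cons_zero, Function.update_self]
      | succ r =>
        rw [Fin.cons_succ, Function.update_of_ne (Fin.succ_ne_zero r)]
        induction r using Fin.lastCases with
        | last => rw [Fin.snoc_last, Fin.succ_last]
        | cast r => rw [Fin.snoc_castSucc]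
  have e4 : ∀ u y, altForm Matrix.detRowAlternating u (stdVec L i) y (stdVec L j) +
      altForm Matrix.detRowAlternating u (stdVec L j) y (stdVec L i) = 0 := fun u y => by
    have := altForm_snd_eq_last Matrix.detRowAlternating u (stdVec L i + stdVec L j) y
    rw [altForm_add_snd, altForm_add_last, altForm_add_last, altForm_snd_eq_last,
      altForm_snd_eq_last, zero_add, add_zero] at this
    exact this
  -- `e4` removes the terms in which both `e_i` and `e_j` stand in the determinant
  rw [map_pderiv_pderiv_bracket h.ends, h.formula_polar, h.formula_polar]
  congr 1
  have e5 := e4 (β (stdVec L (a 0)) (stdVec L (a (Fin.last (m + 1)))))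
    (fun r => stdVec L (a r.castSucc.succ))
  rw [h.symm (stdVec L (a 0)) (stdVec L i), h.symm (stdVec L (a 0)) (stdVec L j),
    h.symm (stdVec L j) (stdVec L i), e1, e2, e2, e3, e3]
  linear_combination -e5

/-- The second derivatives of `Ω_k` are the structure constants of the product, up to the factor
`2n` and to a change of the basis elements by multiples of the unit. -/
theorem map_pderiv_pderiv_Omega (h : F.IsProductOf β) (i j k : Fin (m + 3)) :
    MvPolynomial.map (algebraMap K L) (pderiv i (pderiv j (F.Omega k))) =
      C (2 * ((m + 4 : ℕ) : L) * β (stdVec L i) (stdVec L j) k -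
        2 * (if j = k then ∑ s, β (stdVec L i) (stdVec L s) s else 0) -
        2 * (if i = k then ∑ s, β (stdVec L j) (stdVec L s) s else 0)) := by
  set w := toSeq (m + 2) (omitted [k]) with hw
  have hlen : (omitted [k]).length = m + 2 := by
    have := length_add_length_omitted (List.nodup_singleton k)
    simp at this
    omega
  have hinj : Function.Injective w := toSeq_injective hlen (nodup_omitted _)
  have hk : ∀ r, w r ≠ k := fun r hr => by
    have : w r ∈ omitted [k] := by
      rw [hw, toSeq_eq_getElem hlen]; exact List.getElem_mem _
    rw [mem_omitted, hr] at this
    simp at this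
  have hs : ∀ s, s ≠ k → ∃ r, w r = s := fun s hsk => by
    have : s ∈ omitted [k] := by rw [mem_omitted]; simpa using hsk
    obtain ⟨r, hr, hrs⟩ := List.getElem_of_mem this
    exact ⟨⟨r, hlen ▸ hr⟩, by rw [hw, toSeq_eq_getElem hlen, ← hrs]⟩
  set W := Matrix.detRowAlternating (Fin.cons (stdVec L k) (fun r => stdVec L (w r)) :
    Fin (m + 3) → Fin (m + 3) → L) with hW
  have hWk : W = (-1) ^ (k : ℕ) := by
    rw [← eps_singleton, eps_cast, signDet, hW]
    congr 1
    ext1 r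
    induction r using Fin.cases with
    | zero => rfl
    | succ r => rfl
  have hterm : ∀ t, MvPolynomial.map (algebraMap K L) (pderiv i (pderiv j
      (F.bracket fun r => w (((finRotate (m + 2)) ^ (2 * t)) r)))) =
      C (-(2 * (β (stdVec L i) (stdVec L j) k * W) +
        (exchange (β (stdVec L i)) (stdVec L j) (fun r => stdVec L (w r))
            (((finRotate (m + 2)) ^ (2 * t)) (Fin.last (m + 1))) +
          exchange (β (stdVec L i)) (stdVec L j) (fun r => stdVec L (w r))
            (((finRotate (m + 2)) ^ (2 * t)) 0)) +
        (exchange (β (stdVec L j)) (stdVec L i) (fun r => stdVec L (w r))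
            (((finRotate (m + 2)) ^ (2 * t)) (Fin.last (m + 1))) +
          exchange (β (stdVec L j)) (stdVec L i) (fun r => stdVec L (w r))
            (((finRotate (m + 2)) ^ (2 * t)) 0)))) := fun t => by
    have hsg := sign_rotate_sq (m + 2) t
    have e : (fun r => stdVec L (w (((finRotate (m + 2)) ^ (2 * t)) r))) =
        (fun r => stdVec L (w r)) ∘ ((finRotate (m + 2)) ^ (2 * t)) := rfl
    rw [h.map_pderiv_pderiv_bracket_eq, e, det_cons_perm _ _ hsg, det_cons_eq _ hs,
      exchange_perm _ _ _ hsg, exchange_perm _ _ _ hsg, exchange_perm _ _ _ hsg,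
      exchange_perm _ _ _ hsg]
  have hone : ∀ f, MvPolynomial.map (algebraMap K L) (pderiv i (pderiv j
      ((-1) ^ ((k : ℕ) + 1) * f))) = C ((-1) ^ ((k : ℕ) + 1)) *
        MvPolynomial.map (algebraMap K L) (pderiv i (pderiv j f)) := fun f => by
    have : ((-1) ^ ((k : ℕ) + 1) : MvPolynomial (Fin (m + 3)) K) = C ((-1) ^ ((k : ℕ) + 1)) := by
      simp
    rw [this, pderiv_C_mul, pderiv_C_mul, map_mul, map_C]
    simp
  rw [Omega, hone, doubleBracket, map_sum, map_sum, map_sum, Finset.sum_congr rfl fun t _ => hterm t,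
    ← map_sum, ← C_mul, Finset.sum_neg_distrib, Finset.sum_add_distrib, Finset.sum_add_distrib,
    sum_rotate_sq, sum_rotate_sq, sum_exchange _ _ hinj hk hs, sum_exchange _ _ hinj hk hs,
    ← hW, hWk, h.symm (stdVec L j) (stdVec L i)]
  congr 1
  have hsq : ((-1) ^ (k : ℕ) : L) * (-1) ^ (k : ℕ) = 1 := by
    rw [← mul_pow]; simp
  simp only [Finset.sum_const, Nat.card_Icc, nsmul_eq_mul, pow_succ]
  push_cast
  linear_combination (2 * ((m : L) + 4) * β (stdVec L i) (stdVec L j) k -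
        2 * (if j = k then ∑ s, β (stdVec L i) (stdVec L s) s else 0) -
        2 * (if i = k then ∑ s, β (stdVec L j) (stdVec L s) s else 0)) * hsq

end IsProductOf

end MinFreeRes

/-! ### The table of structure constants -/

lemma eps_mul_self {N : ℕ} [NeZero N] (L : Type*) [Field L] {l : List (Fin N)} (hl : l.Nodup) :
    (eps l : L) * (eps l : L) = 1 := by
  have h : Function.Bijective (toSeq N (l ++ omitted l)) := by
    refine Finite.injective_iff_bijective.1 (toSeq_injective ?_ ?_)
    · rw [List.length_append, length_add_length_omitted hl]
    · exact (append_omitted_perm hl).nodup_iff.2 (List.nodup_finRange N)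
  rw [eps, dif_pos h]
  rcases Int.units_eq_one_or (Equiv.Perm.sign (Equiv.ofBijective _ h)) with h1 | h1 <;> simp [h1]

section Signs

variable {L : Type*} [Field L] {m : ℕ}

lemma signDet_last {x y z : Fin (m + 3)} {c : List (Fin (m + 3))} (hc : c.length = m) :
    signDet L (x :: y :: (c ++ [z])) = (-1) ^ m * signDet L (z :: x :: y :: c) := by
  have h := signDet_move (L := L) [] (x :: y :: c) [] z (by simp [hc])
  rw [List.nil_append, List.append_nil, List.nil_append] at h
  rw [h, List.length_cons, List.length_cons, hc, ← mul_assoc, ← pow_add,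
    show m + (m + 1 + 1) = 2 * (m + 1) by ring, pow_mul]
  simp

lemma signDet_swap_fst (x y z : Fin (m + 3)) (c : List (Fin (m + 3))) :
    signDet L (x :: y :: z :: c) = -signDet L (y :: x :: z :: c) :=
  signDet_swap [] (z :: c) x y (by simp)

lemma signDet_swap_snd (x y z : Fin (m + 3)) (c : List (Fin (m + 3))) :
    signDet L (x :: y :: z :: c) = -signDet L (x :: z :: y :: c) :=
  signDet_swap [x] c y z (by simp)

lemma altForm_eq_zero_of_not_nodup (u : Fin (m + 3) → L) {a d : Fin (m + 3)}
    {c : List (Fin (m + 3))} (hc : c.length = m) (h : ¬ (a :: (c ++ [d])).Nodup) :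
    altForm Matrix.detRowAlternating u (stdVec L a)
      (fun r => stdVec L (toSeq m c r)) (stdVec L d) = 0 := by
  rw [altForm_fst_sum]
  refine Finset.sum_eq_zero fun s _ => ?_
  rw [altForm_stdVec _ _ _ hc, signDet_eq_zero (by simp [hc]), mul_zero]
  exact fun h1 => h (List.nodup_cons.1 h1).2

end Signs

namespace MinFreeRes

variable {K : Type*} [Field K] {m : ℕ} {I : Ideal (MvPolynomial (Fin (m + 3)) K)}
  {F : MinFreeRes I} {L : Type*} [Field L] [Algebra K L]

lemma quadCoeff_comm (k : ℕ) (i j : Fin (m + 3)) : F.quadCoeff k i j = F.quadCoeff k j i := by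
  rw [quadCoeff, quadCoeff, add_comm (Finsupp.single i 1)]

namespace IsProductOf

variable {β : (Fin (m + 3) → L) →ₗ[L] (Fin (m + 3) → L) →ₗ[L] (Fin (m + 3) → L)}
  {i j k : Fin (m + 3)} {c : List (Fin (m + 3))}

/-- Besides `i`, `j` and `k`, the list `c` contains all indices. Hence in every determinant of the
polarised formula at most one index is missing, and one coordinate of `β` remains. -/
lemma brace_ii_jj (h : F.IsProductOf β) (hc : c.length = m)
    (hs : ∀ s, s = i ∨ s = j ∨ s = k ∨ s ∈ c) :
    algebraMap K L (F.brace ([i, i] ++ c ++ [j, j])) =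
      (-1) ^ (m + 1) * signDet L (i :: j :: k :: c) * β (stdVec L i) (stdVec L j) k := by
  rw [algebraMap_brace h.ends _ _ _ _ hc, quadCoeff_self h.ends.first, quadCoeff_self h.ends.last,
    h.formula, altForm_eq_single _ k hc, signDet_last hc, signDet_swap_snd j k i,
    signDet_swap_fst j i k]
  · ring
  · intro s hsk
    have := hs s
    simp only [List.mem_cons, List.mem_append, List.not_mem_nil, or_false]
    tauto

lemma brace_ii_jk (h : F.IsProductOf β) (hc : c.length = m) (hjk : j ≠ k)
    (hs : ∀ s, s = i ∨ s = j ∨ s = k ∨ s ∈ c) :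
    algebraMap K L (F.brace ([i, i] ++ c ++ [j, k])) =
      (-1) ^ m * signDet L (i :: j :: k :: c) *
        (β (stdVec L i) (stdVec L j) j - β (stdVec L i) (stdVec L k) k) := by
  rw [algebraMap_brace h.ends _ _ _ _ hc, quadCoeff_self h.ends.first,
    quadCoeff_of_ne h.ends.last hjk, h.formula_polar_right, altForm_eq_single _ j hc,
    altForm_eq_single _ k hc, signDet_last hc, signDet_last hc, signDet_swap_snd j k i,
    signDet_swap_fst j i k, signDet_swap_fst k j i, signDet_swap_snd j k i, signDet_swap_fst j i k]
  · ring
  all_goals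
    intro s hsk
    have := hs s
    simp only [List.mem_cons, List.mem_append, List.not_mem_nil, or_false]
    tauto

lemma brace_jk_ii (h : F.IsProductOf β) (hc : c.length = m) (hjk : j ≠ k)
    (hs : ∀ s, s = i ∨ s = j ∨ s = k ∨ s ∈ c) :
    algebraMap K L (F.brace ([j, k] ++ c ++ [i, i])) =
      (-1) ^ (m + 1) * signDet L (i :: j :: k :: c) *
        (β (stdVec L i) (stdVec L j) j - β (stdVec L i) (stdVec L k) k) := by
  rw [algebraMap_brace h.ends _ _ _ _ hc, quadCoeff_self h.ends.last,
    quadCoeff_of_ne h.ends.first hjk, h.formula_polar_left, altForm_eq_single _ j hc,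
    altForm_eq_single _ k hc, signDet_last hc, signDet_last hc, signDet_swap_snd i k j,
    h.symm (stdVec L j), h.symm (stdVec L k)]
  · ring
  all_goals
    intro s hsk
    have := hs s
    simp only [List.mem_cons, List.mem_append, List.not_mem_nil, or_false]
    tauto

lemma brace_ij_ki (h : F.IsProductOf β) (hc : c.length = m) (hij : i ≠ j) (hik : i ≠ k)
    (hs : ∀ s, s = i ∨ s = j ∨ s = k ∨ s ∈ c) :
    algebraMap K L (F.brace ([i, j] ++ c ++ [k, i])) =
      (-1) ^ (m + 1) * signDet L (i :: j :: k :: c) *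
        (β (stdVec L i) (stdVec L i) i - β (stdVec L i) (stdVec L j) j -
          β (stdVec L i) (stdVec L k) k) := by
  rw [algebraMap_brace h.ends _ _ _ _ hc, quadCoeff_of_ne h.ends.first hij,
    quadCoeff_of_ne h.ends.last hik.symm, h.formula_polar,
    altForm_snd_eq_last, altForm_eq_single (β (stdVec L i) (stdVec L k)) k hc,
    altForm_eq_single (β (stdVec L i) (stdVec L i)) i hc,
    altForm_eq_single (β (stdVec L j) (stdVec L i)) j hc, signDet_last hc, signDet_last hc,
    signDet_last hc, signDet_swap_snd i k j, signDet_swap_fst k i j, signDet_swap_snd i k j,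
    signDet_swap_fst k j i, signDet_swap_snd j k i, signDet_swap_fst j i k, h.symm (stdVec L j)]
  · ring
  all_goals
    intro s hsk
    have := hs s
    simp only [List.mem_cons, List.mem_append, List.not_mem_nil, or_false]
    tauto

lemma brace_ii_ki (h : F.IsProductOf β) (hc : c.length = m) (hik : i ≠ k)
    (hs : ∀ s, s = i ∨ s = j ∨ s = k ∨ s ∈ c) :
    algebraMap K L (F.brace ([i, i] ++ c ++ [k, i])) =
      signDet L (i :: j :: (c ++ [k])) * β (stdVec L i) (stdVec L i) j := by
  rw [algebraMap_brace h.ends _ _ _ _ hc, quadCoeff_self h.ends.first,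
    quadCoeff_of_ne h.ends.last hik.symm, h.formula_polar_right, altForm_snd_eq_last,
    altForm_eq_single _ j hc, signDet_last hc, signDet_last hc, signDet_swap_snd k j i]
  · ring
  · intro s hsk
    have := hs s
    simp only [List.mem_cons, List.mem_append, List.not_mem_nil, or_false]
    tauto

/-- A brace in which `i` occurs three times: the terms with `i` twice in the determinant vanish. -/
lemma brace_li_ik (h : F.IsProductOf β) {l : Fin (m + 3)} (hc : c.length = m)
    (hli : l ≠ i) (hik : i ≠ k) (hic : i ∈ c) (hs : ∀ s, s ≠ j → s ∈ l :: (c ++ [k])) :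
    algebraMap K L (F.brace ([l, i] ++ c ++ [i, k])) =
      -(signDet L (j :: l :: (c ++ [k])) * β (stdVec L i) (stdVec L i) j) := by
  rw [algebraMap_brace h.ends _ _ _ _ hc, quadCoeff_of_ne h.ends.first hli,
    quadCoeff_of_ne h.ends.last hik, h.formula_polar, altForm_snd_eq_last,
    altForm_eq_zero_of_not_nodup _ hc (a := i) (d := k),
    altForm_eq_zero_of_not_nodup _ hc (a := l) (d := i),
    altForm_eq_single _ j hc hs]
  · ring
  · intro h1
    have := (List.nodup_append.1 (List.nodup_cons.1 h1).2).2.2 i hic i (by simp)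
    exact this rfl
  · intro h1
    exact (List.nodup_cons.1 h1).1 (List.mem_append_left _ hic)

lemma length_omitted_three (hij : i ≠ j) (hik : i ≠ k) (hjk : j ≠ k) :
    (omitted [i, j, k]).length = m := by
  have := length_add_length_omitted (l := [i, j, k]) (by simp [*])
  simp at this
  omega

lemma mem_three_or_omitted (s : Fin (m + 3)) :
    s = i ∨ s = j ∨ s = k ∨ s ∈ omitted [i, j, k] := by
  rw [mem_omitted]
  simp only [List.mem_cons, List.not_mem_nil, or_false]
  tauto

/-- The brace for `c^k_{ij}` with distinct indices. Its power of `-1` is made up of the sign of the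
determinantal formula and of the cost of moving the last vector of the determinant across the
middle. -/
lemma row_one (h : F.IsProductOf β) (hij : i ≠ j) (hik : i ≠ k) (hjk : j ≠ k) :
    algebraMap K L ((-1) ^ ((m + 4) + 1) * (eps [i, j, k] : K) *
      F.brace ([i, i] ++ omitted [i, j, k] ++ [j, j])) = β (stdVec L i) (stdVec L j) k := by
  have he := eps_mul_self L (l := [i, j, k]) (by simp [*])
  rw [map_mul, map_mul, map_intCast, h.brace_ii_jj (length_omitted_three hij hik hjk)
    mem_three_or_omitted]
  have e := eps_cast (L := L) [i, j, k]
  simp only [List.cons_append, List.nil_append] at e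
  rw [← e, map_pow, map_neg, map_one]
  have h2 : ((-1) ^ ((m + 4) + 1) : L) * (-1) ^ (m + 1) = 1 := by
    rw [← pow_add, show m + 4 + 1 + (m + 1) = 2 * (m + 3) by ring, pow_mul]; simp
  linear_combination (β (stdVec L i) (stdVec L j) k) * ((eps [i, j, k] : L) * (eps [i, j, k] : L)) *
    h2 + (β (stdVec L i) (stdVec L j) k) * he

lemma row_two (h : F.IsProductOf β) (hij : i ≠ j) :
    algebraMap K L ((eps [i, j] : K) *
      F.brace ([i, i] ++ omitted [i, j] ++ [i])) = β (stdVec L i) (stdVec L i) j := by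
  have he := eps_mul_self L (l := [i, j]) (by simp [*])
  have hlen := length_add_length_omitted (l := [i, j]) (by simp [*])
  simp only [List.length_cons, List.length_nil] at hlen
  obtain ⟨c, k, hck⟩ : ∃ c k, omitted [i, j] = c ++ [k] := by
    rcases List.eq_nil_or_concat (omitted [i, j]) with h0 | ⟨c, k, h0⟩
    · rw [h0] at hlen; simp at hlen
    · exact ⟨c, k, by rw [h0, List.concat_eq_append]⟩
  have hc : c.length = m := by rw [hck] at hlen; simp at hlen; omega
  have hk : k ∈ omitted [i, j] := by rw [hck]; simp
  have hik : i ≠ k := by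
    rintro rfl
    rw [mem_omitted] at hk
    simp at hk
  have hs : ∀ s, s = i ∨ s = j ∨ s = k ∨ s ∈ c := fun s => by
    have : s ∈ [i, j] ∨ s ∈ c ++ [k] := by rw [← hck, mem_omitted]; tauto
    simp only [List.mem_cons, List.mem_append, List.not_mem_nil, or_false] at this
    tauto
  have e := eps_cast (L := L) [i, j]
  have e1 : [i, i] ++ omitted [i, j] ++ [i] = [i, i] ++ c ++ [k, i] := by rw [hck]; simp
  rw [map_mul, map_intCast, e1, h.brace_ii_ki hc hik hs]
  rw [hck] at e
  simp only [List.cons_append, List.nil_append] at e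
  rw [← e]
  linear_combination (β (stdVec L i) (stdVec L i) j) * he

lemma row_three (h : F.IsProductOf β) (hij : i ≠ j) (hik : i ≠ k) (hjk : j ≠ k) :
    algebraMap K L ((-1) ^ (m + 4) * (eps [i, j, k] : K) *
      F.brace ([i, i] ++ omitted [i, j, k] ++ [j, k])) =
      β (stdVec L i) (stdVec L j) j - β (stdVec L i) (stdVec L k) k := by
  have he := eps_mul_self L (l := [i, j, k]) (by simp [*])
  rw [map_mul, map_mul, map_intCast, h.brace_ii_jk (length_omitted_three hij hik hjk) hjk
    mem_three_or_omitted]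
  have e := eps_cast (L := L) [i, j, k]
  simp only [List.cons_append, List.nil_append] at e
  rw [← e, map_pow, map_neg, map_one]
  have h2 : ((-1) ^ (m + 4) : L) * (-1) ^ m = 1 := by
    rw [← pow_add, show m + 4 + m = 2 * (m + 2) by ring, pow_mul]; simp
  linear_combination (β (stdVec L i) (stdVec L j) j - β (stdVec L i) (stdVec L k) k) *
    ((eps [i, j, k] : L) * (eps [i, j, k] : L)) * h2 +
    (β (stdVec L i) (stdVec L j) j - β (stdVec L i) (stdVec L k) k) * he

lemma row_four (h : F.IsProductOf β) (hij : i ≠ j) (hik : i ≠ k) (hjk : j ≠ k) :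
    algebraMap K L ((-1) ^ ((m + 4) + 1) * (eps [i, j, k] : K) *
      F.brace ([i, j] ++ omitted [i, j, k] ++ [k, i])) =
      β (stdVec L i) (stdVec L i) i - β (stdVec L i) (stdVec L j) j -
        β (stdVec L i) (stdVec L k) k := by
  have he := eps_mul_self L (l := [i, j, k]) (by simp [*])
  rw [map_mul, map_mul, map_intCast, h.brace_ij_ki (length_omitted_three hij hik hjk) hij hik
    mem_three_or_omitted]
  have e := eps_cast (L := L) [i, j, k]
  simp only [List.cons_append, List.nil_append] at e
  rw [← e, map_pow, map_neg, map_one]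
  have h2 : ((-1) ^ ((m + 4) + 1) : L) * (-1) ^ (m + 1) = 1 := by
    rw [← pow_add, show m + 4 + 1 + (m + 1) = 2 * (m + 3) by ring, pow_mul]; simp
  linear_combination (β (stdVec L i) (stdVec L i) i - β (stdVec L i) (stdVec L j) j -
        β (stdVec L i) (stdVec L k) k) *
    ((eps [i, j, k] : L) * (eps [i, j, k] : L)) * h2 +
    (β (stdVec L i) (stdVec L i) i - β (stdVec L i) (stdVec L j) j -
        β (stdVec L i) (stdVec L k) k) * he

end IsProductOf

end MinFreeRes

section FourPoints

open MinFreeRes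

variable {K : Type*} [Field K] {I : Ideal (MvPolynomial (Fin (0 + 3)) K)}
  {F : MinFreeRes I} {L : Type*} [Field L] [Algebra K L]
  {β : (Fin (0 + 3) → L) →ₗ[L] (Fin (0 + 3) → L) →ₗ[L] (Fin (0 + 3) → L)}
  {i j k : Fin (0 + 3)}

/-- Without linear matrices, a brace is symmetric in its last two indices, and the braces with
left and right interchanged are covered by the general ones. -/
lemma rows_four_points (h : F.IsProductOf β) (hij : i ≠ j) (hik : i ≠ k) (hjk : j ≠ k) :
    algebraMap K L ((eps [i, j, k] : K) * F.brace [j, j, i, i]) = β (stdVec L i) (stdVec L j) k ∧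
    algebraMap K L ((eps [i, j, k] : K) * F.brace [i, i, i, k]) = β (stdVec L i) (stdVec L i) j ∧
    algebraMap K L ((eps [i, j, k] : K) * F.brace [i, i, j, k]) =
      β (stdVec L i) (stdVec L j) j - β (stdVec L i) (stdVec L k) k ∧
    algebraMap K L ((eps [i, j, k] : K) * F.brace [i, k, i, j]) =
      β (stdVec L i) (stdVec L i) i - β (stdVec L i) (stdVec L j) j -
        β (stdVec L i) (stdVec L k) k := by
  have he := eps_mul_self L (l := [i, j, k]) (by simp [*])
  have e := eps_cast (L := L) [i, j, k]
  have hom : omitted [i, j, k] = [] :=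
    List.length_eq_zero_iff.1 (IsProductOf.length_omitted_three hij hik hjk)
  rw [hom, List.append_nil] at e
  have hs : ∀ s, s = i ∨ s = j ∨ s = k ∨ s ∈ ([] : List (Fin (0 + 3))) := fun s =>
    hom ▸ IsProductOf.mem_three_or_omitted s
  have hs' : ∀ s, s = j ∨ s = i ∨ s = k ∨ s ∈ ([] : List (Fin (0 + 3))) := fun s => by
    have := hs s; tauto
  have hs'' : ∀ s, s = i ∨ s = k ∨ s = j ∨ s ∈ ([] : List (Fin (0 + 3))) := fun s => by
    have := hs s; tauto
  have hcomm : ∀ a b d e : Fin (0 + 3), algebraMap K L (F.brace [a, b, d, e]) =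
      algebraMap K L (F.brace [a, b, e, d]) := fun a b d e => by
    have h1 := algebraMap_brace (L := L) h.ends a b d e (c := []) rfl
    have h2 := algebraMap_brace (L := L) h.ends a b e d (c := []) rfl
    rw [quadCoeff_comm _ e d, ← h1] at h2
    exact h2.symm
  have b1 := h.brace_ii_jj (c := []) rfl hs'
  have b2 := h.brace_ii_ki (c := []) rfl hik hs
  have b3 := h.brace_ii_jk (c := []) rfl hjk hs
  have b4 := h.brace_ij_ki (c := []) rfl hik hij hs''
  simp only [List.cons_append, List.nil_append, List.append_nil] at b1 b2 b3 b4
  rw [signDet_swap_fst j i k, ← e, h.symm (stdVec L j)] at b1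
  rw [← e] at b2 b3
  rw [signDet_swap_snd i k j, ← e] at b4
  refine ⟨?_, ?_, ?_, ?_⟩
  · rw [map_mul, map_intCast, b1]
    linear_combination (β (stdVec L i) (stdVec L j) k) * he
  · rw [map_mul, map_intCast, hcomm, b2]
    linear_combination (β (stdVec L i) (stdVec L i) j) * he
  · rw [map_mul, map_intCast, b3]
    linear_combination (β (stdVec L i) (stdVec L j) j - β (stdVec L i) (stdVec L k) k) * he
  · rw [map_mul, map_intCast, hcomm, b4]
    linear_combination (β (stdVec L i) (stdVec L i) i - β (stdVec L i) (stdVec L j) j -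
        β (stdVec L i) (stdVec L k) k) * he

end FourPoints

section FivePoints

open MinFreeRes

variable {K : Type*} [Field K] {I : Ideal (MvPolynomial (Fin (1 + 3)) K)}
  {F : MinFreeRes I} {L : Type*} [Field L] [Algebra K L]
  {β : (Fin (1 + 3) → L) →ₗ[L] (Fin (1 + 3) → L) →ₗ[L] (Fin (1 + 3) → L)}
  {i j k l : Fin (1 + 3)}

/-- With one linear matrix, the mirror images of the general braces and the brace with the
repeated index in the middle give the same constants. -/
lemma rows_five_points (h : F.IsProductOf β) (hij : i ≠ j) (hik : i ≠ k) (hjk : j ≠ k)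
    (hli : l ≠ i) (hlj : l ≠ j) (hlk : l ≠ k) :
    algebraMap K L ((eps [i, j, k, l] : K) * F.brace [i, i, l, j, j]) =
      β (stdVec L i) (stdVec L j) k ∧
    algebraMap K L ((eps [i, j, k, l] : K) * F.brace [l, i, i, i, k]) =
      β (stdVec L i) (stdVec L i) j ∧
    algebraMap K L ((eps [i, j, k, l] : K) * F.brace [j, k, l, i, i]) =
      β (stdVec L i) (stdVec L j) j - β (stdVec L i) (stdVec L k) k ∧
    algebraMap K L ((eps [i, j, k, l] : K) * F.brace [i, j, l, k, i]) =
      β (stdVec L i) (stdVec L i) i - β (stdVec L i) (stdVec L j) j -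
        β (stdVec L i) (stdVec L k) k := by
  have hnd : [i, j, k, l].Nodup := by simp [hij, hik, hjk, hli.symm, hlj.symm, hlk.symm]
  have he := eps_mul_self L hnd
  have e := eps_cast (L := L) [i, j, k, l]
  have hom : omitted [i, j, k, l] = [] := by
    have := length_add_length_omitted hnd
    simpa using this
  rw [hom, List.append_nil] at e
  have hs : ∀ s, s = i ∨ s = j ∨ s = k ∨ s ∈ [l] := fun s => by
    have : s ∈ [i, j, k, l] := by
      by_contra h1
      have h2 := mem_omitted.2 h1
      rw [hom] at h2
      simp at h2
    simpa using this
  have b1 := h.brace_ii_jj (c := [l]) rfl hs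
  have b2 := h.brace_li_ik (c := [i]) (j := j) rfl hli hik (by simp) (fun s hsj => by
    have := hs s
    simp only [List.mem_cons, List.mem_append, List.not_mem_nil, or_false] at this ⊢
    tauto)
  have b3 := h.brace_jk_ii (c := [l]) rfl hjk hs
  have b4 := h.brace_ij_ki (c := [l]) rfl hij hik hs
  simp only [List.cons_append, List.nil_append] at b1 b2 b3 b4
  rw [← e] at b1 b3 b4
  have s1 : signDet L [j, l, i, k] = -signDet L [i, j, k, l] := by
    rw [signDet_swap_snd j l i [k], signDet_swap_fst j i l [k],
      show signDet L [i, j, l, k] = -signDet L [i, j, k, l] from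
        signDet_swap [i, j] [] l k (by simp)]
    ring
  rw [s1, ← e] at b2
  refine ⟨?_, ?_, ?_, ?_⟩
  · rw [map_mul, map_intCast, b1]
    linear_combination (β (stdVec L i) (stdVec L j) k) * he
  · rw [map_mul, map_intCast, b2]
    linear_combination (β (stdVec L i) (stdVec L i) j) * he
  · rw [map_mul, map_intCast, b3]
    linear_combination (β (stdVec L i) (stdVec L j) j - β (stdVec L i) (stdVec L k) k) * he
  · rw [map_mul, map_intCast, b4]
    linear_combination (β (stdVec L i) (stdVec L i) i - β (stdVec L i) (stdVec L j) j -
        β (stdVec L i) (stdVec L k) k) * he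

end FivePoints

/-! ### Descent to the base field -/

section Descent

namespace MinFreeRes

variable {K : Type*} [Field K] {m : ℕ} {I : Ideal (MvPolynomial (Fin (m + 3)) K)}
  {F : MinFreeRes I} {L : Type*} [Field L] [Algebra K L]

namespace IsProductOf

variable {β : (Fin (m + 3) → L) →ₗ[L] (Fin (m + 3) → L) →ₗ[L] (Fin (m + 3) → L)}

/-- Descent to the base field of identities between second derivatives and constants. -/
lemma eq_C_of_map_eq {f : MvPolynomial (Fin (m + 3)) K} {c : K}
    (h : MvPolynomial.map (algebraMap K L) f = C (algebraMap K L c)) : f = C c :=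
  MvPolynomial.map_injective _ (algebraMap K L).injective (by rw [h, map_C])

/-- In each combination the traces cancel, and the coordinates of `β` that remain are those given
by a brace. -/
lemma pderiv_pderiv_Omega_rows (h : F.IsProductOf β) {i j k : Fin (m + 3)} (hij : i ≠ j)
    (hik : i ≠ k) (hjk : j ≠ k) :
    pderiv i (pderiv j (F.Omega k)) =
      C ((-1) ^ ((m + 4) + 1) * (eps [i, j, k] : K) * (2 * ((m + 4 : ℕ) : K)) *
        F.brace ([i, i] ++ omitted [i, j, k] ++ [j, j])) ∧
    pderiv i (pderiv i (F.Omega j)) =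
      C ((eps [i, j] : K) * (2 * ((m + 4 : ℕ) : K)) *
        F.brace ([i, i] ++ omitted [i, j] ++ [i])) ∧
    pderiv i (pderiv j (F.Omega j)) - pderiv i (pderiv k (F.Omega k)) =
      C ((-1) ^ (m + 4) * (eps [i, j, k] : K) * (2 * ((m + 4 : ℕ) : K)) *
        F.brace ([i, i] ++ omitted [i, j, k] ++ [j, k])) ∧
    pderiv i (pderiv i (F.Omega i)) - pderiv i (pderiv j (F.Omega j)) -
        pderiv i (pderiv k (F.Omega k)) =
      C ((-1) ^ ((m + 4) + 1) * (eps [i, j, k] : K) * (2 * ((m + 4 : ℕ) : K)) *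
        F.brace ([i, j] ++ omitted [i, j, k] ++ [k, i])) := by
  have hn : algebraMap K L (2 * ((m + 4 : ℕ) : K)) = 2 * ((m + 4 : ℕ) : L) := by
    rw [map_mul, map_ofNat, map_natCast]
  refine ⟨eq_C_of_map_eq (L := L) ?_, eq_C_of_map_eq (L := L) ?_, eq_C_of_map_eq (L := L) ?_,
    eq_C_of_map_eq (L := L) ?_⟩
  · rw [mul_right_comm, map_mul, h.row_one hij hik hjk, hn, h.map_pderiv_pderiv_Omega, if_neg hjk,
      if_neg hik]
    congr 1
    ring
  · rw [mul_right_comm, map_mul, h.row_two hij, hn, h.map_pderiv_pderiv_Omega, if_neg hij]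
    congr 1
    ring
  · rw [mul_right_comm, map_mul, h.row_three hij hik hjk, hn, map_sub, h.map_pderiv_pderiv_Omega,
      h.map_pderiv_pderiv_Omega, if_neg hij, if_neg hik, if_pos rfl, if_pos rfl, ← C_sub]
    congr 1
    ring
  · rw [mul_right_comm, map_mul, h.row_four hij hik hjk, hn, map_sub, map_sub,
      h.map_pderiv_pderiv_Omega, h.map_pderiv_pderiv_Omega, h.map_pderiv_pderiv_Omega,
      if_neg hij, if_neg hik, if_pos rfl, if_pos rfl, if_pos rfl, ← C_sub, ← C_sub]
    congr 1
    ring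

lemma algebraMap_structConst (h : F.IsProductOf β) (i j k : Fin (m + 3)) :
    algebraMap K L (F.structConst i j k) = (2 * ((m + 4 : ℕ) : L))⁻¹ *
      (2 * ((m + 4 : ℕ) : L) * β (stdVec L i) (stdVec L j) k -
        2 * (if j = k then ∑ s, β (stdVec L i) (stdVec L s) s else 0) -
        2 * (if i = k then ∑ s, β (stdVec L j) (stdVec L s) s else 0)) := by
  have h1 := congrArg constantCoeff (h.map_pderiv_pderiv_Omega i j k)
  rw [constantCoeff_map, constantCoeff_C] at h1
  rw [structConst, map_mul, map_inv₀, h1, map_mul, map_ofNat, map_natCast]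

lemma structConst_rows (h : F.IsProductOf β) (hn : 2 * ((m + 4 : ℕ) : K) ≠ 0)
    {i j k : Fin (m + 3)} (hij : i ≠ j) (hik : i ≠ k) (hjk : j ≠ k) :
    algebraMap K L (F.structConst i j k) = β (stdVec L i) (stdVec L j) k ∧
    algebraMap K L (F.structConst i i j) = β (stdVec L i) (stdVec L i) j ∧
    algebraMap K L (F.structConst i j j - F.structConst i k k) =
      β (stdVec L i) (stdVec L j) j - β (stdVec L i) (stdVec L k) k ∧
    algebraMap K L (F.structConst i i i - F.structConst i j j - F.structConst i k k) =
      β (stdVec L i) (stdVec L i) i - β (stdVec L i) (stdVec L j) j -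
        β (stdVec L i) (stdVec L k) k := by
  have hn' : 2 * ((m + 4 : ℕ) : L) ≠ 0 := by
    have := (map_ne_zero (algebraMap K L)).2 hn
    rwa [map_mul, map_ofNat, map_natCast] at this
  simp only [map_sub, h.algebraMap_structConst, if_neg hij, if_neg hik, if_neg hjk, if_true]
  have hinv : (2 * ((m + 4 : ℕ) : L))⁻¹ * (2 * ((m + 4 : ℕ) : L)) = 1 := inv_mul_cancel₀ hn'
  refine ⟨?_, ?_, ?_, ?_⟩
  · linear_combination β (stdVec L i) (stdVec L j) k * hinv
  · linear_combination β (stdVec L i) (stdVec L i) j * hinv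
  · linear_combination
      (β (stdVec L i) (stdVec L j) j - β (stdVec L i) (stdVec L k) k) * hinv
  · linear_combination (β (stdVec L i) (stdVec L i) i - β (stdVec L i) (stdVec L j) j -
        β (stdVec L i) (stdVec L k) k) * hinv

end IsProductOf

end MinFreeRes

end Descent

/-! ### Integral structure constants -/

section Integrality

variable {K : Type*} [Field K]

lemma mul_apply_mem {p q r : ℕ} {S : Subring K} {M : Matrix (Fin p) (Fin q) K}
    {N : Matrix (Fin q) (Fin r) K} (hM : ∀ s t, M s t ∈ S) (hN : ∀ s t, N s t ∈ S) (s : Fin p)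
    (t : Fin r) : (M * N) s t ∈ S := by
  rw [Matrix.mul_apply]
  exact S.sum_mem fun u _ => S.mul_mem (hM s u) (hN u t)

lemma pathProd_apply_mem {V : Type*} {ρ : ℕ → ℕ} {S : Subring K}
    {D : ∀ k, V → Matrix (Fin (ρ k)) (Fin (ρ (k + 1))) K} (hD : ∀ k v s t, D k v s t ∈ S) (t : ℕ)
    (a : Fin t → V) : ∀ r s, pathProd D t a r s ∈ S := by
  induction t with
  | zero =>
    intro r s
    rw [pathProd, Matrix.one_apply]
    split_ifs
    · exact S.one_mem
    · exact S.zero_mem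
  | succ t ih => exact mul_apply_mem (ih _) (hD _ _)

lemma MinFreeRes.brace_mem {m : ℕ} {I : Ideal (MvPolynomial (Fin (m + 3)) K)} (F : MinFreeRes I)
    {S : Subring K} (hS : ∀ k r s e, coeff e (F.φ k r s) ∈ S) (l : List (Fin (m + 3))) :
    F.brace l ∈ S := by
  classical
  rw [brace, entry]
  refine S.sum_mem fun r _ => S.sum_mem fun s _ => ?_
  refine mul_apply_mem (mul_apply_mem (fun s t => hS _ _ _ _)
    (pathProd_apply_mem (ρ := fun k => F.rank (k + 1)) (fun k i s t => ?_) m _))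
    (fun s t => hS _ _ _ _) r s
  have h1 : ∀ (i : Fin (m + 3)) (f : MvPolynomial (Fin (m + 3)) K),
      constantCoeff (pderiv i f) = coeff (Finsupp.single i 1) f := fun i f => by
    rw [constantCoeff_eq, coeff_pderiv]
    simp
  rw [Matrix.map_apply, h1]
  exact hS _ _ _ _

variable {ι A : Type*} [Fintype ι] [DecidableEq ι] [CommRing A] [Algebra K A]

/-- If, after subtracting suitable constants `t i` from the basis elements, the structure
constants at the new basis elements lie in a subring `S`, then so do the constant terms of the
products, because of associativity. Hence the new basis spans an `S`-subalgebra. -/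
theorem exists_subalgebra_of_mem (S : Subring K) (b : Module.Basis (Option ι) K A)
    (hb : b none = 1) (c : ι → ι → ι → K) (c₀ : ι → ι → K)
    (hmul : ∀ i j, b (some i) * b (some j) = algebraMap K A (c₀ i j) + ∑ k, c i j k • b (some k))
    (t : ι → K)
    (hS : ∀ i j k, c i j k - (if j = k then t i else 0) - (if i = k then t j else 0) ∈ S)
    (hne : ∀ i : ι, ∃ k, k ≠ i) :
    ∃ B : Subalgebra S A, Subalgebra.toSubmodule B =
      Submodule.span S (insert 1 (Set.range fun i => b (some i) - algebraMap K A (t i))) := by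
  set g : ι → ι → ι → K := fun i j k =>
    c i j k - (if j = k then t i else 0) - (if i = k then t j else 0) with hg
  set β : ι → A := fun i => b (some i) - algebraMap K A (t i) with hβ
  have hone : ∀ x : K, algebraMap K A x = x • (1 : A) := fun x => Algebra.algebraMap_eq_smul_one x
  let d : ι → ι → K := fun i j => c₀ i j - t i * t j + ∑ k, c i j k * t k
  have hprod : ∀ i j, β i * β j = d i j • 1 + ∑ k, g i j k • β k := by
    intro i j
    have e1 : ∑ k, g i j k • β k = (∑ k, c i j k • b (some k)) - (∑ k, c i j k * t k) • (1 : A) -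
        t i • β j - t j • β i := by
      simp only [hg, sub_smul, Finset.sum_sub_distrib, ite_smul, zero_smul,
        Finset.sum_ite_eq, Finset.mem_univ, if_true]
      congr 2
      simp only [hβ, smul_sub, Finset.sum_sub_distrib, hone, smul_smul, ← Finset.sum_smul]
    have e2 : β i * β j = b (some i) * b (some j) - t i • b (some j) - t j • b (some i) +
        (t i * t j) • (1 : A) := by
      simp only [hβ, Algebra.smul_def, map_mul]
      ring
    rw [e1, e2, hmul]
    simp only [hβ, d, hone, smul_sub, smul_smul]
    module
  -- the coordinate functionals of the new basis
  let ℓ : ι → A →ₗ[K] K := fun k => b.coord (some k)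
  have hℓ1 : ∀ k, ℓ k 1 = 0 := fun k => by
    rw [← hb]; simp [ℓ]
  have hℓβ : ∀ k i, ℓ k (β i) = if i = k then 1 else 0 := fun k i => by
    simp only [hβ, map_sub, hone, map_smul, hℓ1, smul_zero, sub_zero]
    simp [ℓ, Finsupp.single_apply]
  -- compare the coefficients of `β k` in `(β i * β j) * β k = β i * (β j * β k)`: for `k ≠ i` the
  -- constant term of `β i * β j` occurs on the left, and no constant term on the right
  have hd : ∀ i j, d i j ∈ S := by
    intro i j
    obtain ⟨k, hk⟩ := hne i
    have hℓmul : ∀ i j, ℓ k (β i * β j) = g i j k := fun i j => by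
      rw [hprod, map_add, map_smul, hℓ1, smul_zero, zero_add, map_sum]
      simp [hℓβ]
    have e1 : ℓ k (β i * β j * β k) = d i j + ∑ l, g i j l * g l k k := by
      rw [hprod, add_mul, smul_mul_assoc, one_mul, map_add, map_smul, hℓβ, if_pos rfl,
        Finset.sum_mul, map_sum, smul_eq_mul, mul_one]
      congr 1
      exact Finset.sum_congr rfl fun l _ => by rw [smul_mul_assoc, map_smul, hℓmul, smul_eq_mul]
    have e2 : ℓ k (β i * (β j * β k)) = ∑ l, g j k l * g i l k := by
      rw [hprod, mul_add, mul_smul_comm, mul_one, map_add, map_smul, hℓβ, if_neg hk.symm,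
        smul_zero, zero_add, Finset.mul_sum, map_sum]
      exact Finset.sum_congr rfl fun l _ => by rw [mul_smul_comm, map_smul, hℓmul, smul_eq_mul]
    rw [mul_assoc, e2] at e1
    rw [← sub_eq_iff_eq_add.2 e1]
    exact S.sub_mem (S.sum_mem fun l _ => S.mul_mem (hS _ _ _) (hS _ _ _))
      (S.sum_mem fun l _ => S.mul_mem (hS _ _ _) (hS _ _ _))
  set P := Submodule.span S (insert 1 (Set.range β)) with hP
  have h1 : (1 : A) ∈ P := Submodule.subset_span (Set.mem_insert _ _)
  have hβP : ∀ i, β i ∈ P := fun i => Submodule.subset_span (Set.mem_insert_of_mem _ ⟨i, rfl⟩)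
  have hsm : ∀ (x : K) (y : A), x ∈ S → y ∈ P → x • y ∈ P := fun x y hx hy =>
    P.smul_mem (⟨x, hx⟩ : S) hy
  have hββ : ∀ i j, β i * β j ∈ P := fun i j => by
    rw [hprod]
    exact P.add_mem (hsm _ _ (hd i j) h1) (P.sum_mem fun k _ => hsm _ _ (hS i j k) (hβP k))
  refine ⟨P.toSubalgebra h1 fun x y hx hy => ?_, Submodule.toSubalgebra_toSubmodule _ _ _⟩
  induction hx, hy using Submodule.span_induction₂ with
  | mem_mem x y hx hy =>
    rcases hx with rfl | ⟨i, rfl⟩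
    · rw [one_mul]; exact Submodule.subset_span hy
    · rcases hy with rfl | ⟨j, rfl⟩
      · rw [mul_one]; exact hβP i
      · exact hββ i j
  | zero_left y _ => rw [zero_mul]; exact P.zero_mem
  | zero_right x _ => rw [mul_zero]; exact P.zero_mem
  | add_left x y z _ _ _ h1 h2 => rw [add_mul]; exact P.add_mem h1 h2
  | add_right x y z _ _ _ h1 h2 => rw [mul_add]; exact P.add_mem h1 h2
  | smul_left r x y _ _ h => rw [smul_mul_assoc]; exact P.smul_mem r h
  | smul_right r x y _ _ h => rw [mul_smul_comm]; exact P.smul_mem r h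

/-- A table of structure constants whose entries of the four kinds lie in `S` defines an
`S`-subalgebra. -/
theorem exists_subalgebra_of_rows {m : ℕ} (S : Subring K)
    (b : Module.Basis (Option (Fin (m + 3))) K A)
    (hb : b none = 1) (c : Fin (m + 3) → Fin (m + 3) → Fin (m + 3) → K)
    (c₀ : Fin (m + 3) → Fin (m + 3) → K)
    (hmul : ∀ i j, b (some i) * b (some j) = algebraMap K A (c₀ i j) + ∑ k, c i j k • b (some k))
    (hc : ∀ i j k, i ≠ j → i ≠ k → j ≠ k → c i j k ∈ S ∧ c i i j ∈ S ∧ c i j j - c i k k ∈ S ∧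
      c i i i - c i j j - c i k k ∈ S)
    (ν : Fin (m + 3) → Fin (m + 3)) (hν : ∀ i, ν i ≠ i) :
    ∃ B : Subalgebra S A, Subalgebra.toSubmodule B =
      Submodule.span S (insert 1 (Set.range fun i =>
        b (some i) - algebraMap K A (c i (ν i) (ν i)))) := by
  -- there are at least three indices, since `n ≥ 4`
  have hthird : ∀ i j : Fin (m + 3), ∃ k, k ≠ i ∧ k ≠ j := fun i j => by
    obtain ⟨k, -, hk⟩ := Finset.exists_mem_notMem_of_card_lt_card
      (s := ({i, j} : Finset (Fin (m + 3)))) (t := Finset.univ)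
      (lt_of_le_of_lt Finset.card_le_two (by simp))
    simp only [Finset.mem_insert, Finset.mem_singleton, not_or] at hk
    exact ⟨k, hk⟩
  have hsymm : ∀ i j k, c i j k = c j i k := fun i j k => by
    have h1 : ∀ i j, b.coord (some k) (b (some i) * b (some j)) = c i j k := fun i j => by
      have h2 : b.coord (some k) (1 : A) = 0 := by rw [← hb]; simp
      rw [hmul, map_add, Algebra.algebraMap_eq_smul_one, map_smul, h2, smul_zero, zero_add, map_sum]
      simp [Finsupp.single_apply]
    rw [← h1 i j, mul_comm, h1]
  have hdiag : ∀ i j k, j ≠ i → k ≠ i → c i j j - c i k k ∈ S := fun i j k hj hk => by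
    by_cases hjk : j = k
    · rw [hjk, sub_self]; exact S.zero_mem
    · exact (hc i j k hj.symm hk.symm hjk).2.2.1
  refine exists_subalgebra_of_mem S b hb c c₀ hmul (fun i => c i (ν i) (ν i)) (fun i j k => ?_)
    fun i => ⟨ν i, hν i⟩
  by_cases hjk : j = k
  · subst hjk
    by_cases hij : i = j
    · subst hij
      rw [if_pos rfl]
      obtain ⟨k, hki, hkν⟩ := hthird i (ν i)
      have h1 := (hc i (ν i) k (hν i).symm hki.symm hkν.symm).2.2.2
      have h2 := hdiag i k (ν i) hki (hν i)
      have := S.add_mem h1 h2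
      convert this using 1
      ring
    · rw [if_pos rfl, if_neg hij, sub_zero]
      exact hdiag i j (ν i) (Ne.symm hij) (hν i)
  · rw [if_neg hjk, sub_zero]
    by_cases hik : i = k
    · subst hik
      rw [if_pos rfl, hsymm]
      exact hdiag j i (ν j) (Ne.symm hjk) (hν j)
    · rw [if_neg hik, sub_zero]
      by_cases hij : i = j
      · subst hij
        obtain ⟨l, hli, hlk⟩ := hthird i k
        exact (hc i k l hik hli.symm hlk.symm).2.1
      · exact (hc i j k hij hik hjk).1

end Integrality

end PointsResolution

end

theorem mainTheorem3 {K : Type*} [Field K] (m : ℕ)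
    (X : Finset (ℙ (AlgebraicClosure K) (Fin (m + 3) → AlgebraicClosure K)))
    (hX : PointsResolution.IsGeneralPosition K X)
    (F : PointsResolution.MinFreeRes (PointsResolution.homIdeal K X)) :
    -- `F_0` and `F_{n-2}` have rank one, the complex ends there, and the differentials consist
    -- of quadratic forms at the two ends and of linear forms in between.
    (F.rank 0 = 1 ∧ F.rank (m + 2) = 1 ∧ (∀ k, m + 2 < k → F.rank k = 0) ∧
      (∀ r s, (F.φ 0 r s).IsHomogeneous 2) ∧ (∀ r s, (F.φ (m + 1) r s).IsHomogeneous 2) ∧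
      (∀ k, 1 ≤ k → k ≤ m → ∀ r s, (F.φ k r s).IsHomogeneous 1)) ∧
    -- The identities with explicit signs, over every field.
    (∀ i j k : Fin (m + 3), i ≠ j → i ≠ k → j ≠ k →
      pderiv i (pderiv j (F.Omega k)) =
        C ((-1) ^ ((m + 4) + 1) * (PointsResolution.eps [i, j, k] : K) * (2 * ((m + 4 : ℕ) : K)) *
          F.brace ([i, i] ++ PointsResolution.omitted [i, j, k] ++ [j, j])) ∧
      pderiv i (pderiv i (F.Omega j)) =
        C ((PointsResolution.eps [i, j] : K) * (2 * ((m + 4 : ℕ) : K)) *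
          F.brace ([i, i] ++ PointsResolution.omitted [i, j] ++ [i])) ∧
      pderiv i (pderiv j (F.Omega j)) - pderiv i (pderiv k (F.Omega k)) =
        C ((-1) ^ (m + 4) * (PointsResolution.eps [i, j, k] : K) * (2 * ((m + 4 : ℕ) : K)) *
          F.brace ([i, i] ++ PointsResolution.omitted [i, j, k] ++ [j, k])) ∧
      pderiv i (pderiv i (F.Omega i)) - pderiv i (pderiv j (F.Omega j)) -
          pderiv i (pderiv k (F.Omega k)) =
        C ((-1) ^ ((m + 4) + 1) * (PointsResolution.eps [i, j, k] : K) * (2 * ((m + 4 : ℕ) : K)) *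
          F.brace ([i, j] ++ PointsResolution.omitted [i, j, k] ++ [k, i]))) ∧
    -- If `2n` is invertible, the constants `c^k_{ij}` satisfy the linear system of the table.
    (2 * ((m + 4 : ℕ) : K) ≠ 0 →
      -- all `n ≥ 4`
      (∀ i j k : Fin (m + 3), i ≠ j → i ≠ k → j ≠ k →
        F.structConst i j k = (-1) ^ ((m + 4) + 1) * (PointsResolution.eps [i, j, k] : K) *
          F.brace ([i, i] ++ PointsResolution.omitted [i, j, k] ++ [j, j]) ∧
        F.structConst i i j = (PointsResolution.eps [i, j] : K) *
          F.brace ([i, i] ++ PointsResolution.omitted [i, j] ++ [i]) ∧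
        F.structConst i j j - F.structConst i k k =
          (-1) ^ (m + 4) * (PointsResolution.eps [i, j, k] : K) *
          F.brace ([i, i] ++ PointsResolution.omitted [i, j, k] ++ [j, k]) ∧
        F.structConst i i i - F.structConst i j j - F.structConst i k k =
          (-1) ^ ((m + 4) + 1) * (PointsResolution.eps [i, j, k] : K) *
          F.brace ([i, j] ++ PointsResolution.omitted [i, j, k] ++ [k, i])) ∧
      -- `n = 4`
      (m = 0 → ∀ i j k : Fin (m + 3), i ≠ j → i ≠ k → j ≠ k →
        F.structConst i j k = (PointsResolution.eps [i, j, k] : K) * F.brace [j, j, i, i] ∧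
        F.structConst i i j = (PointsResolution.eps [i, j, k] : K) * F.brace [i, i, i, k] ∧
        F.structConst i j j - F.structConst i k k =
          (PointsResolution.eps [i, j, k] : K) * F.brace [i, i, j, k] ∧
        F.structConst i i i - F.structConst i j j - F.structConst i k k =
          (PointsResolution.eps [i, j, k] : K) * F.brace [i, k, i, j]) ∧
      -- `n = 5`
      (m = 1 → ∀ i j k l : Fin (m + 3), i ≠ j → i ≠ k → j ≠ k → l ≠ i → l ≠ j → l ≠ k →
        F.structConst i j k = (PointsResolution.eps [i, j, k, l] : K) * F.brace [i, i, l, j, j] ∧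
        F.structConst i i j = (PointsResolution.eps [i, j, k, l] : K) * F.brace [l, i, i, i, k] ∧
        F.structConst i j j - F.structConst i k k =
          (PointsResolution.eps [i, j, k, l] : K) * F.brace [j, k, l, i, i] ∧
        F.structConst i i i - F.structConst i j j - F.structConst i k k =
          (PointsResolution.eps [i, j, k, l] : K) * F.brace [i, j, l, k, i]) ∧
      -- Orders: if the resolution has coefficients in a subring `S` of `K` (for instance `ℤ` in
      -- `ℚ`), then in every `K`-algebra with basis `1, α_1, …, α_{n-1}` and structure constants
      -- `c^k_{ij}`, the shear `β_1, …, β_{n-1}` of this basis for which the structure constants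
      -- with indices `i, ν(i); ν(i)` are zero spans together with `1` an `S`-subalgebra.
      (∀ S : Subring K, (∀ k r s e, coeff e (F.φ k r s) ∈ S) →
        ∀ (A : Type*) [CommRing A] [Algebra K A] (b : Module.Basis (Option (Fin (m + 3))) K A)
          (c₀ : Fin (m + 3) → Fin (m + 3) → K), b none = 1 →
          (∀ i j, b (some i) * b (some j) =
            algebraMap K A (c₀ i j) + ∑ k, F.structConst i j k • b (some k)) →
          ∀ ν : Fin (m + 3) → Fin (m + 3), (∀ i, ν i ≠ i) →
            ∃ B : Subalgebra S A, Subalgebra.toSubmodule B =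
              Submodule.span S (insert 1 (Set.range fun i =>
                b (some i) - algebraMap K A (F.structConst i (ν i) (ν i)))))) := by
  obtain ⟨hshape, b, hb0, hb1⟩ := F.shape hX
  refine ⟨hshape, ?_⟩
  obtain ⟨-, -, -, h0, h1, hm⟩ := hshape
  obtain ⟨β, h⟩ := PointsResolution.MinFreeRes.exists_isProductOf ⟨h0, h1, hm⟩ b hb0 hb1
  have hinj := (algebraMap K (AlgebraicClosure K)).injective
  refine ⟨fun i j k hij hik hjk => h.pderiv_pderiv_Omega_rows hij hik hjk, fun hn => ?_⟩
  have hrows : ∀ i j k : Fin (m + 3), i ≠ j → i ≠ k → j ≠ k →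
      F.structConst i j k = (-1) ^ ((m + 4) + 1) * (PointsResolution.eps [i, j, k] : K) *
        F.brace ([i, i] ++ PointsResolution.omitted [i, j, k] ++ [j, j]) ∧
      F.structConst i i j = (PointsResolution.eps [i, j] : K) *
        F.brace ([i, i] ++ PointsResolution.omitted [i, j] ++ [i]) ∧
      F.structConst i j j - F.structConst i k k =
        (-1) ^ (m + 4) * (PointsResolution.eps [i, j, k] : K) *
        F.brace ([i, i] ++ PointsResolution.omitted [i, j, k] ++ [j, k]) ∧
      F.structConst i i i - F.structConst i j j - F.structConst i k k =
        (-1) ^ ((m + 4) + 1) * (PointsResolution.eps [i, j, k] : K) *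
        F.brace ([i, j] ++ PointsResolution.omitted [i, j, k] ++ [k, i]) := by
    intro i j k hij hik hjk
    obtain ⟨e1, e2, e3, e4⟩ := h.structConst_rows hn hij hik hjk
    exact ⟨hinj (e1.trans (h.row_one hij hik hjk).symm), hinj (e2.trans (h.row_two hij).symm),
      hinj (e3.trans (h.row_three hij hik hjk).symm), hinj (e4.trans (h.row_four hij hik hjk).symm)⟩
  refine ⟨hrows, ?_, ?_, ?_⟩
  · rintro rfl i j k hij hik hjk
    obtain ⟨e1, e2, e3, e4⟩ := h.structConst_rows hn hij hik hjk
    obtain ⟨f1, f2, f3, f4⟩ := PointsResolution.rows_four_points h hij hik hjk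
    exact ⟨hinj (e1.trans f1.symm), hinj (e2.trans f2.symm), hinj (e3.trans f3.symm),
      hinj (e4.trans f4.symm)⟩
  · rintro rfl i j k l hij hik hjk hli hlj hlk
    obtain ⟨e1, e2, e3, e4⟩ := h.structConst_rows hn hij hik hjk
    obtain ⟨f1, f2, f3, f4⟩ := PointsResolution.rows_five_points h hij hik hjk hli hlj hlk
    exact ⟨hinj (e1.trans f1.symm), hinj (e2.trans f2.symm), hinj (e3.trans f3.symm),
      hinj (e4.trans f4.symm)⟩
  · intro S hS A _ _ a c₀ ha hmul ν hν
    refine PointsResolution.exists_subalgebra_of_rows S a ha _ c₀ hmul (fun i j k hij hik hjk => ?_)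
      ν hν
    have hint : ∀ (n : ℕ) (l l' : List (Fin (m + 3))),
        (-1) ^ n * (PointsResolution.eps l : K) * F.brace l' ∈ S := fun n l l' =>
      S.mul_mem (S.mul_mem (S.pow_mem (S.neg_mem S.one_mem) n) (intCast_mem S _))
        (F.brace_mem hS l')
    obtain ⟨e1, e2, e3, e4⟩ := hrows i j k hij hik hjk
    refine ⟨e1 ▸ hint _ _ _, ?_, e3 ▸ hint _ _ _, e4 ▸ hint _ _ _⟩
    rw [e2]
    exact S.mul_mem (intCast_mem S _) (F.brace_mem hS _)
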